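/- Let $d\in\{2,3\}$ and let $B\subseteq[0,1]^d$ be an (open or closed) Euclidean ball of positive radius, $f=\chi_B$. For $g:\mathbb R^d\to\mathbb C$, $j\in\mathbb Z$, $k\in\mathbb Z^d$ put $g_{j,k}(x)=2^{jd/2}g(2^jx-k)$. Call $g$ *well localized* if $|g(x)|\le C(1+|x|)^{-m}$ for all $x\in\mathbb R^d$, for some constants $C$ and $m>d+1$ (for instance, $g$ bounded with compact support). A *wavelet basis* of $L^2(\Omega)$, where $\Omega=\mathbb R^d$ or $\Omega=[0,1]^d$, is a Riesz basis $\Phi=(\phi_i)_{i\in I}$ of $L^2(\Omega)$ such that $\Phi$ and its dual basis $\Phi'$ (with $\Phi'=\Phi$ if $\Phi$ is an orthonormal basis) are, with a common indexing, wavelet systems of one and the same of the following types. Here the number $q\ge1$ of generators and the numbers $r\ge 0$, $J$, $R$ and $b_j$ below are common to $\Phi$ and $\Phi'$, whereas the generators may differ. * For $\Omega=\mathbb R^d$: (i) $\{\psi^l_{j,k}: 1\le l\le q,\ j\in\mathbb Z,\ k\in\mathbb Z^d\}$ with well localized $\psi^l$; or (ii) $\{\eta^a_{J,k}:1\le a\le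 r,\ k\in\mathbb Z^d\}\cup\{\psi^l_{j,k}:1\le l\le q,\ j\ge J,\ k\in\mathbb Z^d\}$ with $J\in\mathbb Z$ and well localized $\eta^a,\psi^l$. * For $\Omega=[0,1]^d$: (iii) $r<\infty$ arbitrary functions in $L^2([0,1]^d)$ together with the periodizations $\sum_{z\in\mathbb Z^d}\psi^l_{j,k}(\cdot+z)$, $1\le l\le q$, $j\ge J\ge 0$, $k\in\{0,\dots,2^j-1\}^d$, with well localized $\psi^l$; or (iv) $r<\infty$ arbitrary functions in $L^2([0,1]^d)$ together with, for every $j\ge J\ge 0$, the interior wavelets $\psi^l_{j,k}$, $1\le l\le q$, $R\le k_i\le 2^j-R$ for all $i$, where $\psi^l$ is supported in $[-R,R]^d$, and $b_j=O(2^{j(d-1)})$ boundary wavelets, each of which is supported in a set $\{x\in[0,1]^d:\ \operatorname{dist}(x,y+\mathbb Z^d)\le \rho\,2^{-j}\}$ with $y\in\partial[0,1]^d$ and $\rho$ independent of $j$ and of the boundary wavelet. Then, for every wavelet basis $\Phi$ of $L^2(\mathbb R^d)$ or of $L^2([0,1]^d)$ and every $N\in\mathbb N$, there is a best $N$-term approximation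 to $f$ from $\Phi$, that is, a linear combination $f_N$ of $N$ elements of $\Phi$ such that $\|f-f_N\|_{L^2}\le\|f-g\|_{L^2}$ for every linear combination $g$ of $N$ elements of $\Phi$; and for every choice of best $N$-term approximations $f_N$, $$\|f-f_N\|_{L^2}^2\asymp N^{-\frac1{d-1}}\qquad(N\to\infty),$$ that is, each side is $O$ of the other; the constants may depend on $B$ and $\Phi$. Thus the rate is $N^{-1}$ for $d=2$ and $N^{-1/2}$ for $d=3$. -/

import Mathlib

open MeasureTheory Filter Asymptotics

noncomputable section

namespace WaveletApprox

/-! ### Riesz bases and best `N`-term approximation in a Hilbert space -/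

section Hilbert

variable {ι H : Type*} [NormedAddCommGroup H] [InnerProductSpace ℂ H]

/-- `φ` is a Riesz basis of `H`: its linear span is dense, and the norm of a finite linear
combination is equivalent to the `ℓ²`-norm of its coefficients. Orthonormal bases are the
special case `A = B = 1`. -/
def IsRieszBasis (φ : ι → H) : Prop :=
  (Submodule.span ℂ (Set.range φ)).topologicalClosure = ⊤ ∧
  ∃ A B : ℝ, 0 < A ∧ 0 < B ∧ ∀ (s : Finset ι) (c : ι → ℂ),
    A * ∑ i ∈ s, ‖c i‖ ^ 2 ≤ ‖∑ i ∈ s, c i • φ i‖ ^ 2 ∧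
    ‖∑ i ∈ s, c i • φ i‖ ^ 2 ≤ B * ∑ i ∈ s, ‖c i‖ ^ 2

/-- `φ'` is biorthogonal to `φ`. For a Riesz basis `φ` this says that `φ'` is its dual basis;
if `φ` is an orthonormal basis, then `φ' = φ`. -/
def IsBiorthogonal (φ' φ : ι → H) : Prop :=
  (∀ i, inner ℂ (φ' i) (φ i) = 1) ∧ ∀ i j, i ≠ j → inner ℂ (φ' i) (φ j) = 0

/-- `g` is a best `N`-term approximation to `f` from the system `φ`: it is a linear combination
of `N` elements, and no linear combination of `N` elements is closer to `f`. -/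
def IsBestNTerm (φ : ι → H) (f : H) (N : ℕ) (g : H) : Prop :=
  (∃ (s : Finset ι) (c : ι → ℂ), s.card = N ∧ g = ∑ i ∈ s, c i • φ i) ∧
  ∀ (s : Finset ι) (c : ι → ℂ), s.card = N → ‖f - g‖ ≤ ‖f - ∑ i ∈ s, c i • φ i‖

end Hilbert

/-! ### Dilates and translates -/

/-- The Euclidean space `ℝ^d`. -/
abbrev E (d : ℕ) : Type := EuclideanSpace ℝ (Fin d)

/-- The unit cube `[0,1]^d`. -/
def unitCube (d : ℕ) : Set (E d) := {x | ∀ i, 0 ≤ x i ∧ x i ≤ 1}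

/-- The Hilbert space `L²(ℝ^d)` of complex-valued functions. -/
abbrev L2Space (d : ℕ) : Type := Lp ℂ 2 (volume : Measure (E d))

/-- The Hilbert space `L²([0,1]^d)` of complex-valued functions. -/
abbrev L2Cube (d : ℕ) : Type := Lp ℂ 2 ((volume : Measure (E d)).restrict (unitCube d))

/-- The integer vector `k` as a point of `ℝ^d`. -/
def latticePoint {d : ℕ} (k : Fin d → ℤ) : E d := WithLp.toLp 2 fun i => (k i : ℝ)

/-- `g_{j,k}(x) = 2^{jd/2} g(2^j x - k)`. -/
def dilTrans {d : ℕ} (g : E d → ℂ) (j : ℤ) (k : Fin d → ℤ) : E d → ℂ := fun x =>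
  ((2 : ℝ) ^ ((j : ℝ) * (d : ℝ) / 2)) • g ((2 : ℝ) ^ j • x - latticePoint k)

/-- The `ℤ^d`-periodization of `g_{j,k}`. -/
def periodizedDilTrans {d : ℕ} (g : E d → ℂ) (j : ℤ) (k : Fin d → ℤ) : E d → ℂ := fun x =>
  ∑' z : Fin d → ℤ, dilTrans g j k (x + latticePoint z)

/-- A well localized generator: `|g(x)| ≤ C (1 + |x|)^{-m}` for some `m > d + 1`. Bounded
functions of compact support are well localized. -/
def WellLocalized {d : ℕ} (g : E d → ℂ) : Prop :=
  ∃ C m : ℝ, (d : ℝ) + 1 < m ∧ ∀ x, ‖g x‖ ≤ C * (1 + ‖x‖) ^ (-m)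

/-! ### Wavelet systems on `ℝ^d` -/

/-- Indices `(l, j, k)` of a homogeneous wavelet system with `q` generators. -/
abbrev HomIndex (d q : ℕ) : Type := Fin q × ℤ × (Fin d → ℤ)

/-- `{ψ^l_{j,k} : l < q, j ∈ ℤ, k ∈ ℤ^d}`. -/
def IsHomSystem {d q : ℕ} (φ : HomIndex d q → L2Space d) : Prop :=
  ∃ ψ : Fin q → E d → ℂ, (∀ l, WellLocalized (ψ l)) ∧
    ∀ l j k, φ (l, j, k) =ᵐ[volume] dilTrans (ψ l) j k

/-- Indices of a wavelet system with coarsest scale `J`, `r` scaling functions and `q` wavelets. -/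
abbrev InhomIndex (d r q : ℕ) (J : ℤ) : Type :=
  (Fin r × (Fin d → ℤ)) ⊕ (Fin q × {j : ℤ // J ≤ j} × (Fin d → ℤ))

/-- `{η^a_{J,k} : a < r, k ∈ ℤ^d} ∪ {ψ^l_{j,k} : l < q, j ≥ J, k ∈ ℤ^d}`, with scaling
functions `η^a` and wavelets `ψ^l`. -/
def IsInhomSystem {d r q : ℕ} {J : ℤ} (φ : InhomIndex d r q J → L2Space d) : Prop :=
  ∃ (η : Fin r → E d → ℂ) (ψ : Fin q → E d → ℂ),
    (∀ a, WellLocalized (η a)) ∧ (∀ l, WellLocalized (ψ l)) ∧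
    (∀ a k, φ (Sum.inl (a, k)) =ᵐ[volume] dilTrans (η a) J k) ∧
    ∀ l j k, φ (Sum.inr (l, j, k)) =ᵐ[volume] dilTrans (ψ l) j k

/-- A wavelet basis for `L²(ℝ^d)`: a Riesz basis which, together with its dual basis, is a
wavelet system, either over all scales or with scaling functions at a coarsest scale. Every
orthonormal basis of this form is included (it is its own dual basis). -/
def IsWaveletBasisSpace {d : ℕ} {ι : Type*} (φ : ι → L2Space d) : Prop :=
  IsRieszBasis φ ∧ ∃ φ' : ι → L2Space d, IsBiorthogonal φ' φ ∧
    ((∃ q : ℕ, 0 < q ∧ ∃ e : HomIndex d q ≃ ι,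
        IsHomSystem (φ ∘ e) ∧ IsHomSystem (φ' ∘ e)) ∨
     (∃ (r q : ℕ) (J : ℤ), 0 < q ∧ ∃ e : InhomIndex d r q J ≃ ι,
        IsInhomSystem (φ ∘ e) ∧ IsInhomSystem (φ' ∘ e)))

/-! ### Wavelet systems on `[0,1]^d` -/

/-- Indices of a periodic wavelet system: `r` coarse functions, and `(j, l, k)` with `j ≥ J`,
`l < q` and `k ∈ {0, …, 2^j - 1}^d`. -/
abbrev PerIndex (d r q J : ℕ) : Type :=
  Fin r ⊕ (Σ j : {j : ℕ // J ≤ j}, Fin q × (Fin d → Fin (2 ^ (j : ℕ))))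

/-- Finitely many coarse functions in `L²([0,1]^d)`, and the periodizations of `ψ^l_{j,k}`. -/
def IsPerSystem {d r q J : ℕ} (φ : PerIndex d r q J → L2Cube d) : Prop :=
  ∃ ψ : Fin q → E d → ℂ, (∀ l, WellLocalized (ψ l)) ∧
    ∀ (j : {j : ℕ // J ≤ j}) (l : Fin q) (k : Fin d → Fin (2 ^ (j : ℕ))),
      φ (Sum.inr ⟨j, l, k⟩) =ᵐ[volume.restrict (unitCube d)]
        periodizedDilTrans (ψ l) ((j : ℕ) : ℤ) (fun i => ((k i : ℕ) : ℤ))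

/-- The translation parameters `k` at scale `j` with `R ≤ k_i ≤ 2^j - R` for all `i`; if `g` is
supported in `[-R,R]^d`, then `g_{j,k}` is supported in `[0,1]^d`. -/
abbrev InteriorIndex (d R j : ℕ) : Type :=
  {k : Fin d → ℤ // ∀ i, (R : ℤ) ≤ k i ∧ k i ≤ 2 ^ j - (R : ℤ)}

/-- Indices of a boundary adapted wavelet system: `r` coarse functions, and at each scale `j ≥ J`
the interior wavelets `(l, k)` and `b j` boundary wavelets. -/
abbrev BdryIndex (d r q J R : ℕ) (b : ℕ → ℕ) : Type :=
  Fin r ⊕ (Σ j : {j : ℕ // J ≤ j}, (Fin q × InteriorIndex d R j) ⊕ Fin (b j))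

/-- Finitely many coarse functions in `L²([0,1]^d)`; interior wavelets `ψ^l_{j,k}`, with `ψ^l`
supported in `[-R,R]^d`; and boundary wavelets, each supported in a neighbourhood of size
`ρ 2^{-j}` of a boundary point. The neighbourhood is taken modulo `ℤ^d`, so that a boundary
wavelet may wrap around to the opposite face. -/
def IsBdrySystem {d r q J R : ℕ} {b : ℕ → ℕ} (φ : BdryIndex d r q J R b → L2Cube d) : Prop :=
  (∃ ψ : Fin q → E d → ℂ, (∀ l x, ψ l x ≠ 0 → ∀ i, |x i| ≤ R) ∧
    ∀ (j : {j : ℕ // J ≤ j}) (l : Fin q) (k : InteriorIndex d R j),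
      φ (Sum.inr ⟨j, Sum.inl (l, k)⟩) =ᵐ[volume.restrict (unitCube d)]
        dilTrans (ψ l) ((j : ℕ) : ℤ) k) ∧
  ∃ ρ : ℝ, ∀ (j : {j : ℕ // J ≤ j}) (β : Fin (b j)), ∃ y ∈ frontier (unitCube d),
    ∀ᵐ x ∂(volume.restrict (unitCube d)), φ (Sum.inr ⟨j, Sum.inr β⟩) x ≠ 0 →
      ∃ z : Fin d → ℤ, ‖x - (y + latticePoint z)‖ ≤ ρ * ((2 : ℝ) ^ (j : ℕ))⁻¹

/-- A wavelet basis for `L²([0,1]^d)`: a Riesz basis which, together with its dual basis, is a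
periodic wavelet system, or a boundary adapted wavelet system with `O(2^{j(d-1)})` boundary
wavelets at scale `j`. Every orthonormal basis of this form is included. -/
def IsWaveletBasisCube {d : ℕ} {ι : Type*} (φ : ι → L2Cube d) : Prop :=
  IsRieszBasis φ ∧ ∃ φ' : ι → L2Cube d, IsBiorthogonal φ' φ ∧
    ((∃ r q J : ℕ, 0 < q ∧ ∃ e : PerIndex d r q J ≃ ι,
        IsPerSystem (φ ∘ e) ∧ IsPerSystem (φ' ∘ e)) ∨
     (∃ (r q J R : ℕ) (b : ℕ → ℕ), 0 < q ∧ (∃ C : ℕ, ∀ j, b j ≤ C * 2 ^ (j * (d - 1))) ∧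
        ∃ e : BdryIndex d r q J R b ≃ ι,
          IsBdrySystem (φ ∘ e) ∧ IsBdrySystem (φ' ∘ e)))

/-- Best `N`-term approximations to `f` from `φ` exist for every `N`, and for every choice `f_N`
of them `‖f - f_N‖² ≍ N^{-α}` as `N → ∞`. -/
def BestNTermRate {ι H : Type*} [NormedAddCommGroup H] [InnerProductSpace ℂ H]
    (φ : ι → H) (f : H) (α : ℝ) : Prop :=
  (∀ N : ℕ, ∃ g, IsBestNTerm φ f N g) ∧
  ∀ fN : ℕ → H, (∀ N, IsBestNTerm φ f N (fN N)) →
    (fun N : ℕ => ‖f - fN N‖ ^ 2) =Θ[atTop] fun N : ℕ => (N : ℝ) ^ (-α)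

end WaveletApprox

end

namespace WaveletApprox

/-! ### Riesz bases: coefficients and best approximation -/

section RieszBasis

variable {ι H : Type*} [NormedAddCommGroup H] [InnerProductSpace ℂ H] {φ φ' : ι → H}

/-! Write c_i = ⟨φ'_i, f⟩ with φ' the dual basis. By the Riesz property a squared error is
comparable to the ℓ² sum of the coefficient errors, so the best N-term error is governed by how many
c_i exceed a given size.

For a dual wavelet of scale j and translation k on ℝ^d, a change of variables shows that |c_i| is
2^{-jd/2} times the modulus of the integral of its generator ψ over the ball of centre 2^j x₀ - k
and radius 2^j ρ. If ψ has mean zero, this is small unless k lies near the sphere of radius 2^j ρ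
about 2^j x₀, and only of order 2^{j(d-1)} lattice points do. So scale j carries about 2^{j(d-1)}
coefficients of size 2^{-jd/2}, whose squares add up to 2^{-j}; spending N ≈ 2^{J(d-1)} terms on the
scales up to J leaves 2^{-J} ≈ N^{-1/(d-1)}. `Sparse` and `Abundant` record the two halves of this
count, and `bestNTermRate_of_sparse_of_abundant` turns them into the rate.

Sparsity comes from `WellLocalized.ballDecay`, `BallDecay.tsum_le` and `sparse_of_levels`. The
vanishing mean is not assumed: otherwise about 2^{jd} translates well inside the ball would have
coefficients of size 2^{-jd/2} at every fine scale, against Bessel (`Tracks.integral_eq_zero`).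
Boundary wavelets are few enough to need no cancellation (`sparse_boundary`).

For abundance the integrals near the sphere must not all be small. A nonzero ψ has a nonzero
integral over some half-space, by uniqueness of characteristic functions, and the normal ν can be
taken with irrational slope. Seen from a lattice point near the sphere, a huge ball looks like a
half-space, and irrationality lets lattice points realise the right offset within bounded distance
of any point (`exists_many_large_integrals`). As ν is not parallel to an axis, the spherical cap
used stays inside the cube even if the ball touches its faces; there periodic and interior wavelets
behave as on ℝ^d. Best approximations exist by weak compactness. -/

theorem IsBiorthogonal.inner_sum [DecidableEq ι] (hb : IsBiorthogonal φ' φ) (s : Finset ι)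
    (c : ι → ℂ) (i : ι) :
    inner ℂ (φ' i) (∑ j ∈ s, c j • φ j) = if i ∈ s then c i else 0 := by
  rw [_root_.inner_sum]
  simp only [inner_smul_right]
  split_ifs with hi
  · rw [Finset.sum_eq_single_of_mem i hi]
    · rw [hb.1 i, mul_one]
    · intro j _ hj
      rw [hb.2 i j hj.symm, mul_zero]
  · refine Finset.sum_eq_zero fun j hj => ?_
    rw [hb.2 i j (fun h => hi (h ▸ hj)), mul_zero]

theorem IsBiorthogonal.eq_sum_of_mem_span (hb : IsBiorthogonal φ' φ) {h : H}
    (hh : h ∈ Submodule.span ℂ (Set.range φ)) :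
    ∃ s : Finset ι, h = ∑ i ∈ s, inner ℂ (φ' i) h • φ i ∧ ∀ i ∉ s, inner ℂ (φ' i) h = 0 := by
  classical
  obtain ⟨c, rfl⟩ := (Finsupp.mem_span_range_iff_exists_finsupp).1 hh
  refine ⟨c.support, ?_, ?_⟩
  · rw [Finsupp.sum]
    refine Finset.sum_congr rfl fun i hi => ?_
    rw [hb.inner_sum, if_pos hi]
  · intro i hi
    rw [Finsupp.sum, hb.inner_sum, if_neg hi]

/-- On the span the pairings with `φ'` are the coefficients, so this is the lower Riesz bound; for a
fixed finite `t` both sides are continuous in `h`, and the span is dense. -/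
theorem bessel_of_lower (hb : IsBiorthogonal φ' φ)
    (hd : (Submodule.span ℂ (Set.range φ)).topologicalClosure = ⊤) {A : ℝ} (hA : 0 < A)
    (hl : ∀ (s : Finset ι) (c : ι → ℂ), A * ∑ i ∈ s, ‖c i‖ ^ 2 ≤ ‖∑ i ∈ s, c i • φ i‖ ^ 2)
    (t : Finset ι) (h : H) : A * ∑ i ∈ t, ‖inner ℂ (φ' i) h‖ ^ 2 ≤ ‖h‖ ^ 2 := by
  have hd' : Dense (Submodule.span ℂ (Set.range φ) : Set H) :=
    (Submodule.dense_iff_topologicalClosure_eq_top).2 hd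
  refine hd'.induction (P := fun h => A * ∑ i ∈ t, ‖inner ℂ (φ' i) h‖ ^ 2 ≤ ‖h‖ ^ 2) ?_ ?_ h
  · intro h hh
    obtain ⟨s, hs, hs0⟩ := hb.eq_sum_of_mem_span hh
    calc A * ∑ i ∈ t, ‖inner ℂ (φ' i) h‖ ^ 2 ≤ A * ∑ i ∈ s, ‖inner ℂ (φ' i) h‖ ^ 2 := by
          gcongr 1
          classical
          rw [← Finset.sum_filter_add_sum_filter_not t (· ∈ s),
            Finset.sum_eq_zero (s := t.filter (· ∉ s)), add_zero]
          · exact Finset.sum_le_sum_of_subset_of_nonneg (by intro i; simp)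
              fun _ _ _ => by positivity
          · intro i hi
            rw [hs0 i (Finset.mem_filter.1 hi).2]; simp
      _ ≤ ‖∑ i ∈ s, inner ℂ (φ' i) h • φ i‖ ^ 2 := hl s _
      _ = ‖h‖ ^ 2 := by rw [← hs]
  · exact isClosed_le (by fun_prop) (by fun_prop)

/-- Series expansions are avoided: `h` is approximated by `h'` in the span, to which the upper Riesz
bound applies, and the coefficients of `h' - h` are controlled by Bessel. The factor 4 stems from
using (a + b)² ≤ 2a² + 2b² twice. -/
theorem norm_sq_le_of_upper (hb : IsBiorthogonal φ' φ)
    (hd : (Submodule.span ℂ (Set.range φ)).topologicalClosure = ⊤) {A B : ℝ} (hA : 0 < A)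
    (hB : 0 < B)
    (hl : ∀ (s : Finset ι) (c : ι → ℂ), A * ∑ i ∈ s, ‖c i‖ ^ 2 ≤ ‖∑ i ∈ s, c i • φ i‖ ^ 2)
    (hu : ∀ (s : Finset ι) (c : ι → ℂ), ‖∑ i ∈ s, c i • φ i‖ ^ 2 ≤ B * ∑ i ∈ s, ‖c i‖ ^ 2)
    (h : H) {M : ℝ} (hM : ∀ t : Finset ι, ∑ i ∈ t, ‖inner ℂ (φ' i) h‖ ^ 2 ≤ M) :
    ‖h‖ ^ 2 ≤ 4 * B * M := by
  have hd' : Dense (Submodule.span ℂ (Set.range φ) : Set H) :=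
    (Submodule.dense_iff_topologicalClosure_eq_top).2 hd
  have key : ∀ ε : ℝ, 0 < ε → ‖h‖ ^ 2 ≤ 4 * B * M + (4 * B / A + 2) * ε ^ 2 := by
    intro ε hε
    obtain ⟨h', hh', hdist⟩ := hd'.exists_dist_lt h hε
    obtain ⟨s, hs, -⟩ := hb.eq_sum_of_mem_span hh'
    have h1 : ‖h‖ ^ 2 ≤ 2 * ‖h'‖ ^ 2 + 2 * ε ^ 2 := by
      have : ‖h‖ ≤ ‖h'‖ + ε := by
        calc ‖h‖ = ‖h' + (h - h')‖ := by congr 1; abel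
          _ ≤ ‖h'‖ + ‖h - h'‖ := norm_add_le _ _
          _ ≤ _ := by rw [← dist_eq_norm]; gcongr
      nlinarith [sq_nonneg (‖h'‖ - ε), norm_nonneg h, norm_nonneg h']
    have h2 : ‖h'‖ ^ 2 ≤ B * ∑ i ∈ s, ‖inner ℂ (φ' i) h'‖ ^ 2 := by
      conv_lhs => rw [hs]
      exact hu s _
    have h3 : ∑ i ∈ s, ‖inner ℂ (φ' i) h'‖ ^ 2 ≤
        2 * ∑ i ∈ s, ‖inner ℂ (φ' i) h‖ ^ 2 + 2 * ∑ i ∈ s, ‖inner ℂ (φ' i) (h' - h)‖ ^ 2 := by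
      rw [Finset.mul_sum, Finset.mul_sum, ← Finset.sum_add_distrib]
      refine Finset.sum_le_sum fun i _ => ?_
      have : ‖inner ℂ (φ' i) h'‖ ≤ ‖inner ℂ (φ' i) h‖ + ‖inner ℂ (φ' i) (h' - h)‖ := by
        refine le_trans (le_of_eq ?_) (norm_add_le _ _)
        rw [← inner_add_right]; congr 2; abel
      nlinarith [sq_nonneg (‖inner ℂ (φ' i) h‖ - ‖inner ℂ (φ' i) (h' - h)‖),
        norm_nonneg (inner ℂ (φ' i) h')]
    have h4 : ∑ i ∈ s, ‖inner ℂ (φ' i) (h' - h)‖ ^ 2 ≤ ε ^ 2 / A := by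
      rw [le_div_iff₀ hA, mul_comm]
      refine (bessel_of_lower hb hd hA hl s _).trans ?_
      rw [dist_comm, dist_eq_norm] at hdist
      gcongr
    have h5 := hM s
    calc ‖h‖ ^ 2 ≤ 2 * (B * (2 * M + 2 * (ε ^ 2 / A))) + 2 * ε ^ 2 := by
          refine h1.trans ?_
          gcongr
          refine h2.trans ?_
          gcongr
          exact h3.trans (by gcongr)
      _ = _ := by ring
  have hlim : Tendsto (fun ε : ℝ => 4 * B * M + (4 * B / A + 2) * ε ^ 2) (nhdsWithin 0 (Set.Ioi 0))
      (nhds (4 * B * M)) := by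
    refine tendsto_nhdsWithin_of_tendsto_nhds ?_
    have : Continuous fun ε : ℝ => 4 * B * M + (4 * B / A + 2) * ε ^ 2 := by fun_prop
    simpa using this.tendsto 0
  exact ge_of_tendsto hlim (eventually_nhdsWithin_of_forall fun ε hε => key ε hε)

theorem IsRieszBasis.exists_coefficient_bounds (hφ : IsRieszBasis φ) (hb : IsBiorthogonal φ' φ) :
    ∃ A B : ℝ, 0 < A ∧ 0 < B ∧
      (∀ (t : Finset ι) (h : H), A * ∑ i ∈ t, ‖inner ℂ (φ' i) h‖ ^ 2 ≤ ‖h‖ ^ 2) ∧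
      ∀ (h : H) (M : ℝ), (∀ t : Finset ι, ∑ i ∈ t, ‖inner ℂ (φ' i) h‖ ^ 2 ≤ M) →
        ‖h‖ ^ 2 ≤ B * M := by
  obtain ⟨hd, A, B, hA, hB, h⟩ := hφ
  exact ⟨A, 4 * B, hA, by positivity, bessel_of_lower hb hd hA fun s c => (h s c).1,
    fun x M hM => norm_sq_le_of_upper hb hd hA hB (fun s c => (h s c).1) (fun s c => (h s c).2) x hM⟩

theorem IsRieszBasis.eq_zero_of_inner (hφ : IsRieszBasis φ) (hb : IsBiorthogonal φ' φ) {h : H}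
    (hh : ∀ i, inner ℂ (φ' i) h = 0) : h = 0 := by
  obtain ⟨A, B, _, _, _, hu⟩ := hφ.exists_coefficient_bounds hb
  have := hu h 0 (fun t => by simp [hh])
  have h0 : ‖h‖ ^ 2 = 0 := le_antisymm (by simpa using this) (by positivity)
  simpa using h0

/-- The dual elements are uniformly bounded. -/
theorem IsRieszBasis.exists_norm_dual_le (hφ : IsRieszBasis φ) (hb : IsBiorthogonal φ' φ) :
    ∃ M : ℝ, 0 ≤ M ∧ ∀ i, ‖φ' i‖ ≤ M := by
  obtain ⟨A, B, hA, _, hl, _⟩ := hφ.exists_coefficient_bounds hb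
  refine ⟨Real.sqrt (1 / A), Real.sqrt_nonneg _, fun i => ?_⟩
  -- Bessel for the vector `φ' i` and the single index `i` reads A ‖φ' i‖⁴ ≤ ‖φ' i‖².
  have h := hl {i} (φ' i)
  rw [Finset.sum_singleton, inner_self_eq_norm_sq_to_K] at h
  have h1 : A * (‖φ' i‖ ^ 2) ^ 2 ≤ ‖φ' i‖ ^ 2 := by simpa using h
  apply Real.le_sqrt_of_sq_le
  rw [le_div_iff₀ hA]
  by_contra hc
  push Not at hc
  have hpos : 0 < ‖φ' i‖ ^ 2 := by
    by_contra h0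
    nlinarith [sq_nonneg ‖φ' i‖]
  nlinarith

/-- Direct method. The combinations of `N` elements form a set that is not convex but is weakly
closed, since it is cut out by the condition that among any `N + 1` dual functionals one vanishes.
Closed balls are weak-* compact in the dual of `H`, and the distance to `f` is weak-* lower
semicontinuous. -/
theorem IsRieszBasis.exists_isBestNTerm [CompleteSpace H] [Infinite ι] (hφ : IsRieszBasis φ)
    (hb : IsBiorthogonal φ' φ) (f : H) (N : ℕ) : ∃ g, IsBestNTerm φ f N g := by
  classical
  let D := InnerProductSpace.toDual ℂ H
  let W : Set (WeakDual ℂ H) := ⋂ T : {T : Finset ι // T.card = N + 1}, ⋃ i ∈ T.1, {w | w (φ' i) = 0}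
  have hW : IsClosed W := by
    refine isClosed_iInter fun T => ?_
    refine Set.Finite.isClosed_biUnion (Finset.finite_toSet T.1) fun i _ => ?_
    exact isClosed_eq (WeakDual.eval_continuous _) continuous_const
  let dist' : WeakDual ℂ H → ℝ := fun w => ‖WeakDual.toStrongDual w - D f‖
  have hlsc : LowerSemicontinuous dist' := by
    rw [lowerSemicontinuous_iff_isClosed_preimage]
    intro y
    convert WeakDual.isClosed_closedBall (D f) y using 1
    ext w
    simp [dist', dist_eq_norm]
  have h0W : (0 : WeakDual ℂ H) ∈ W := by
    simp only [W, Set.mem_iInter, Set.mem_iUnion]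
    intro T
    obtain ⟨i, hi⟩ := Finset.card_pos.1 (by rw [T.2]; omega : 0 < T.1.card)
    exact ⟨i, hi, rfl⟩
  -- Zero is a competitor, so nothing outside the ball of radius `‖f‖` about `f` can be better.
  let K : Set (WeakDual ℂ H) :=
    W ∩ WeakDual.toStrongDual ⁻¹' Metric.closedBall (D f) ‖f‖
  have hK : IsCompact K := (WeakDual.isCompact_closedBall (𝕜 := ℂ) (D f) ‖f‖).inter_left hW
  have h0K : (0 : WeakDual ℂ H) ∈ K := ⟨h0W, by simp [D]⟩
  obtain ⟨w, hwK, hmin⟩ := LowerSemicontinuousOn.exists_isMinOn ⟨0, h0K⟩ hK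
    (hlsc.lowerSemicontinuousOn K)
  have hmin' : ∀ v ∈ W, dist' w ≤ dist' v := by
    intro v hv
    by_cases hvK : v ∈ K
    · exact hmin hvK
    · have h1 : ‖f‖ < dist' v := by
        by_contra hc
        exact hvK ⟨hv, by simpa [dist', dist_eq_norm] using hc⟩
      have h2 : dist' w ≤ ‖f‖ := by simpa [dist', dist_eq_norm] using hwK.2
      linarith
  have hdist : ∀ h : H, dist' (StrongDual.toWeakDual (D h)) = ‖f - h‖ := by
    intro h
    have : dist' (StrongDual.toWeakDual (D h)) = ‖D h - D f‖ := rfl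
    rw [this, ← map_sub, LinearIsometryEquiv.norm_map, norm_sub_rev]
  let g : H := D.symm (WeakDual.toStrongDual w)
  have hDg : StrongDual.toWeakDual (D g) = w := by
    simp only [g, LinearIsometryEquiv.apply_symm_apply]; rfl
  have hwg : ∀ x, w x = inner ℂ g x := by
    intro x; rw [← hDg]; rfl
  have hcomb : ∀ (s : Finset ι) (c : ι → ℂ), s.card = N →
      StrongDual.toWeakDual (D (∑ i ∈ s, c i • φ i)) ∈ W := by
    intro s c hs
    simp only [W, Set.mem_iInter, Set.mem_iUnion]
    intro T
    obtain ⟨i, hiT, his⟩ := Finset.exists_mem_notMem_of_card_lt_card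
      (by rw [hs, T.2]; omega : s.card < T.1.card)
    refine ⟨i, hiT, ?_⟩
    have : inner ℂ (φ' i) (∑ j ∈ s, c j • φ j) = 0 := by rw [hb.inner_sum, if_neg his]
    exact (inner_eq_zero_symm.1 this)
  refine ⟨g, ?_, fun s c hs => ?_⟩
  -- More than `N` nonzero coefficients of the minimiser would provide `N + 1` indices violating
  -- membership in `W`.
  · have hfin : {i | inner ℂ (φ' i) g ≠ 0}.Finite ∧ {i | inner ℂ (φ' i) g ≠ 0}.ncard ≤ N := by
      by_contra hc
      have : ∃ T : Finset ι, T.card = N + 1 ∧ (T : Set ι) ⊆ {i | inner ℂ (φ' i) g ≠ 0} := by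
        by_cases hf : {i | inner ℂ (φ' i) g ≠ 0}.Finite
        · have hlt : N + 1 ≤ hf.toFinset.card := by
            rw [← Set.ncard_eq_toFinset_card _ hf]
            by_contra h; exact hc ⟨hf, by omega⟩
          obtain ⟨T, hT, hTc⟩ := Finset.exists_subset_card_eq hlt
          exact ⟨T, hTc, Set.Finite.subset_toFinset.1 hT⟩
        · obtain ⟨T, hT, hTc⟩ := Set.Infinite.exists_subset_card_eq hf (N + 1)
          exact ⟨T, hTc, hT⟩
      obtain ⟨T, hTc, hT⟩ := this
      have hw := hwK.1
      simp only [W, Set.mem_iInter, Set.mem_iUnion] at hw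
      obtain ⟨i, hiT, hi⟩ := hw ⟨T, hTc⟩
      have hi' : w (φ' i) = 0 := hi
      rw [hwg] at hi'
      exact hT hiT (inner_eq_zero_symm.1 hi')
    -- The support is padded with zero coefficients to exactly `N` indices; this is where `ι` must
    -- be infinite.
    obtain ⟨s, hs, hsN⟩ := Infinite.exists_superset_card_eq hfin.1.toFinset N
      (by rw [← Set.ncard_eq_toFinset_card _ hfin.1]; exact hfin.2)
    refine ⟨s, fun i => inner ℂ (φ' i) g, hsN, ?_⟩
    rw [← sub_eq_zero]
    apply hφ.eq_zero_of_inner hb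
    intro i
    rw [inner_sub_right, hb.inner_sum]
    split_ifs with hi
    · simp
    · have : i ∉ hfin.1.toFinset := fun h => hi (hs h)
      simp only [Set.Finite.mem_toFinset, Set.mem_ofPred_eq, not_not] at this
      rw [this, sub_zero]
  · have := hmin' _ (hcomb s c hs)
    rwa [hdist, ← hDg, hdist] at this

end RieszBasis

open scoped ENNReal

/-! ### Sparse and abundant coefficient families -/

section Sparse

variable {ι : Type*}

/-- The coefficient family `c` is sparse in dimension `d`: truncating the squared moduli at height
`2^{-Jd}` leaves a total of order `2^{-J}`. -/
def Sparse (d : ℕ) (c : ι → ℂ) : Prop :=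
  ∃ C : ℝ≥0∞, C ≠ ∞ ∧ ∀ J : ℕ,
    ∑' i, min (‖c i‖ₑ ^ (2 : ℝ)) ((2 : ℝ≥0∞) ^ (-(d * J : ℝ))) ≤ C * (2 : ℝ≥0∞) ^ (-(J : ℝ))

/-- The coefficient family `c` has at least of order `2^{j(d-1)}` entries of modulus at least
of order `2^{-jd/2}`. -/
def Abundant (d : ℕ) (c : ι → ℂ) : Prop :=
  ∃ κ : ℝ, 0 < κ ∧ ∀ᶠ j : ℕ in atTop, ∃ T : Finset ι, κ * (2 ^ j) ^ (d - 1) ≤ (T.card : ℝ) ∧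
    ∀ i ∈ T, κ * ((2 ^ j) ^ d)⁻¹ ≤ ‖c i‖ ^ 2

theorem Sparse.comp_injective {κ : Type*} {d : ℕ} {c : ι → ℂ} (h : Sparse d c) {e : κ → ι}
    (he : Function.Injective e) : Sparse d (fun k => c (e k)) := by
  obtain ⟨C, hC, h⟩ := h
  refine ⟨C, hC, fun J => le_trans ?_ (h J)⟩
  exact ENNReal.tsum_comp_le_tsum_of_injective he
    (fun i => min (‖c i‖ₑ ^ (2 : ℝ)) ((2 : ℝ≥0∞) ^ (-(d * J : ℝ))))

/-- The truncated sum is subadditive over finite covers, disjoint or not, so each generator can be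
treated separately. -/
theorem Sparse.of_cover {L : Type*} [Fintype L] {κ : L → Type*} {d : ℕ} {c : ι → ℂ}
    (e : ∀ l, κ l → ι) (he : ∀ i, ∃ l k, e l k = i) (h : ∀ l, Sparse d (fun k => c (e l k))) :
    Sparse d c := by
  choose C hC h using h
  refine ⟨∑ l, C l, by simp [hC], fun J => ?_⟩
  have hs : Function.Surjective (fun p : Σ l, κ l => e p.1 p.2) := by
    intro i
    obtain ⟨l, k, rfl⟩ := he i
    exact ⟨⟨l, k⟩, rfl⟩
  refine (ENNReal.tsum_le_tsum_comp_of_surjective hs _).trans ?_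
  rw [ENNReal.tsum_sigma (fun l k => min (‖c (e l k)‖ₑ ^ (2 : ℝ)) ((2 : ℝ≥0∞) ^ (-(d * J : ℝ)))),
    tsum_fintype, Finset.sum_mul]
  exact Finset.sum_le_sum fun l _ => h l J

/-- Interpolation: write the minimum as its powers `s / 2` and `(2 - s) / 2`, and bound one factor
by each argument. -/
theorem min_rpow_two_le {a t : ℝ≥0∞} {s : ℝ} (hs : 0 ≤ s) (hs2 : s ≤ 2) :
    min (a ^ (2 : ℝ)) t ≤ a ^ s * t ^ ((2 - s) / 2) := by
  have h1 : min (a ^ (2 : ℝ)) t =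
      min (a ^ (2 : ℝ)) t ^ (s / 2) * min (a ^ (2 : ℝ)) t ^ ((2 - s) / 2) := by
    rw [← ENNReal.rpow_add_of_nonneg _ _ (by linarith) (by linarith)]
    ring_nf
    simp
  rw [h1]
  gcongr
  · calc min (a ^ (2 : ℝ)) t ^ (s / 2) ≤ (a ^ (2 : ℝ)) ^ (s / 2) := by
          gcongr; exact min_le_left _ _
      _ = a ^ s := by rw [← ENNReal.rpow_mul]; ring_nf
  · exact min_le_right _ _

theorem two_rpow_ne_top (x : ℝ) : (2 : ℝ≥0∞) ^ x ≠ ∞ := by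
  simp

theorem two_rpow_add (x y : ℝ) : (2 : ℝ≥0∞) ^ (x + y) = 2 ^ x * 2 ^ y :=
  ENNReal.rpow_add _ _ two_ne_zero (by simp)

/-- Interpolating with the threshold 2^{-dJ} gains 2^{-dJ(2-s)/2}, and d(2-s)/2 ≥ 1 for d ≥ 2 and s
≤ 1. This handles families without fine scales, where no cancellation is available. -/
theorem sparse_of_tsum_rpow {d : ℕ} (hd : 2 ≤ d) {c : ι → ℂ} {s : ℝ} (hs : 0 ≤ s) (hs1 : s ≤ 1)
    (h : ∑' i, ‖c i‖ₑ ^ s ≠ ∞) : Sparse d c := by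
  refine ⟨_, h, fun J => ?_⟩
  calc _ ≤ ∑' i, ‖c i‖ₑ ^ s * ((2 : ℝ≥0∞) ^ (-(d * J : ℝ))) ^ ((2 - s) / 2) :=
        ENNReal.tsum_le_tsum fun i => min_rpow_two_le hs (by linarith)
    _ = (∑' i, ‖c i‖ₑ ^ s) * (2 : ℝ≥0∞) ^ (-(d * J : ℝ) * ((2 - s) / 2)) := by
        rw [ENNReal.tsum_mul_right, ← ENNReal.rpow_mul]
    _ ≤ _ := by
        gcongr
        · norm_num
        have h2 : (2 : ℝ) ≤ d := by exact_mod_cast hd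
        have h3 : (0 : ℝ) ≤ J := by positivity
        nlinarith [mul_nonneg h3 (mul_nonneg (by linarith : 0 ≤ (d : ℝ) - 2)
          (by linarith : 0 ≤ 1 - s)), mul_nonneg h3 (by linarith : 0 ≤ 1 - s),
          mul_nonneg h3 (by linarith : 0 ≤ (d : ℝ) - 2)]

theorem tsum_int_geometric_ne_top {δ : ℝ} (hδ : 0 < δ) :
    ∑' z : ℤ, (if 0 ≤ z then (2 : ℝ≥0∞) ^ (-(z : ℝ)) else (2 : ℝ≥0∞) ^ (δ * z)) ≠ ∞ := by
  rw [tsum_of_nat_of_neg_add_one ENNReal.summable ENNReal.summable]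
  have h1 : ∀ n : ℕ, (if 0 ≤ (n : ℤ) then (2 : ℝ≥0∞) ^ (-((n : ℤ) : ℝ))
      else (2 : ℝ≥0∞) ^ (δ * ((n : ℤ) : ℝ))) = ((2 : ℝ≥0∞) ^ (-1 : ℝ)) ^ n := by
    intro n
    rw [if_pos (by positivity), ← ENNReal.rpow_natCast, ← ENNReal.rpow_mul]
    simp
  have h2 : ∀ n : ℕ, (if 0 ≤ (-((n : ℤ) + 1) : ℤ) then (2 : ℝ≥0∞) ^ (-((-((n : ℤ) + 1) : ℤ) : ℝ))
      else (2 : ℝ≥0∞) ^ (δ * ((-((n : ℤ) + 1) : ℤ) : ℝ)))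
        = (2 : ℝ≥0∞) ^ (-δ) * ((2 : ℝ≥0∞) ^ (-δ)) ^ n := by
    intro n
    rw [if_neg (by omega), ← pow_succ', ← ENNReal.rpow_natCast, ← ENNReal.rpow_mul]
    push_cast
    ring_nf
  have hlt : ∀ x : ℝ, 0 < x → (1 - (2 : ℝ≥0∞) ^ (-x))⁻¹ ≠ ∞ := by
    intro x hx
    rw [ne_eq, ENNReal.inv_eq_top, tsub_eq_zero_iff_le, not_le]
    exact ENNReal.rpow_lt_one_of_one_lt_of_neg (by norm_num) (by linarith)
  simp_rw [h1, h2]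
  rw [ENNReal.tsum_mul_left, ENNReal.tsum_geometric, ENNReal.tsum_geometric]
  exact ENNReal.add_ne_top.2 ⟨hlt 1 one_pos, ENNReal.mul_ne_top (two_rpow_ne_top _) (hlt δ hδ)⟩

/-- A family organised in levels is sparse if level `n` has entries of size `O(2^{-nd/2})` and,
up to the decay measured by the `ℓ^s` norm, only `O(2^{n(d-1)})` of them. -/
theorem sparse_of_levels {β : Type*} {K : β → Type*} {lev : β → ℕ} (hlev : Function.Injective lev)
    {d : ℕ} (hd : 2 ≤ d) {c : (Σ b, K b) → ℂ} {s : ℝ} (hs : 0 < s) (hs1 : s < 1)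
    {C : ℝ≥0∞} (hC : C ≠ ∞)
    (h1 : ∀ b, ∑' k, ‖c ⟨b, k⟩‖ₑ ^ s ≤ C * (2 : ℝ≥0∞) ^ ((d - 1 - d * s / 2) * lev b : ℝ))
    (h2 : ∀ b k, ‖c ⟨b, k⟩‖ₑ ≤ C * (2 : ℝ≥0∞) ^ (-(d / 2 * lev b) : ℝ)) :
    Sparse d c := by
  have hd' : (2 : ℝ) ≤ d := by exact_mod_cast hd
  -- The ℓ^s sum of level n grows like 2^{δn}; `δ` is positive because s < 1 and d ≥ 2.
  set δ : ℝ := d - 1 - d * s / 2 with hδ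
  have hδ0 : 0 < δ := by nlinarith
  let G : ℤ → ℝ≥0∞ := fun z => if 0 ≤ z then (2 : ℝ≥0∞) ^ (-(z : ℝ)) else (2 : ℝ≥0∞) ^ (δ * z)
  have hG : ∑' z, G z ≠ ∞ := tsum_int_geometric_ne_top hδ0
  let D : ℝ≥0∞ := C * C ^ (2 - s) + C
  have hD : D ≠ ∞ := ENNReal.add_ne_top.2
    ⟨ENNReal.mul_ne_top hC (ENNReal.rpow_ne_top_of_nonneg (by linarith) hC), hC⟩
  refine ⟨D * ∑' z, G z, ENNReal.mul_ne_top hD hG, fun J => ?_⟩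
  -- At levels n ≥ J the truncation is dropped: the squares add up to O(2^{-n}), from the ℓ^s bound
  -- and the uniform bound. At n < J interpolation with the threshold gives O(2^{-J} 2^{δ(n-J)}).
  -- Both are geometric in |n - J|.
  have key : ∀ b, ∑' k, min (‖c ⟨b, k⟩‖ₑ ^ (2 : ℝ)) ((2 : ℝ≥0∞) ^ (-(d * J : ℝ)))
      ≤ D * (2 : ℝ≥0∞) ^ (-(J : ℝ)) * G ((lev b : ℤ) - J) := by
    intro b
    by_cases hbJ : (0 : ℤ) ≤ (lev b : ℤ) - J
    · have hGb : G ((lev b : ℤ) - J) = (2 : ℝ≥0∞) ^ (-((lev b : ℝ) - J)) := by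
        simp only [G, if_pos hbJ]; push_cast; rfl
      calc _ ≤ ∑' k, ‖c ⟨b, k⟩‖ₑ ^ s * (C * (2 : ℝ≥0∞) ^ (-(d / 2 * lev b) : ℝ)) ^ (2 - s) := by
            refine ENNReal.tsum_le_tsum fun k => (min_le_left _ _).trans ?_
            calc ‖c ⟨b, k⟩‖ₑ ^ (2 : ℝ) = ‖c ⟨b, k⟩‖ₑ ^ s * ‖c ⟨b, k⟩‖ₑ ^ (2 - s) := by
                  rw [← ENNReal.rpow_add_of_nonneg _ _ hs.le (by linarith)]; ring_nf
              _ ≤ _ := by gcongr 2; · linarith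
                          · exact h2 b k
        _ ≤ (C * (2 : ℝ≥0∞) ^ (δ * lev b : ℝ)) *
              (C ^ (2 - s) * (2 : ℝ≥0∞) ^ (-(d / 2 * lev b) * (2 - s) : ℝ)) := by
            rw [ENNReal.tsum_mul_right, ENNReal.mul_rpow_of_nonneg _ _ (by linarith),
              ← ENNReal.rpow_mul]
            gcongr
            exact h1 b
        _ = C * C ^ (2 - s) * ((2 : ℝ≥0∞) ^ (-(J : ℝ)) * G ((lev b : ℤ) - J)) := by
            rw [hGb, ← two_rpow_add, mul_mul_mul_comm, ← two_rpow_add]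
            congr 2
            rw [hδ]; ring
        _ ≤ D * ((2 : ℝ≥0∞) ^ (-(J : ℝ)) * G ((lev b : ℤ) - J)) := by
            gcongr; exact le_self_add
        _ = _ := by rw [mul_assoc]
    · have hGb : G ((lev b : ℤ) - J) = (2 : ℝ≥0∞) ^ (δ * ((lev b : ℝ) - J)) := by
        simp only [G, if_neg hbJ]; push_cast; rfl
      calc _ ≤ ∑' k, ‖c ⟨b, k⟩‖ₑ ^ s * ((2 : ℝ≥0∞) ^ (-(d * J : ℝ))) ^ ((2 - s) / 2) :=
            ENNReal.tsum_le_tsum fun k => min_rpow_two_le hs.le (by linarith)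
        _ ≤ (C * (2 : ℝ≥0∞) ^ (δ * lev b : ℝ)) * (2 : ℝ≥0∞) ^ (-(d * J : ℝ) * ((2 - s) / 2)) := by
            rw [ENNReal.tsum_mul_right, ← ENNReal.rpow_mul]
            gcongr
            exact h1 b
        _ = C * ((2 : ℝ≥0∞) ^ (-(J : ℝ)) * G ((lev b : ℤ) - J)) := by
            rw [hGb, ← two_rpow_add, mul_assoc, ← two_rpow_add]
            congr 2
            rw [hδ]; ring
        _ ≤ D * ((2 : ℝ≥0∞) ^ (-(J : ℝ)) * G ((lev b : ℤ) - J)) := by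
            gcongr; exact le_add_self
        _ = _ := by rw [mul_assoc]
  rw [ENNReal.tsum_sigma (fun b k => min (‖c ⟨b, k⟩‖ₑ ^ (2 : ℝ)) ((2 : ℝ≥0∞) ^ (-(d * J : ℝ))))]
  calc _ ≤ ∑' b, D * (2 : ℝ≥0∞) ^ (-(J : ℝ)) * G ((lev b : ℤ) - J) := ENNReal.tsum_le_tsum key
    _ = D * (2 : ℝ≥0∞) ^ (-(J : ℝ)) * ∑' b, G ((lev b : ℤ) - J) := ENNReal.tsum_mul_left
    _ ≤ D * (2 : ℝ≥0∞) ^ (-(J : ℝ)) * ∑' z, G z := by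
        gcongr
        refine ENNReal.tsum_comp_le_tsum_of_injective (f := fun b => (lev b : ℤ) - J) ?_ G
        intro b b' h
        exact hlev (by simpa using h)
    _ = _ := by ring

/-- An entry above the threshold contributes 2^{-dJ} to the truncated sum, so there are at most C
2^{J(d-1)} of them; every other entry contributes its full square. -/
theorem Sparse.exists_finset {d : ℕ} (hd : 2 ≤ d) {c : ι → ℂ} (h : Sparse d c) :
    ∃ K : ℝ, 1 ≤ K ∧ ∀ J : ℕ, ∃ s : Finset ι, (s.card : ℝ) ≤ K * (2 ^ J) ^ (d - 1) ∧
      ∀ t : Finset ι, Disjoint t s → ∑ i ∈ t, ‖c i‖ ^ 2 ≤ K * (2 ^ J)⁻¹ := by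
  obtain ⟨C, hC, h⟩ := h
  lift C to NNReal using hC
  refine ⟨max C 1, le_max_right _ _, fun J => ?_⟩
  have hthr : (2 : ℝ≥0∞) ^ (-(d * J : ℝ)) ≠ 0 := by simp
  have hCJ : (C : ℝ≥0∞) * (2 : ℝ≥0∞) ^ (-(J : ℝ)) ≠ ∞ :=
    ENNReal.mul_ne_top ENNReal.coe_ne_top (two_rpow_ne_top _)
  obtain ⟨hf, hcard⟩ := ENNReal.finset_card_const_le_le_of_tsum_le hCJ (h J) hthr
  refine ⟨hf.toFinset, ?_, fun t ht => ?_⟩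
  · have h1 : ((hf.toFinset.card : ℕ) : ℝ≥0∞) ≤ C * (2 : ℝ≥0∞) ^ (((J * (d - 1) : ℕ)) : ℝ) := by
      refine hcard.trans (le_of_eq ?_)
      rw [ENNReal.div_eq_inv_mul, ← ENNReal.rpow_neg, mul_left_comm, ← two_rpow_add]
      congr 2
      push_cast [Nat.cast_sub (by omega : 1 ≤ d)]
      ring
    rw [ENNReal.rpow_natCast] at h1
    have h2 : (hf.toFinset.card : ℝ) ≤ C * 2 ^ (J * (d - 1)) := by exact_mod_cast h1
    calc _ ≤ _ := h2
      _ ≤ _ := by rw [pow_mul]; gcongr; exact le_max_left _ _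
  · have h1 : ∑ i ∈ t, ‖c i‖ₑ ^ (2 : ℝ) ≤ C * (2 : ℝ≥0∞) ^ (-(J : ℝ)) := by
      calc _ = ∑ i ∈ t, min (‖c i‖ₑ ^ (2 : ℝ)) ((2 : ℝ≥0∞) ^ (-(d * J : ℝ))) := by
            refine Finset.sum_congr rfl fun i hi => ?_
            have : i ∉ hf.toFinset := Finset.disjoint_left.1 ht hi
            simp only [Set.Finite.mem_toFinset, Set.mem_ofPred_eq, not_le] at this
            rw [min_eq_left]
            by_contra hcon
            push Not at hcon
            rw [min_eq_right hcon.le] at this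
            exact lt_irrefl _ this
        _ ≤ _ := (ENNReal.sum_le_tsum t).trans (h J)
    rw [ENNReal.rpow_neg, ENNReal.rpow_natCast] at h1
    have h2 : ∑ i ∈ t, ‖c i‖ₑ ^ (2 : ℝ) = ENNReal.ofReal (∑ i ∈ t, ‖c i‖ ^ 2) := by
      rw [ENNReal.ofReal_sum_of_nonneg (fun _ _ => by positivity)]
      refine Finset.sum_congr rfl fun i _ => ?_
      rw [ENNReal.ofReal_pow (norm_nonneg _), ofReal_norm]
      norm_cast
    rw [h2] at h1
    have h3 : ENNReal.ofReal (∑ i ∈ t, ‖c i‖ ^ 2) ≤ ENNReal.ofReal (C * (2 ^ J)⁻¹) := by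
      refine h1.trans (le_of_eq ?_)
      rw [ENNReal.ofReal_mul (by positivity), ENNReal.ofReal_inv_of_pos (by positivity),
        ENNReal.ofReal_pow (by norm_num)]
      simp
    rw [ENNReal.ofReal_le_ofReal_iff (by positivity)] at h3
    exact h3.trans (by gcongr; exact le_max_left _ _)

end Sparse

/-! ### From the size distribution of the coefficients to the approximation rate -/

section Rate

variable {ι H : Type*} [NormedAddCommGroup H] [InnerProductSpace ℂ H] {φ φ' : ι → H}

/-- Sparse and abundant coefficients determine the rate of best `N`-term approximation. -/
theorem bestNTermRate_of_sparse_of_abundant [CompleteSpace H] [Infinite ι] (hφ : IsRieszBasis φ)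
    (hb : IsBiorthogonal φ' φ) {d : ℕ} (hd : 2 ≤ d) (f : H)
    (hs : Sparse d (fun i => inner ℂ (φ' i) f)) (ha : Abundant d (fun i => inner ℂ (φ' i) f)) :
    BestNTermRate φ f (1 / ((d : ℝ) - 1)) := by
  classical
  refine ⟨hφ.exists_isBestNTerm hb f, fun fN hfN => ?_⟩
  obtain ⟨A, B, hA, hB, hl, hu⟩ := hφ.exists_coefficient_bounds hb
  set α : ℝ := 1 / ((d : ℝ) - 1) with hα
  have hd1 : ((d - 1 : ℕ) : ℝ) = (d : ℝ) - 1 := by push_cast [Nat.cast_sub (by omega : 1 ≤ d)]; rfl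
  have hd2 : (2 : ℝ) ≤ d := by exact_mod_cast hd
  have hdpos : 0 < (d : ℝ) - 1 := by linarith
  have hαpos : 0 < α := by positivity
  have hpow : ∀ x : ℝ, 0 ≤ x → (x ^ α) ^ (d - 1) = x := by
    intro x hx
    rw [← Real.rpow_natCast, ← Real.rpow_mul hx, hd1, hα, one_div, inv_mul_cancel₀ hdpos.ne',
      Real.rpow_one]
  have hcoef : ∀ (s : Finset ι) (a : ι → ℂ) i, inner ℂ (φ' i) (f - ∑ j ∈ s, a j • φ j) =
      inner ℂ (φ' i) f - if i ∈ s then a i else 0 := by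
    intro s a i
    rw [inner_sub_right, hb.inner_sum]
  constructor
  · obtain ⟨K, hK1, hK⟩ := hs.exists_finset hd
    refine IsBigO.of_bound (B * K * 2 * K ^ α) ?_
    filter_upwards [eventually_ge_atTop ⌈K⌉₊] with N hN
    have hNK : K ≤ N := (Nat.le_ceil K).trans (by exact_mod_cast hN)
    have hK0 : 0 < K := by linarith
    have hN0 : (0 : ℝ) < N := by linarith
    have hx1 : 1 ≤ ((N : ℝ) / K) ^ α := Real.one_le_rpow ((one_le_div hK0).2 hNK) hαpos.le
    -- `J` is the largest scale for which the K 2^{J(d-1)} large coefficients fit into the budget of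
    -- `N` terms.
    obtain ⟨J, hJ1, hJ2⟩ := exists_nat_pow_near hx1 (by norm_num : (1 : ℝ) < 2)
    obtain ⟨s, hsc, hst⟩ := hK J
    have hsN : s.card ≤ N := by
      have : (s.card : ℝ) ≤ N := by
        calc (s.card : ℝ) ≤ K * (2 ^ J) ^ (d - 1) := hsc
          _ ≤ K * (((N : ℝ) / K) ^ α) ^ (d - 1) := by gcongr
          _ = N := by rw [hpow _ (by positivity)]; field_simp
      exact_mod_cast this
    obtain ⟨s', hss', hs'N⟩ := Infinite.exists_superset_card_eq s N hsN
    have h1 := (hfN N).2 s' (fun i => inner ℂ (φ' i) f) hs'N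
    have h2 : ‖f - ∑ i ∈ s', inner ℂ (φ' i) f • φ i‖ ^ 2 ≤ B * (K * (2 ^ J)⁻¹) := by
      refine hu _ _ fun t => ?_
      rw [← Finset.sum_filter_add_sum_filter_not t (· ∈ s'), Finset.sum_eq_zero, zero_add]
      · refine le_trans (Finset.sum_le_sum fun i hi => ?_)
          (hst (t.filter (· ∉ s')) ?_)
        · rw [hcoef, if_neg (Finset.mem_filter.1 hi).2, sub_zero]
        · rw [Finset.disjoint_left]
          intro i hi his
          exact (Finset.mem_filter.1 hi).2 (hss' his)
      · intro i hi
        rw [hcoef, if_pos (Finset.mem_filter.1 hi).2, sub_self]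
        simp
    have hNα : (0 : ℝ) < (N : ℝ) ^ (-α) := by positivity
    rw [Real.norm_of_nonneg (by positivity), Real.norm_of_nonneg hNα.le]
    calc ‖f - fN N‖ ^ 2 ≤ ‖f - ∑ i ∈ s', inner ℂ (φ' i) f • φ i‖ ^ 2 := by gcongr
      _ ≤ B * (K * (2 ^ J)⁻¹) := h2
      _ ≤ B * (K * (2 * (((N : ℝ) / K) ^ α)⁻¹)) := by
          gcongr
          rw [← div_eq_mul_inv, le_div_iff₀ (by positivity), inv_mul_le_iff₀ (by positivity)]
          rw [pow_succ] at hJ2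
          exact hJ2.le
      _ = _ := by
          rw [Real.div_rpow hN0.le hK0.le, Real.rpow_neg hN0.le]
          field_simp
  · obtain ⟨κ, hκ, hev⟩ := ha
    obtain ⟨j0, hj0⟩ := eventually_atTop.1 hev
    refine IsBigO.of_bound (A * (κ / 2 * κ) * (2 * (2 / κ) ^ α)⁻¹)⁻¹ ?_
    have hlarge : Tendsto (fun N : ℕ => (2 / κ * (N : ℝ)) ^ α) atTop atTop :=
      (tendsto_rpow_atTop hαpos).comp
        (tendsto_natCast_atTop_atTop.const_mul_atTop (by positivity))
    filter_upwards [eventually_ge_atTop 1, hlarge.eventually_ge_atTop (2 ^ j0)] with N hN1 hNj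
    have hN0 : (0 : ℝ) < N := by exact_mod_cast hN1
    have hx1 : 1 ≤ (2 / κ * (N : ℝ)) ^ α := le_trans (one_le_pow₀ (by norm_num)) hNj
    -- `j + 1` is the first scale at which the abundant set is sure to have at least 2N members;
    -- `hNj` makes it at least `j0`.
    obtain ⟨j, hj1, hj2⟩ := exists_nat_pow_near hx1 (by norm_num : (1 : ℝ) < 2)
    have hjj : j0 ≤ j + 1 := by
      by_contra hcon
      have : (2 : ℝ) ^ (j + 1) ≤ 2 ^ j0 := pow_le_pow_right₀ (by norm_num) (by omega)
      linarith
    obtain ⟨T, hTc, hT⟩ := hj0 (j + 1) hjj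
    obtain ⟨⟨s, a, hsN, hfs⟩, -⟩ := hfN N
    have h2N : 2 * (N : ℝ) ≤ κ * (2 ^ (j + 1)) ^ (d - 1) := by
      calc 2 * (N : ℝ) = κ * ((2 / κ * (N : ℝ)) ^ α) ^ (d - 1) := by
            rw [hpow _ (by positivity)]; field_simp
        _ ≤ _ := by gcongr
    -- The `N` indices used remove at most half of `T`, and each index left contributes its full
    -- coefficient to the error.
    have hcard : κ / 2 * (2 ^ (j + 1)) ^ (d - 1) ≤ ((T \ s).card : ℝ) := by
      have : T.card ≤ (T \ s).card + s.card := by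
        have := Finset.le_card_sdiff s T
        omega
      have : (T.card : ℝ) ≤ (T \ s).card + N := by rw [← hsN]; exact_mod_cast this
      linarith
    have h3 : A * (κ / 2 * κ) * (2 ^ (j + 1))⁻¹ ≤ ‖f - fN N‖ ^ 2 := by
      rw [hfs]
      refine le_trans ?_ (hl (T \ s) _)
      rw [mul_assoc]
      gcongr
      calc κ / 2 * κ * (2 ^ (j + 1))⁻¹
          = (κ / 2 * (2 ^ (j + 1)) ^ (d - 1)) * (κ * ((2 ^ (j + 1)) ^ d)⁻¹) := by
            obtain ⟨e, rfl⟩ : ∃ e, d = e + 1 := ⟨d - 1, by omega⟩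
            rw [Nat.add_sub_cancel, pow_succ _ e]
            field_simp
        _ ≤ ((T \ s).card : ℝ) * (κ * ((2 ^ (j + 1)) ^ d)⁻¹) := by gcongr
        _ = ∑ i ∈ T \ s, κ * ((2 ^ (j + 1)) ^ d)⁻¹ := by rw [Finset.sum_const, nsmul_eq_mul]
        _ ≤ _ := by
            refine Finset.sum_le_sum fun i hi => ?_
            rw [hcoef, if_neg (Finset.mem_sdiff.1 hi).2, sub_zero]
            exact hT i (Finset.mem_sdiff.1 hi).1
    rw [Real.norm_of_nonneg (by positivity), Real.norm_of_nonneg (by positivity),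
      inv_mul_eq_div, le_div_iff₀ (by positivity)]
    calc (N : ℝ) ^ (-α) * (A * (κ / 2 * κ) * (2 * (2 / κ) ^ α)⁻¹)
        = A * (κ / 2 * κ) * (2 * (2 / κ * (N : ℝ)) ^ α)⁻¹ := by
          rw [Real.mul_rpow (by positivity) hN0.le, Real.rpow_neg hN0.le, mul_inv, mul_inv, mul_inv]
          ring
      _ ≤ A * (κ / 2 * κ) * (2 ^ (j + 1))⁻¹ := by
          gcongr
          rw [pow_succ, mul_comm]
          gcongr
      _ ≤ _ := h3

end Rate

/-! ### Counting lattice points in spherical shells -/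

section Lattice

variable {d : ℕ}

theorem exists_volume_real_ball (hd : 2 ≤ d) :
    ∃ V : ℝ, 0 < V ∧ ∀ (x : E d) (r : ℝ), 0 ≤ r → volume.real (Metric.ball x r) = V * r ^ d := by
  have : Nonempty (Fin d) := ⟨⟨0, by omega⟩⟩
  refine ⟨volume.real (Metric.ball (0 : E d) 1), ?_, fun x r hr => ?_⟩
  · exact ENNReal.toReal_pos (Metric.measure_ball_pos _ _ one_pos).ne' measure_ball_lt_top.ne
  · rw [Measure.real, Measure.real, EuclideanSpace.volume_ball, EuclideanSpace.volume_ball,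
      ENNReal.toReal_mul, ENNReal.toReal_mul, ENNReal.toReal_pow, ENNReal.toReal_ofReal hr]
    simp [mul_comm]

theorem latticePoint_apply (k : Fin d → ℤ) (i : Fin d) : latticePoint k i = (k i : ℝ) := rfl

theorem latticePoint_add (k l : Fin d → ℤ) :
    latticePoint (k + l) = latticePoint k + latticePoint l := by
  ext i; simp [latticePoint_apply]

theorem latticePoint_sub (k l : Fin d → ℤ) :
    latticePoint (k - l) = latticePoint k - latticePoint l := by
  ext i; simp [latticePoint_apply]

theorem abs_apply_le_norm (x : E d) (i : Fin d) : |x i| ≤ ‖x‖ := by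
  simpa using PiLp.norm_apply_le x i

theorem one_le_norm_latticePoint_sub {k l : Fin d → ℤ} (h : k ≠ l) :
    1 ≤ ‖latticePoint k - latticePoint l‖ := by
  obtain ⟨i, hi⟩ := Function.ne_iff.1 h
  refine le_trans ?_ (abs_apply_le_norm _ i)
  rw [PiLp.sub_apply, latticePoint_apply, latticePoint_apply, ← Int.cast_sub, ← Int.cast_abs]
  exact_mod_cast Int.one_le_abs (sub_ne_zero.2 hi)

theorem pow_sub_pow_le_mul {a b : ℝ} (hb : 0 ≤ b) (hab : b ≤ a) (n : ℕ) :
    a ^ (n + 1) - b ^ (n + 1) ≤ (n + 1) * (a - b) * a ^ n := by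
  induction n with
  | zero => simp
  | succ n ih =>
    have h1 : b ^ (n + 1) ≤ a ^ (n + 1) := pow_le_pow_left₀ hb hab _
    have h2 : 0 ≤ a := hb.trans hab
    push_cast
    have h3 := mul_le_mul_of_nonneg_left ih h2
    have h4 := mul_le_mul_of_nonneg_left h1 (sub_nonneg.2 hab)
    calc a ^ (n + 1 + 1) - b ^ (n + 1 + 1)
        = a * (a ^ (n + 1) - b ^ (n + 1)) + (a - b) * b ^ (n + 1) := by ring
      _ ≤ a * ((n + 1) * (a - b) * a ^ n) + (a - b) * a ^ (n + 1) := by linarith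
      _ = _ := by ring

/-- Balls of radius 1/2 about distinct lattice points are disjoint, and those about points of the
shell lie in the annulus with radii n - 1/2 and n + 3/2. Comparing volumes gives the bound,
uniformly in the centre `c`. -/
theorem card_shell_le (hd : 2 ≤ d) (c : E d) (n : ℕ) (T : Finset (Fin d → ℤ))
    (hT : ∀ k ∈ T, ⌊‖c - latticePoint k‖⌋₊ = n) :
    (T.card : ℝ) ≤ (2 ^ d * (2 * d) * 2 ^ (d - 1)) * ((n : ℝ) + 1) ^ (d - 1) := by
  obtain ⟨V, hV, hball⟩ := exists_volume_real_ball hd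
  have hn : ∀ k ∈ T, (n : ℝ) ≤ ‖c - latticePoint k‖ ∧ ‖c - latticePoint k‖ < n + 1 := by
    intro k hk
    have := hT k hk
    rw [Nat.floor_eq_iff (norm_nonneg _)] at this
    exact this
  -- For n = 0 the inner radius would be negative; clipping it at 0 keeps the width at most 2.
  set b : ℝ := max ((n : ℝ) - 1 / 2) 0 with hbdef
  have hb0 : 0 ≤ b := le_max_right _ _
  set a : ℝ := (n : ℝ) + 3 / 2 with ha
  have hba : b ≤ a := max_le (by linarith) (by positivity)
  have hab2 : a - b ≤ 2 := by
    have : (n : ℝ) - 1 / 2 ≤ b := le_max_left _ _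
    linarith
  let U : Set (E d) := ⋃ k ∈ T, Metric.ball (latticePoint k) (1 / 2)
  have hUm : MeasurableSet U := Finset.measurableSet_biUnion _ fun _ _ => measurableSet_ball
  have hpd : (T : Set (Fin d → ℤ)).PairwiseDisjoint
      (fun k => Metric.ball (latticePoint k : E d) (1 / 2)) := by
    intro k _ l _ hkl
    refine Metric.ball_disjoint_ball ?_
    rw [dist_eq_norm]
    have := one_le_norm_latticePoint_sub hkl
    linarith
  have hUvol : volume.real U = T.card * (V * (1 / 2) ^ d) := by
    rw [measureReal_biUnion_finset hpd (fun _ _ => measurableSet_ball)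
      (fun _ _ => measure_ball_lt_top.ne), Finset.sum_congr rfl
      (fun k _ => hball (latticePoint k) (1 / 2) (by norm_num)), Finset.sum_const, nsmul_eq_mul]
  have hUdisj : Disjoint U (Metric.ball c b) := by
    rw [Set.disjoint_left]
    intro x hx hxb
    simp only [U, Set.mem_iUnion, Metric.mem_ball, dist_eq_norm] at hx hxb
    obtain ⟨k, hk, hxk⟩ := hx
    have h1 := (hn k hk).1
    have h2 : ‖c - latticePoint k‖ ≤ ‖x - c‖ + ‖x - latticePoint k‖ := by
      rw [norm_sub_rev x c]
      exact norm_sub_le_norm_sub_add_norm_sub _ _ _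
    rcases le_total ((n : ℝ) - 1 / 2) 0 with h | h
    · have : b = 0 := max_eq_right h
      have := norm_nonneg (x - c)
      linarith
    · have : b = (n : ℝ) - 1 / 2 := max_eq_left h
      linarith
  have hsub : U ∪ Metric.ball c b ⊆ Metric.ball c a := by
    refine Set.union_subset ?_ (Metric.ball_subset_ball hba)
    intro x hx
    simp only [U, Set.mem_iUnion, Metric.mem_ball, dist_eq_norm] at hx ⊢
    obtain ⟨k, hk, hxk⟩ := hx
    have h1 := (hn k hk).2
    have h2 : ‖x - c‖ ≤ ‖x - latticePoint k‖ + ‖latticePoint k - c‖ :=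
      norm_sub_le_norm_sub_add_norm_sub _ _ _
    rw [norm_sub_rev (latticePoint k) c] at h2
    linarith
  have hle : T.card * (V * (1 / 2) ^ d) + V * b ^ d ≤ V * a ^ d := by
    rw [← hUvol, ← hball c b hb0, ← hball c a (hb0.trans hba),
      ← measureReal_union hUdisj measurableSet_ball
        ((measure_mono (Set.subset_union_left.trans hsub)).trans_lt measure_ball_lt_top).ne
        measure_ball_lt_top.ne]
    exact measureReal_mono hsub measure_ball_lt_top.ne
  have hle2 : (T.card : ℝ) ≤ 2 ^ d * (a ^ d - b ^ d) := by
    have h2 : (T.card : ℝ) * (1 / 2) ^ d ≤ a ^ d - b ^ d := by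
      have : V * (T.card * (1 / 2) ^ d) ≤ V * (a ^ d - b ^ d) := by linarith
      exact le_of_mul_le_mul_left this hV
    calc (T.card : ℝ) = 2 ^ d * (T.card * (1 / 2) ^ d) := by
          rw [mul_left_comm, ← mul_pow]; norm_num
      _ ≤ _ := by gcongr
  obtain ⟨e, rfl⟩ : ∃ e, d = e + 1 := ⟨d - 1, by omega⟩
  calc (T.card : ℝ) ≤ 2 ^ (e + 1) * (((e : ℝ) + 1) * (a - b) * a ^ e) :=
        hle2.trans (by gcongr; exact pow_sub_pow_le_mul hb0 hba e)
    _ ≤ 2 ^ (e + 1) * (((e : ℝ) + 1) * 2 * (2 * ((n : ℝ) + 1)) ^ e) := by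
        have : a ≤ 2 * ((n : ℝ) + 1) := by
          have : (0 : ℝ) ≤ n := by positivity
          linarith
        have := hb0.trans hba
        gcongr
    _ = _ := by rw [Nat.add_sub_cancel, mul_pow]; push_cast; ring

/-- Grouping the lattice points by the integer part of their distance to `c` reduces a radial
lattice sum to a weighted sum over ℕ. -/
theorem tsum_lattice_le (hd : 2 ≤ d) : ∃ C : ℝ, 0 ≤ C ∧ ∀ (c : E d) (h : ℕ → ℝ≥0∞),
    ∑' k : Fin d → ℤ, h ⌊‖c - latticePoint k‖⌋₊ ≤
      ∑' n : ℕ, ENNReal.ofReal (C * ((n : ℝ) + 1) ^ (d - 1)) * h n := by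
  refine ⟨2 ^ d * (2 * d) * 2 ^ (d - 1), by positivity, fun c h => ?_⟩
  rw [← ENNReal.tsum_fiberwise _ (fun k : Fin d → ℤ => ⌊‖c - latticePoint k‖⌋₊)]
  refine ENNReal.tsum_le_tsum fun n => ?_
  rw [ENNReal.tsum_eq_iSup_sum]
  refine iSup_le fun T => ?_
  have h1 : ∀ b ∈ T, h ⌊‖c - latticePoint (b : Fin d → ℤ)‖⌋₊ = h n := by
    intro b _
    have := b.2
    simp only [Set.mem_preimage, Set.mem_singleton_iff] at this
    rw [this]
  rw [Finset.sum_congr rfl h1, Finset.sum_const, nsmul_eq_mul]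
  gcongr
  have := card_shell_le hd c n (T.map (Function.Embedding.subtype _)) (by
    intro k hk
    obtain ⟨b, _, rfl⟩ := Finset.mem_map.1 hk
    exact b.2)
  rw [Finset.card_map] at this
  rw [← ENNReal.ofReal_natCast]
  exact ENNReal.ofReal_le_ofReal this

theorem tsum_nat_one_add_rpow_ne_top {a : ℝ} (ha : 1 < a) :
    ∑' n : ℕ, ENNReal.ofReal ((1 + (n : ℝ)) ^ (-a)) ≠ ∞ := by
  apply Summable.tsum_ofReal_ne_top
  have := (summable_nat_add_iff 1).2 (Real.summable_nat_rpow.2 (by linarith : -a < -1))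
  refine this.congr fun n => ?_
  push_cast
  rw [add_comm]

theorem tsum_int_one_add_rpow_ne_top {a : ℝ} (ha : 1 < a) :
    ∑' n : ℤ, ENNReal.ofReal ((1 + |(n : ℝ)|) ^ (-a)) ≠ ∞ := by
  rw [tsum_of_nat_of_neg_add_one ENNReal.summable ENNReal.summable]
  refine ENNReal.add_ne_top.2 ⟨?_, ?_⟩
  · refine ne_top_of_le_ne_top (tsum_nat_one_add_rpow_ne_top ha) (ENNReal.tsum_le_tsum fun n => ?_)
    simp
  · refine ne_top_of_le_ne_top (tsum_nat_one_add_rpow_ne_top ha) (ENNReal.tsum_le_tsum fun n => ?_)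
    refine ENNReal.ofReal_le_ofReal ?_
    rw [Int.cast_neg, abs_neg]
    push_cast
    rw [abs_of_nonneg (by positivity)]
    exact Real.rpow_le_rpow_of_nonpos (by positivity) (by linarith) (by linarith)

theorem tsum_lattice_one_add_norm_rpow_ne_top (hd : 2 ≤ d) {a : ℝ} (ha : (d : ℝ) < a) :
    ∑' k : Fin d → ℤ, ENNReal.ofReal ((1 + ‖(latticePoint k : E d)‖) ^ (-a)) ≠ ∞ := by
  obtain ⟨C, hC, h⟩ := tsum_lattice_le hd
  have hd2 : (2 : ℝ) ≤ d := by exact_mod_cast hd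
  have h1 := h 0 (fun n => ENNReal.ofReal ((1 + (n : ℝ)) ^ (-a)))
  refine ne_top_of_le_ne_top (b := ENNReal.ofReal C *
    ∑' n : ℕ, ENNReal.ofReal ((1 + (n : ℝ)) ^ (-(a - (d - 1))))) ?_ ?_
  · exact ENNReal.mul_ne_top ENNReal.ofReal_ne_top (tsum_nat_one_add_rpow_ne_top (by linarith))
  calc _ ≤ ∑' k : Fin d → ℤ,
        ENNReal.ofReal ((1 + ((⌊‖(0 : E d) - latticePoint k‖⌋₊ : ℕ) : ℝ)) ^ (-a)) := by
        refine ENNReal.tsum_le_tsum fun k => ENNReal.ofReal_le_ofReal ?_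
        refine Real.rpow_le_rpow_of_nonpos (by positivity) ?_ (by linarith)
        gcongr
        rw [zero_sub, norm_neg]
        exact Nat.floor_le (norm_nonneg _)
    _ ≤ _ := h1
    _ ≤ _ := by
        rw [← ENNReal.tsum_mul_left]
        refine ENNReal.tsum_le_tsum fun n => ?_
        rw [← ENNReal.ofReal_mul (by positivity), ← ENNReal.ofReal_mul hC]
        refine ENNReal.ofReal_le_ofReal (le_of_eq ?_)
        rw [mul_assoc, ← Real.rpow_natCast, add_comm (n : ℝ) 1, ← Real.rpow_add (by positivity)]
        congr 2
        push_cast [Nat.cast_sub (by omega : 1 ≤ d)]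
        ring

end Lattice

/-! ### Integrals of a generator over balls -/

section BallDecay

variable {d : ℕ}

/-- The integrals of `ψ` over balls of radius `r ≥ ρ` decay with the distance of the sphere to
the origin, and also with the distance of the centre to the origin. -/
def BallDecay (ρ : ℝ) (ψ : E d → ℂ) : Prop :=
  ∃ C β : ℝ, 0 ≤ C ∧ 1 < β ∧ ∀ (c : E d) (r : ℝ), ρ ≤ r →
    ‖∫ x in Metric.ball c r, ψ x‖ ≤ C * (1 + |‖c‖ - r|) ^ (-β) * (r / (‖c‖ + r)) ^ d

/-- In ℓ^s the lattice translates count like the r^{d-1} ones near the sphere. Decay away from the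
sphere makes the sum over shells converge, and the decay in ‖c - k‖ offsets the growing number of
points in distant shells. -/
theorem BallDecay.tsum_le (hd : 2 ≤ d) {ρ : ℝ} (hρ : 0 < ρ) {ψ : E d → ℂ}
    (h : BallDecay ρ ψ) : ∃ s : ℝ, 0 < s ∧ s < 1 ∧ ∃ C : ℝ≥0∞, C ≠ ∞ ∧
      ∀ (c : E d) (r : ℝ), ρ ≤ r →
        ∑' k : Fin d → ℤ, ‖∫ x in Metric.ball (c - latticePoint k) r, ψ x‖ₑ ^ s ≤
          C * ENNReal.ofReal (r ^ (d - 1)) := by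
  obtain ⟨C, β, hC, hβ, h⟩ := h
  obtain ⟨L, hL, hlat⟩ := tsum_lattice_le hd
  have hd2 : (2 : ℝ) ≤ d := by exact_mod_cast hd
  -- s < 1 must be close enough to 1 that βs > 1, for summability across shells, and ds > d - 1, to
  -- absorb the shell count (n + 1)^{d-1}.
  obtain ⟨s, hs, hs1⟩ : ∃ s : ℝ, max (1 / β) (((d : ℝ) - 1) / d) < s ∧ s < 1 := by
    refine exists_between (max_lt ?_ ?_)
    · rw [div_lt_one (by linarith)]; exact hβ
    · rw [div_lt_one (by linarith)]; linarith
  have hs2 : 1 < β * s := by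
    have := (le_max_left _ _).trans_lt hs
    rwa [div_lt_iff₀ (by linarith), mul_comm] at this
  have hs3 : (d : ℝ) - 1 < d * s := by
    have := (le_max_right _ _).trans_lt hs
    rwa [div_lt_iff₀ (by linarith), mul_comm] at this
  have hs0 : 0 < s := by
    by_contra hcon
    nlinarith
  let M : ℝ := C ^ s * 2 ^ (β * s) * (1 + 1 / ρ) ^ (d - 1)
  have hM : 0 ≤ M := by positivity
  let S : ℝ≥0∞ := ∑' n : ℤ, ENNReal.ofReal ((1 + |(n : ℝ)|) ^ (-(β * s)))
  have hS : S ≠ ∞ := tsum_int_one_add_rpow_ne_top hs2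
  refine ⟨s, hs0, hs1, ENNReal.ofReal (L * M) * S, ENNReal.mul_ne_top ENNReal.ofReal_ne_top hS,
    fun c r hr => ?_⟩
  have hr0 : 0 < r := hρ.trans_le hr
  -- Distances and radius are replaced by their integer parts; the loss of at most 1 in their
  -- difference costs the factor 2^{βs}.
  let H : ℕ → ℝ := fun n =>
    M * r ^ (d - 1) * (((n : ℝ) + 1) ^ (d - 1))⁻¹ * (1 + |((n - ⌊r⌋₊ : ℤ) : ℝ)|) ^ (-(β * s))
  have hterm : ∀ k : Fin d → ℤ, ‖∫ x in Metric.ball (c - latticePoint k) r, ψ x‖ₑ ^ s ≤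
      ENNReal.ofReal (H ⌊‖c - latticePoint k‖⌋₊) := by
    intro k
    rw [← ofReal_norm, ENNReal.ofReal_rpow_of_nonneg (norm_nonneg _) hs0.le]
    refine ENNReal.ofReal_le_ofReal ?_
    set u := ‖c - latticePoint k‖ with hu
    have hu0 : 0 ≤ u := norm_nonneg _
    have hn1 : ((⌊u⌋₊ : ℕ) : ℝ) ≤ u := Nat.floor_le hu0
    have hn2 : u < (⌊u⌋₊ : ℕ) + 1 := Nat.lt_floor_add_one u
    have hr1 : ((⌊r⌋₊ : ℕ) : ℝ) ≤ r := Nat.floor_le hr0.le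
    have hr2 : r < (⌊r⌋₊ : ℕ) + 1 := Nat.lt_floor_add_one r
    have habs : |(((⌊u⌋₊ : ℕ) - (⌊r⌋₊ : ℕ) : ℤ) : ℝ)| ≤ |u - r| + 1 := by
      push_cast
      rw [abs_le]
      constructor
      · linarith [neg_abs_le (u - r)]
      · linarith [le_abs_self (u - r)]
    have e1 : (1 + |u - r|) ^ (-(β * s)) ≤
        2 ^ (β * s) * (1 + |(((⌊u⌋₊ : ℕ) - (⌊r⌋₊ : ℕ) : ℤ) : ℝ)|) ^ (-(β * s)) := by
      calc (1 + |u - r|) ^ (-(β * s))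
          ≤ ((1 + |(((⌊u⌋₊ : ℕ) - (⌊r⌋₊ : ℕ) : ℤ) : ℝ)|) / 2) ^ (-(β * s)) := by
            refine Real.rpow_le_rpow_of_nonpos (by positivity) ?_ (by linarith)
            linarith [abs_nonneg (u - r)]
        _ = _ := by
            rw [Real.div_rpow (by positivity) (by norm_num), Real.rpow_neg (by norm_num : (0:ℝ) ≤ 2)]
            field_simp
    have e2 : ((r / (u + r)) ^ d) ^ s ≤
        (1 + 1 / ρ) ^ (d - 1) * r ^ (d - 1) * (((⌊u⌋₊ : ℝ) + 1) ^ (d - 1))⁻¹ := by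
      have hq0 : 0 < r / (u + r) := by positivity
      calc ((r / (u + r)) ^ d) ^ s = (r / (u + r)) ^ ((d : ℝ) * s) := by
            rw [← Real.rpow_natCast, ← Real.rpow_mul hq0.le]
        _ ≤ (r / (u + r)) ^ (((d - 1 : ℕ)) : ℝ) := by
            refine Real.rpow_le_rpow_of_exponent_ge hq0 ?_ ?_
            · rw [div_le_one (by positivity)]; linarith
            · push_cast [Nat.cast_sub (by omega : 1 ≤ d)]; linarith
        _ ≤ ((1 + 1 / ρ) * r / ((⌊u⌋₊ : ℝ) + 1)) ^ (d - 1) := by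
            rw [Real.rpow_natCast]
            gcongr 1
            rw [div_le_div_iff₀ (by positivity) (by positivity)]
            have : 1 ≤ r / ρ := (one_le_div hρ).2 hr
            have h5 : (⌊u⌋₊ : ℝ) + 1 ≤ (1 + 1 / ρ) * (u + r) := by
              have : (1 + 1 / ρ) * (u + r) = u + r + u / ρ + r / ρ := by ring
              rw [this]
              have : 0 ≤ u / ρ := by positivity
              linarith
            nlinarith
        _ = _ := by rw [div_pow, mul_pow, div_eq_mul_inv]
    calc ‖∫ x in Metric.ball (c - latticePoint k) r, ψ x‖ ^ s
        ≤ (C * (1 + |u - r|) ^ (-β) * (r / (u + r)) ^ d) ^ s := by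
          gcongr; exact h _ r hr
      _ = C ^ s * (1 + |u - r|) ^ (-(β * s)) * ((r / (u + r)) ^ d) ^ s := by
          rw [Real.mul_rpow (by positivity) (by positivity), Real.mul_rpow hC (by positivity),
            ← Real.rpow_mul (by positivity), neg_mul]
      _ ≤ C ^ s * (2 ^ (β * s) * (1 + |(((⌊u⌋₊ : ℕ) - (⌊r⌋₊ : ℕ) : ℤ) : ℝ)|) ^ (-(β * s))) *
          ((1 + 1 / ρ) ^ (d - 1) * r ^ (d - 1) * (((⌊u⌋₊ : ℝ) + 1) ^ (d - 1))⁻¹) := by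
          gcongr
      _ = H ⌊u⌋₊ := by simp only [H, M]; ring
  calc _ ≤ ∑' k : Fin d → ℤ, ENNReal.ofReal (H ⌊‖c - latticePoint k‖⌋₊) :=
        ENNReal.tsum_le_tsum hterm
    _ ≤ ∑' n : ℕ, ENNReal.ofReal (L * ((n : ℝ) + 1) ^ (d - 1)) * ENNReal.ofReal (H n) :=
        hlat c fun n => ENNReal.ofReal (H n)
    _ = ∑' n : ℕ, ENNReal.ofReal (L * M) * ENNReal.ofReal (r ^ (d - 1)) *
          ENNReal.ofReal ((1 + |((n - ⌊r⌋₊ : ℤ) : ℝ)|) ^ (-(β * s))) := by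
        refine tsum_congr fun n => ?_
        rw [← ENNReal.ofReal_mul (by positivity), ← ENNReal.ofReal_mul (by positivity),
          ← ENNReal.ofReal_mul (by positivity)]
        congr 1
        simp only [H]
        field_simp
    _ ≤ ENNReal.ofReal (L * M) * ENNReal.ofReal (r ^ (d - 1)) * S := by
        rw [ENNReal.tsum_mul_left]
        gcongr
        exact ENNReal.tsum_comp_le_tsum_of_injective (f := fun n : ℕ => (n : ℤ) - ⌊r⌋₊)
          (fun a b hab => by simpa using hab)
          (fun z : ℤ => ENNReal.ofReal ((1 + |(z : ℝ)|) ^ (-(β * s))))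
    _ = _ := by ring

/-- The exponent m > d + 1 is split into β > 1, which becomes the decay rate of the tail, and m - β
> d, which keeps the remaining weight integrable. -/
theorem WellLocalized.exists_tail {ψ : E d → ℂ} (h : WellLocalized ψ) :
    ∃ C m β : ℝ, 0 ≤ C ∧ 1 < β ∧ β + d < m ∧ (∀ x, ‖ψ x‖ ≤ C * (1 + ‖x‖) ^ (-m)) ∧
      (Integrable ψ → ∀ D : ℝ, 0 ≤ D → ∀ S : Set (E d), MeasurableSet S → (∀ x ∈ S, D ≤ ‖x‖) →
        ∫ x in S, ‖ψ x‖ ≤ C * (1 + D) ^ (-β)) := by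
  obtain ⟨C, m, hm, hC⟩ := h
  have hC0 : 0 ≤ C := by
    have := (norm_nonneg _).trans (hC 0)
    simpa using this
  obtain ⟨β, hβ1, hβ2⟩ := exists_between (by linarith : (1 : ℝ) < m - d)
  have hint : Integrable (fun x : E d => (1 + ‖x‖) ^ (-(m - β))) :=
    integrable_one_add_norm (by rw [finrank_euclideanSpace_fin]; linarith)
  set I := ∫ x : E d, (1 + ‖x‖) ^ (-(m - β)) with hI
  have hI0 : 0 ≤ I := integral_nonneg fun x => by positivity
  refine ⟨C + C * I, m, β, by positivity, hβ1, by linarith, fun x => (hC x).trans ?_, ?_⟩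
  · gcongr; linarith [mul_nonneg hC0 hI0]
  intro hψ D hD S hSm hS
  calc ∫ x in S, ‖ψ x‖ ≤ ∫ x in S, C * (1 + D) ^ (-β) * (1 + ‖x‖) ^ (-(m - β)) := by
        refine setIntegral_mono_on hψ.norm.integrableOn (hint.const_mul _).integrableOn hSm
          fun x hx => (hC x).trans ?_
        rw [mul_assoc]
        gcongr
        rw [show -m = -β + -(m - β) by ring, Real.rpow_add (by positivity)]
        gcongr 1
        refine Real.rpow_le_rpow_of_nonpos (by positivity) ?_ (by linarith)
        linarith [hS x hx]
    _ = C * (1 + D) ^ (-β) * ∫ x in S, (1 + ‖x‖) ^ (-(m - β)) := integral_const_mul _ _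
    _ ≤ C * (1 + D) ^ (-β) * I := by
        gcongr
        exact setIntegral_le_integral hint (Eventually.of_forall fun x => by positivity)
    _ ≤ _ := by
        have : 0 ≤ C * (1 + D) ^ (-β) := by positivity
        nlinarith

theorem WellLocalized.integrable {ψ : E d → ℂ} (h : WellLocalized ψ)
    (hm : AEStronglyMeasurable ψ volume) : Integrable ψ := by
  obtain ⟨C, m, hm', hC⟩ := h
  have hint : Integrable (fun x : E d => C * (1 + ‖x‖) ^ (-m)) :=
    (integrable_one_add_norm (by rw [finrank_euclideanSpace_fin]; linarith)).const_mul C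
  exact hint.mono' hm (Eventually.of_forall hC)

/-- If `ψ` has mean zero, its integral over a ball is controlled by its mass beyond the distance
of the sphere to the origin. -/
theorem norm_setIntegral_ball_le_of_integral_eq_zero {ψ : E d → ℂ} (hψ : Integrable ψ)
    (h0 : ∫ x, ψ x = 0) (c : E d) (r : ℝ) :
    ∃ S : Set (E d), MeasurableSet S ∧ (∀ x ∈ S, |‖c‖ - r| ≤ ‖x‖) ∧
      ‖∫ x in Metric.ball c r, ψ x‖ ≤ ∫ x in S, ‖ψ x‖ := by
  rcases le_total r ‖c‖ with hrc | hrc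
  · refine ⟨Metric.ball c r, measurableSet_ball, fun x hx => ?_, norm_integral_le_integral_norm _⟩
    rw [abs_of_nonneg (by linarith)]
    rw [mem_ball_iff_norm'] at hx
    linarith [norm_sub_norm_le c x]
  · refine ⟨(Metric.ball c r)ᶜ, measurableSet_ball.compl, fun x hx => ?_, ?_⟩
    · rw [abs_of_nonpos (by linarith)]
      rw [Set.mem_compl_iff, mem_ball_iff_norm, not_lt] at hx
      linarith [norm_sub_le x c]
    · have := integral_add_compl (s := Metric.ball c r) measurableSet_ball hψ
      rw [h0, add_eq_zero_iff_eq_neg] at this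
      rw [this, norm_neg]
      exact norm_integral_le_integral_norm _

/-- For ‖c‖ ≤ 2r the factor (r / (‖c‖ + r))^d is bounded below, so the mean-zero tail estimate
suffices. For ‖c‖ ≥ 2r the ball is far from the origin: the pointwise bound is multiplied by the
volume, and d of the exponents in m > β + d produce (‖c‖ + r)^{-d}. -/
theorem WellLocalized.ballDecay (hd : 2 ≤ d) {ρ : ℝ} (hρ : 0 < ρ) {ψ : E d → ℂ}
    (h : WellLocalized ψ) (hψ : Integrable ψ) (h0 : ∫ x, ψ x = 0) : BallDecay ρ ψ := by
  obtain ⟨C, m, β, hC, hβ, hm, hpt, htail⟩ := h.exists_tail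
  obtain ⟨V, hV, hvol⟩ := exists_volume_real_ball hd
  refine ⟨C * (1 + V) * 3 ^ d, β, by positivity, hβ, fun c r hr => ?_⟩
  have hr0 : 0 < r := hρ.trans_le hr
  set u := ‖c‖ with hu
  have hu0 : 0 ≤ u := norm_nonneg _
  rcases le_total u (2 * r) with hur | hur
  · obtain ⟨S, hSm, hS, hle⟩ := norm_setIntegral_ball_le_of_integral_eq_zero hψ h0 c r
    have h3 : 1 / 3 ≤ r / (u + r) := by
      rw [div_le_div_iff₀ (by norm_num) (by positivity)]; linarith
    calc _ ≤ _ := hle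
      _ ≤ C * (1 + |u - r|) ^ (-β) := htail hψ _ (abs_nonneg _) S hSm hS
      _ = C * (1 + |u - r|) ^ (-β) * (3 ^ d * (1 / 3) ^ d) := by
          rw [← mul_pow]; norm_num
      _ ≤ C * (1 + |u - r|) ^ (-β) * (3 ^ d * (r / (u + r)) ^ d) := by gcongr
      _ = C * 1 * 3 ^ d * (1 + |u - r|) ^ (-β) * (r / (u + r)) ^ d := by ring
      _ ≤ _ := by gcongr; linarith
  · have habs : |u - r| = u - r := abs_of_nonneg (by linarith)
    have hD : 0 ≤ u - r := by linarith
    have h3 : (1 + (u - r)) ^ (-(d : ℝ)) ≤ 3 ^ d * ((u + r) ^ d)⁻¹ := by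
      rw [Real.rpow_neg (by positivity), Real.rpow_natCast]
      calc ((1 + (u - r)) ^ d)⁻¹ ≤ (((u + r) / 3) ^ d)⁻¹ := by
            gcongr; linarith
        _ = _ := by rw [div_pow, inv_div, div_eq_mul_inv]
    calc ‖∫ x in Metric.ball c r, ψ x‖
        ≤ C * (1 + (u - r)) ^ (-m) * volume.real (Metric.ball c r) := by
          refine norm_setIntegral_le_of_norm_le_const measure_ball_lt_top fun x hx => ?_
          refine (hpt x).trans ?_
          gcongr 1
          refine Real.rpow_le_rpow_of_nonpos (by positivity) ?_ (by
            have : (0 : ℝ) ≤ d := by positivity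
            linarith)
          rw [mem_ball_iff_norm'] at hx
          linarith [norm_sub_norm_le c x]
      _ = C * (1 + (u - r)) ^ (-m) * (V * r ^ d) := by rw [hvol c r hr0.le]
      _ ≤ C * ((1 + (u - r)) ^ (-β) * (3 ^ d * ((u + r) ^ d)⁻¹)) * (V * r ^ d) := by
          gcongr
          calc (1 + (u - r)) ^ (-m) ≤ (1 + (u - r)) ^ (-β + -(d : ℝ)) :=
                Real.rpow_le_rpow_of_exponent_le (by linarith) (by linarith)
            _ = (1 + (u - r)) ^ (-β) * (1 + (u - r)) ^ (-(d : ℝ)) :=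
                Real.rpow_add (by positivity) _ _
            _ ≤ _ := by gcongr
      _ = C * V * 3 ^ d * (1 + |u - r|) ^ (-β) * (r / (u + r)) ^ d := by
          rw [habs, div_pow]; ring
      _ ≤ _ := by gcongr; linarith

/-- The version for interior wavelets, which have no pointwise bound. The integral vanishes unless
the sphere comes within `R` of the origin, and then both decay factors are bounded below; the
exponent 2 is an arbitrary choice above 1. -/
theorem ballDecay_of_support {ρ : ℝ} (hρ : 0 < ρ) {ψ : E d → ℂ} (hψ : Integrable ψ)
    (h0 : ∫ x, ψ x = 0) {R : ℝ} (hR : 0 ≤ R) (hsupp : ∀ x, ψ x ≠ 0 → ‖x‖ ≤ R) :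
    BallDecay ρ ψ := by
  set I := ∫ x, ‖ψ x‖ with hI
  have hI0 : 0 ≤ I := integral_nonneg fun x => norm_nonneg _
  refine ⟨I * (1 + R) ^ (2 : ℝ) * (2 + R / ρ) ^ d, 2, by positivity, by norm_num,
    fun c r hr => ?_⟩
  have hr0 : 0 < r := hρ.trans_le hr
  obtain ⟨S, hSm, hS, hle⟩ := norm_setIntegral_ball_le_of_integral_eq_zero hψ h0 c r
  set u := ‖c‖ with hu
  have hu0 : 0 ≤ u := norm_nonneg _
  refine hle.trans ?_
  by_cases hD : |u - r| ≤ R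
  · have h1 : (1 + R) ^ (2 : ℝ) * (1 + |u - r|) ^ (-2 : ℝ) ≥ 1 := by
      rw [Real.rpow_neg (by positivity), ge_iff_le, ← div_eq_mul_inv, one_le_div (by positivity)]
      gcongr
    have h2 : 1 ≤ (2 + R / ρ) * (r / (u + r)) := by
      rw [← mul_div_assoc, one_le_div (by positivity)]
      have h3 : u ≤ r + R := by linarith [le_abs_self (u - r)]
      have h4 : R ≤ R / ρ * r := by
        rw [div_mul_eq_mul_div, le_div_iff₀ hρ]; gcongr
      linarith
    calc ∫ x in S, ‖ψ x‖ ≤ I := setIntegral_le_integral hψ.norm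
          (Eventually.of_forall fun x => norm_nonneg _)
      _ = I * 1 * 1 ^ d := by simp
      _ ≤ I * ((1 + R) ^ (2 : ℝ) * (1 + |u - r|) ^ (-2 : ℝ)) *
          ((2 + R / ρ) * (r / (u + r))) ^ d := by
          gcongr
      _ = _ := by rw [mul_pow]; ring
  · have : ∫ x in S, ‖ψ x‖ = 0 := by
      rw [setIntegral_congr_fun hSm (g := fun _ => (0 : ℝ)), integral_zero]
      intro x hx
      by_contra hne
      have h1 := hsupp x (by simpa using hne)
      linarith [hS x hx]
    rw [this]
    positivity

/-- The integral of a well localized generator over the ball of radius `r` centred at `c - k`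
decays in `k`, with a constant depending on `‖c‖ + r` only. -/
theorem WellLocalized.tsum_ball_ne_top (hd : 2 ≤ d) {ψ : E d → ℂ} (h : WellLocalized ψ) (M : ℝ)
    (hM : 0 ≤ M) : ∃ s : ℝ, 0 < s ∧ s < 1 ∧ ∃ C : ℝ≥0∞, C ≠ ∞ ∧
      ∀ (c : E d) (r : ℝ), 0 ≤ r → ‖c‖ + r ≤ M →
        ∑' k : Fin d → ℤ, ‖∫ x in Metric.ball (c - latticePoint k) r, ψ x‖ₑ ^ s ≤
          C * ENNReal.ofReal ((r ^ d) ^ s) := by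
  obtain ⟨C, m, β, hC, hβ, hm, hpt, -⟩ := h.exists_tail
  obtain ⟨V, hV, hvol⟩ := exists_volume_real_ball hd
  have hd2 : (2 : ℝ) ≤ d := by exact_mod_cast hd
  have hm0 : 0 < m := by linarith
  -- s > d/m makes (1 + |k|)^{-sm} summable over the lattice.
  obtain ⟨s, hs, hs1⟩ : ∃ s : ℝ, (d : ℝ) / m < s ∧ s < 1 := by
    refine exists_between ?_
    rw [div_lt_one hm0]; linarith
  have hs0 : 0 < s := lt_trans (by positivity) hs
  rw [div_lt_iff₀ hm0] at hs
  let S := ∑' k : Fin d → ℤ, ENNReal.ofReal ((1 + ‖(latticePoint k : E d)‖) ^ (-(s * m)))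
  have hS : S ≠ ∞ := tsum_lattice_one_add_norm_rpow_ne_top hd hs
  let A : ℝ := (C * (1 + M) ^ m * V) ^ s
  refine ⟨s, hs0, hs1, ENNReal.ofReal A * S, ENNReal.mul_ne_top ENNReal.ofReal_ne_top hS,
    fun c r hr hcr => ?_⟩
  calc _ ≤ ∑' k : Fin d → ℤ, ENNReal.ofReal A * ENNReal.ofReal ((r ^ d) ^ s) *
        ENNReal.ofReal ((1 + ‖(latticePoint k : E d)‖) ^ (-(s * m))) := by
        refine ENNReal.tsum_le_tsum fun k => ?_
        rw [← ofReal_norm, ENNReal.ofReal_rpow_of_nonneg (norm_nonneg _) hs0.le,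
          ← ENNReal.ofReal_mul (by positivity), ← ENNReal.ofReal_mul (by positivity)]
        refine ENNReal.ofReal_le_ofReal ?_
        have hle : ‖∫ x in Metric.ball (c - latticePoint k) r, ψ x‖ ≤
            C * ((1 + M) ^ m * (1 + ‖(latticePoint k : E d)‖) ^ (-m)) *
              volume.real (Metric.ball (c - latticePoint k) r) := by
          refine norm_setIntegral_le_of_norm_le_const measure_ball_lt_top fun x hx => ?_
          refine (hpt x).trans ?_
          gcongr 1
          have h1 : 1 + ‖(latticePoint k : E d)‖ ≤ (1 + M) * (1 + ‖x‖) := by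
            rw [mem_ball_iff_norm] at hx
            have h2 : ‖(latticePoint k : E d)‖ ≤ ‖x - (c - latticePoint k)‖ + ‖x‖ + ‖c‖ := by
              calc ‖(latticePoint k : E d)‖ = ‖(x - (c - latticePoint k)) - x + c‖ := by
                    congr 1; abel
                _ ≤ _ := (norm_add_le _ _).trans (by gcongr; exact norm_sub_le _ _)
            nlinarith [norm_nonneg x]
          calc (1 + ‖x‖) ^ (-m) = (1 + M) ^ m * ((1 + M) * (1 + ‖x‖)) ^ (-m) := by
                rw [Real.mul_rpow (by positivity) (by positivity), Real.rpow_neg (by positivity),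
                  Real.rpow_neg (by positivity)]
                field_simp
            _ ≤ _ := by
                gcongr 1
                exact Real.rpow_le_rpow_of_nonpos (by positivity) h1 (by linarith)
        rw [hvol _ r hr] at hle
        calc _ ≤ _ := Real.rpow_le_rpow (norm_nonneg _) hle hs0.le
          _ = (C * (1 + M) ^ m * V * r ^ d * (1 + ‖(latticePoint k : E d)‖) ^ (-m)) ^ s := by
              congr 1; ring
          _ = _ := by
              rw [Real.mul_rpow (by positivity) (by positivity),
                Real.mul_rpow (by positivity) (by positivity), ← Real.rpow_mul (by positivity),
                neg_mul, mul_comm m s]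
    _ = ENNReal.ofReal A * ENNReal.ofReal ((r ^ d) ^ s) * S := ENNReal.tsum_mul_left
    _ = _ := by ring

end BallDecay

/-! ### Integrals over half-spaces -/

section HalfSpace

variable {d : ℕ}

theorem norm_setIntegral_sub_le {ψ : E d → ℂ} (hψ : Integrable ψ) {A B S : Set (E d)}
    (hA : MeasurableSet A) (hB : MeasurableSet B) (hS : MeasurableSet S)
    (h : ∀ x ∉ S, x ∈ A ↔ x ∈ B) :
    ‖(∫ x in A, ψ x) - ∫ x in B, ψ x‖ ≤ ∫ x in S, ‖ψ x‖ := by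
  rw [← integral_indicator hA, ← integral_indicator hB, ← integral_indicator hS,
    ← integral_sub (hψ.indicator hA) (hψ.indicator hB)]
  refine norm_integral_le_of_norm_le (hψ.norm.indicator hS) (Eventually.of_forall fun x => ?_)
  by_cases hx : x ∈ S
  · by_cases hxA : x ∈ A <;> by_cases hxB : x ∈ B <;> simp [hx, hxA, hxB]
  · have := h x hx
    by_cases hxA : x ∈ A
    · simp [hx, hxA, this.1 hxA]
    · have hxB : x ∉ B := fun hB => hxA (this.2 hB)
      simp [hx, hxA, hxB]

theorem exists_setIntegral_norm_ge_lt {ψ : E d → ℂ} (hψ : Integrable ψ) {ε : ℝ} (hε : 0 < ε) :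
    ∃ R : ℝ, 0 < R ∧ ∫ x in {x | R ≤ ‖x‖}, ‖ψ x‖ < ε := by
  have hanti : Antitone (fun n : ℕ => {x : E d | (n : ℝ) ≤ ‖x‖}) := by
    intro m n hmn x hx
    have : (m : ℝ) ≤ n := by exact_mod_cast hmn
    exact this.trans hx
  have hlim := tendsto_setIntegral_of_antitone (μ := volume) (f := fun x => ‖ψ x‖)
    (fun n : ℕ => (measurableSet_le measurable_const measurable_norm :
      MeasurableSet {x : E d | (n : ℝ) ≤ ‖x‖})) hanti ⟨0, hψ.norm.integrableOn⟩
  have hempty : ⋂ n : ℕ, {x : E d | (n : ℝ) ≤ ‖x‖} = ∅ := by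
    ext x
    simp only [Set.mem_iInter, Set.mem_ofPred_eq, Set.mem_empty_iff_false, iff_false, not_forall,
      not_le]
    exact exists_nat_gt ‖x‖
  rw [hempty, setIntegral_empty] at hlim
  obtain ⟨n, hn0, hn⟩ := ((eventually_gt_atTop 0).and (hlim.eventually_lt_const hε)).exists
  exact ⟨n, by exact_mod_cast hn0, hn⟩

theorem volume_hyperplane_eq_zero {ν : E d} (hν : ν ≠ 0) (t : ℝ) :
    volume {x : E d | inner ℝ ν x = t} = 0 := by
  by_cases hne : ∃ x₁ : E d, inner ℝ ν x₁ = t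
  · obtain ⟨x₁, hx₁⟩ := hne
    let W : Submodule ℝ (E d) := LinearMap.ker (innerSL ℝ ν).toLinearMap
    have hW : W ≠ ⊤ := by
      intro h
      have : ν ∈ W := h ▸ Submodule.mem_top
      exact hν (inner_self_eq_zero (𝕜 := ℝ) |>.1 this)
    have h1 := Measure.addHaar_submodule volume W hW
    rw [← measure_preimage_add_right volume (-x₁)] at h1
    convert h1 using 2
    ext x
    simp only [Set.mem_ofPred_eq, Set.mem_preimage, SetLike.mem_coe, W, LinearMap.mem_ker]
    change _ ↔ inner ℝ ν (x + -x₁) = 0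
    rw [inner_add_right, inner_neg_right, hx₁]
    constructor <;> intro h <;> linarith
  · convert measure_empty (μ := (volume : Measure (E d)))
    ext x
    simp only [Set.mem_ofPred_eq, Set.mem_empty_iff_false, iff_false]
    exact fun h => hne ⟨x, h⟩

theorem exists_setIntegral_slab_lt {ψ : E d → ℂ} (hψ : Integrable ψ) {ν : E d} (hν : ν ≠ 0)
    (t : ℝ) {ε : ℝ} (hε : 0 < ε) :
    ∃ η : ℝ, 0 < η ∧ ∫ x in {x | |inner ℝ ν x - t| ≤ η}, ‖ψ x‖ < ε := by
  have hanti : Antitone (fun n : ℕ => {x : E d | |inner ℝ ν x - t| ≤ 1 / ((n : ℝ) + 1)}) := by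
    intro m n hmn x hx
    have : 1 / ((n : ℝ) + 1) ≤ 1 / ((m : ℝ) + 1) := by gcongr
    exact le_trans hx this
  have hmeas : ∀ n : ℕ, MeasurableSet {x : E d | |inner ℝ ν x - t| ≤ 1 / ((n : ℝ) + 1)} :=
    fun n => measurableSet_le (by fun_prop) measurable_const
  have hlim := tendsto_setIntegral_of_antitone (μ := volume) (f := fun x => ‖ψ x‖)
    hmeas hanti ⟨0, hψ.norm.integrableOn⟩
  have hnull : volume (⋂ n : ℕ, {x : E d | |inner ℝ ν x - t| ≤ 1 / ((n : ℝ) + 1)}) = 0 := by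
    refine measure_mono_null ?_ (volume_hyperplane_eq_zero hν t)
    intro x hx
    simp only [Set.mem_iInter, Set.mem_ofPred_eq] at hx ⊢
    have h0 : |inner ℝ ν x - t| ≤ 0 :=
      ge_of_tendsto' tendsto_one_div_add_atTop_nhds_zero_nat hx
    exact sub_eq_zero.1 (abs_eq_zero.1 (le_antisymm h0 (abs_nonneg _)))
  rw [setIntegral_measure_zero _ hnull] at hlim
  obtain ⟨n, hn⟩ := (hlim.eventually_lt_const hε).exists
  exact ⟨1 / ((n : ℝ) + 1), by positivity, hn⟩

/-- Cramér–Wold argument. The positive and negative parts of `g` are densities of finite measures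
whose marginals agree in the directions of `D`; hence their characteristic functions agree on `D`,
by continuity everywhere, and the measures coincide. -/
theorem ae_eq_zero_of_setIntegral_halfSpace {g : E d → ℝ} (hg : Integrable g) {D : Set (E d)}
    (hD : Dense D) (h : ∀ ν ∈ D, ∀ t : ℝ, ∫ x in {x | inner ℝ ν x ≤ t}, g x = 0) :
    g =ᵐ[volume] 0 := by
  let μ₁ : Measure (E d) := volume.withDensity fun x => ENNReal.ofReal (g x)
  let μ₂ : Measure (E d) := volume.withDensity fun x => ENNReal.ofReal (-g x)
  have : IsFiniteMeasure μ₁ := isFiniteMeasure_withDensity_ofReal hg.2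
  have : IsFiniteMeasure μ₂ := isFiniteMeasure_withDensity_ofReal hg.neg.2
  have hmeas : ∀ (ν : E d) (t : ℝ), MeasurableSet {x : E d | inner ℝ ν x ≤ t} :=
    fun ν t => measurableSet_le (by fun_prop) measurable_const
  have hhalf : ∀ ν ∈ D, ∀ t : ℝ, μ₁ {x | inner ℝ ν x ≤ t} = μ₂ {x | inner ℝ ν x ≤ t} := by
    intro ν hν t
    have h1 := h ν hν t
    rw [integral_eq_lintegral_pos_part_sub_lintegral_neg_part hg.integrableOn, sub_eq_zero] at h1
    rw [withDensity_apply _ (hmeas ν t), withDensity_apply _ (hmeas ν t)]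
    have hf1 : ∫⁻ x in {x | inner ℝ ν x ≤ t}, ENNReal.ofReal (g x) ≠ ∞ := by
      rw [← withDensity_apply _ (hmeas ν t)]; exact measure_ne_top μ₁ _
    have hf2 : ∫⁻ x in {x | inner ℝ ν x ≤ t}, ENNReal.ofReal (-g x) ≠ ∞ := by
      rw [← withDensity_apply _ (hmeas ν t)]; exact measure_ne_top μ₂ _
    exact (ENNReal.toReal_eq_toReal_iff' hf1 hf2).1 h1
  have hchar : ∀ (μ : Measure (E d)) (ν : E d),
      charFun μ ν = charFun (μ.map fun x => inner ℝ ν x) (1 : ℝ) := by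
    intro μ ν
    rw [charFun_apply, charFun_apply, integral_map (by fun_prop) (by fun_prop)]
    simp [real_inner_comm]
  have hcf : charFun μ₁ = charFun μ₂ := by
    refine Continuous.ext_on hD continuous_charFun continuous_charFun fun ν hν => ?_
    rw [hchar, hchar]
    congr 1
    refine Measure.ext_of_Iic _ _ fun a => ?_
    rw [Measure.map_apply (by fun_prop) measurableSet_Iic,
      Measure.map_apply (by fun_prop) measurableSet_Iic]
    exact hhalf ν hν a
  have heq : μ₁ = μ₂ := Measure.ext_of_charFun hcf
  have hae := (withDensity_eq_iff hg.aestronglyMeasurable.aemeasurable.ennreal_ofReal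
    hg.aestronglyMeasurable.aemeasurable.neg.ennreal_ofReal (by
      have := measure_ne_top μ₁ Set.univ
      rwa [withDensity_apply _ MeasurableSet.univ, Measure.restrict_univ] at this)).1 heq
  filter_upwards [hae] with x hx
  simp only [Pi.zero_apply]
  rcases le_total 0 (g x) with h0 | h0
  · have : ENNReal.ofReal (g x) = 0 := by
      rw [hx]; exact ENNReal.ofReal_of_nonpos (by simpa using h0)
    exact le_antisymm (ENNReal.ofReal_eq_zero.1 this) h0
  · have : ENNReal.ofReal (-g x) = 0 := by
      rw [Pi.neg_apply] at hx
      rw [← hx]; exact ENNReal.ofReal_of_nonpos h0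
    have := ENNReal.ofReal_eq_zero.1 this
    linarith

/-- The excluded directions lie in countably many hyperplanes, one for each rational slope together
with ν i₁ = 0, and these are null sets. -/
theorem dense_irrational_slope {i₀ i₁ : Fin d} (hi : i₀ ≠ i₁) :
    Dense {ν : E d | ν i₁ ≠ 0 ∧ Irrational (ν i₀ / ν i₁)} := by
  have hnull : ∀ a b : ℝ, a ≠ 0 ∨ b ≠ 0 → ∀ᵐ ν : E d, a * ν i₀ + b * ν i₁ ≠ 0 := by
    intro a b hab
    let w : E d := EuclideanSpace.single i₀ a + EuclideanSpace.single i₁ b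
    have hw : ∀ ν : E d, inner ℝ w ν = a * ν i₀ + b * ν i₁ := by
      intro ν
      simp [w, inner_add_left, EuclideanSpace.inner_single_left]
    have hw0 : w ≠ 0 := by
      intro h0
      have h1 := congrArg (fun v : E d => v i₀) h0
      have h2 := congrArg (fun v : E d => v i₁) h0
      simp [w, hi, hi.symm] at h1 h2
      tauto
    have := volume_hyperplane_eq_zero hw0 0
    rw [ae_iff]
    convert this using 3
    ext ν
    rw [hw]; simp
  have hq : ∀ᵐ ν : E d, ∀ q : ℚ, 1 * ν i₀ + (-q : ℝ) * ν i₁ ≠ 0 :=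
    ae_all_iff.2 fun q => hnull _ _ (Or.inl one_ne_zero)
  refine Measure.dense_of_ae (μ := volume) ?_
  filter_upwards [hq, hnull 0 1 (Or.inr one_ne_zero)] with ν h1 h2
  have h2' : ν i₁ ≠ 0 := by simpa using h2
  refine ⟨h2', ?_⟩
  rintro ⟨q, hq⟩
  apply h1 q
  rw [eq_div_iff h2'] at hq
  linarith

theorem exists_halfSpace_integral_ne_zero {ψ : E d → ℂ} (hψ : Integrable ψ)
    (hne : ¬ ψ =ᵐ[volume] 0) {i₀ i₁ : Fin d} (hi : i₀ ≠ i₁) :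
    ∃ ν : E d, ‖ν‖ = 1 ∧ ν i₁ ≠ 0 ∧ Irrational (ν i₀ / ν i₁) ∧
      ∃ t : ℝ, ∫ x in {x | inner ℝ ν x ≤ t}, ψ x ≠ 0 := by
  by_contra! hcon
  apply hne
  have key : ∀ ν ∈ {ν : E d | ν i₁ ≠ 0 ∧ Irrational (ν i₀ / ν i₁)}, ∀ t : ℝ,
      ∫ x in {x | inner ℝ ν x ≤ t}, ψ x = 0 := by
    rintro ν ⟨hν1, hν2⟩ t
    have hν0 : ν ≠ 0 := by
      rintro rfl; simp at hν1
    have hn : 0 < ‖ν‖ := norm_pos_iff.2 hν0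
    have h1 := hcon (‖ν‖⁻¹ • ν) (by rw [norm_smul, norm_inv, norm_norm, inv_mul_cancel₀ hn.ne'])
      (by simp [hν1, hν0]) (by
        simp only [PiLp.smul_apply, smul_eq_mul]
        rwa [mul_div_mul_left _ _ (inv_ne_zero hn.ne')]) (‖ν‖⁻¹ * t)
    convert h1 using 3
    ext x
    simp only [Set.mem_ofPred_eq, real_inner_smul_left]
    exact (mul_le_mul_iff_right₀ (inv_pos.2 hn)).symm
  have hre := ae_eq_zero_of_setIntegral_halfSpace hψ.re (dense_irrational_slope hi)
    fun ν hν t => by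
      refine (integral_re hψ.integrableOn).trans ?_
      rw [key ν hν t, map_zero]
  have him := ae_eq_zero_of_setIntegral_halfSpace hψ.im (dense_irrational_slope hi)
    fun ν hν t => by
      refine (integral_im hψ.integrableOn).trans ?_
      rw [key ν hν t, map_zero]
  filter_upwards [hre, him] with x h1 h2
  exact Complex.ext h1 h2

end HalfSpace

/-! ### Many lattice translates of a large ball have a large integral -/

section Geometry

variable {d : ℕ}

theorem norm_le_mul_of_abs_le {x : E d} {b : ℝ} (hb : 0 ≤ b) (h : ∀ i, |x i| ≤ b) :
    ‖x‖ ≤ d * b := by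
  have h1 : ‖x‖ ^ 2 ≤ (d * b) ^ 2 := by
    rw [EuclideanSpace.norm_sq_eq]
    calc ∑ i, ‖x i‖ ^ 2 ≤ ∑ _i : Fin d, b ^ 2 := by
          refine Finset.sum_le_sum fun i _ => ?_
          rw [Real.norm_eq_abs]
          have := h i
          gcongr
      _ = d * b ^ 2 := by simp
      _ ≤ (d * b) ^ 2 := by
          rcases Nat.eq_zero_or_pos d with rfl | hd
          · simp
          · have : (1 : ℝ) ≤ d := by exact_mod_cast hd
            rw [mul_pow]
            gcongr
            nlinarith
  exact (sq_le_sq₀ (norm_nonneg _) (by positivity)).1 h1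

/-- Locally, a large ball whose boundary normal is close to `ν` integrates like a half-space. -/
theorem exists_ball_integral_close {ψ : E d → ℂ} (hψ : Integrable ψ) {ν : E d} (hν : ‖ν‖ = 1)
    (t : ℝ) {ε : ℝ} (hε : 0 < ε) : ∃ δ : ℝ, 0 < δ ∧ ∀ M : ℝ, 0 ≤ M → ∃ θ : ℝ, 0 < θ ∧ ∃ r₀ : ℝ,
      ∀ r : ℝ, r₀ ≤ r → ∀ p : E d, ‖p‖ = 1 → ‖p - ν‖ ≤ θ → ∀ w : E d, ‖w‖ ≤ M →
        |inner ℝ ν w - t| ≤ δ →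
        ‖(∫ x in Metric.ball (w - r • p) r, ψ x) - ∫ x in {x | inner ℝ ν x ≤ t}, ψ x‖ ≤ ε := by
  have hν0 : ν ≠ 0 := by rintro rfl; simp at hν
  obtain ⟨R, hR, hRε⟩ := exists_setIntegral_norm_ge_lt hψ (half_pos hε)
  obtain ⟨η, hη, hηε⟩ := exists_setIntegral_slab_lt hψ hν0 t (half_pos hε)
  -- Off the slab of half-width η = 3δ there is room for three errors of size δ: the offset of `w`,
  -- the tilt of `p` against `ν`, and the curvature of the sphere.
  set δ := η / 3 with hδ
  have hδ0 : 0 < δ := by positivity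
  -- On points with ‖x - w‖ ≤ R + M this `θ` keeps the tilt below δ, and the lower bound on `r`
  -- keeps the curvature term (R + M)² / (2r) below δ.
  refine ⟨δ, hδ0, fun M hM => ⟨δ / (R + M), by positivity, (R + M) ^ 2 / (2 * δ) + 1,
    fun r hr p hp hpν w hw hwt => ?_⟩⟩
  have hr1 : (R + M) ^ 2 < 2 * r * δ := by
    have : (R + M) ^ 2 / (2 * δ) < r := by linarith
    rw [div_lt_iff₀ (by positivity)] at this
    linarith
  have hr0 : 0 < r := by
    by_contra hcon
    nlinarith [sq_nonneg (R + M)]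
  have hm1 : MeasurableSet {x : E d | R ≤ ‖x‖} := measurableSet_le (by fun_prop) (by fun_prop)
  have hm2 : MeasurableSet {x : E d | |inner ℝ ν x - t| ≤ η} :=
    measurableSet_le (by fun_prop) (by fun_prop)
  refine (norm_setIntegral_sub_le hψ measurableSet_ball
    (measurableSet_le (by fun_prop) (by fun_prop)) (hm1.union hm2) ?_).trans ?_
  · intro x hx
    simp only [Set.mem_union, Set.mem_ofPred_eq, not_or, not_le] at hx
    obtain ⟨hx1, hx2⟩ := hx
    have hxw : ‖x - w‖ ≤ R + M := (norm_sub_le _ _).trans (by linarith)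
    have hpx : |inner ℝ p (x - w) - inner ℝ ν (x - w)| ≤ δ := by
      rw [← inner_sub_left]
      calc |inner ℝ (p - ν) (x - w)| ≤ ‖p - ν‖ * ‖x - w‖ := abs_real_inner_le_norm _ _
        _ ≤ δ / (R + M) * (R + M) := by gcongr
        _ = δ := by field_simp
    have hball : x ∈ Metric.ball (w - r • p) r ↔
        ‖x - w‖ ^ 2 + 2 * r * inner ℝ p (x - w) < 0 := by
      rw [mem_ball_iff_norm, ← sq_lt_sq₀ (norm_nonneg _) hr0.le,
        show x - (w - r • p) = (x - w) + r • p by abel, norm_add_sq_real, inner_smul_right,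
        norm_smul, hp, Real.norm_of_nonneg hr0.le, real_inner_comm]
      constructor <;> intro h <;> nlinarith
    rw [hball, Set.mem_ofPred_eq]
    rw [inner_sub_right, inner_sub_right, abs_le] at hpx
    rw [abs_le] at hwt
    rw [inner_sub_right]
    rcases lt_abs.1 hx2 with h | h
    · constructor
      · intro h1
        exfalso
        have : 0 < inner ℝ p x - inner ℝ p w := by linarith
        nlinarith [sq_nonneg ‖x - w‖]
      · intro h1; linarith
    · constructor
      · intro h1; linarith
      · intro _
        have h2 : inner ℝ p x - inner ℝ p w ≤ -δ := by linarith
        have h3 : ‖x - w‖ ^ 2 ≤ (R + M) ^ 2 := by gcongr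
        nlinarith
  · have hle : ∫ x in {x : E d | R ≤ ‖x‖} ∪ {x | |inner ℝ ν x - t| ≤ η}, ‖ψ x‖ ≤
        (∫ x in {x : E d | R ≤ ‖x‖}, ‖ψ x‖) + ∫ x in {x | |inner ℝ ν x - t| ≤ η}, ‖ψ x‖ := by
      rw [← Set.union_sdiff_self, setIntegral_union Set.disjoint_sdiff_right (hm2.diff hm1)
        hψ.norm.integrableOn hψ.norm.integrableOn]
      exact add_le_add le_rfl (setIntegral_mono_set hψ.norm.integrableOn
        (Eventually.of_forall fun x => norm_nonneg _) Set.sdiff_subset.eventuallyLE)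
    linarith

/-- If two coordinates of `ν` have irrational quotient, every point is within bounded distance of
a lattice point with prescribed difference of `ν`-coordinates, up to `δ`. -/
theorem exists_latticePoint_inner_close {ν : E d} {i₀ i₁ : Fin d}
    (hν : Irrational (ν i₀ / ν i₁)) (t : ℝ) {δ : ℝ} (hδ : 0 < δ) :
    ∃ M : ℝ, 0 ≤ M ∧ ∀ y : E d, ∃ k : Fin d → ℤ, ‖y - latticePoint k‖ ≤ M ∧
      |inner ℝ ν (y - latticePoint k) - t| ≤ δ := by
  let S : AddSubgroup ℝ := AddMonoidHom.range
    { toFun := fun k : Fin d → ℤ => inner ℝ ν (latticePoint k)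
      map_zero' := by
        have : (latticePoint 0 : E d) = 0 := by ext i; simp [latticePoint_apply]
        rw [this, inner_zero_right]
      map_add' := fun k l => by rw [latticePoint_add, inner_add_right] }
  have hmem : ∀ i, ν i ∈ S := by
    intro i
    refine ⟨Pi.single i 1, ?_⟩
    have : (latticePoint (Pi.single i 1) : E d) = EuclideanSpace.single i 1 := by
      ext j
      by_cases hj : j = i
      · subst hj; simp [latticePoint_apply]
      · simp [latticePoint_apply, hj]
    change inner ℝ ν (latticePoint (Pi.single i 1)) = ν i
    rw [this, real_inner_comm, EuclideanSpace.inner_single_left]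
    simp
  -- The values ⟨ν, k⟩ form a subgroup of ℝ containing two numbers of irrational ratio.
  have hS : Dense (S : Set ℝ) := by
    refine (dense_addSubgroupClosure_pair_iff.2 hν).mono ?_
    refine (AddSubgroup.closure_le S).2 ?_
    rintro x (rfl | rfl)
    · exact hmem _
    · exact hmem _
  set L : ℝ := ‖ν‖ * (d * 1) + |t| with hL
  -- Rounding `y` down leaves an offset in [-L, L]. By compactness finitely many lattice corrections
  -- serve all such offsets, which makes `M` independent of `y`.
  obtain ⟨T, hT⟩ := (isCompact_Icc (a := -L) (b := L)).elim_finite_subcover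
    (fun k : Fin d → ℤ => Metric.ball (inner ℝ ν (latticePoint k) : ℝ) δ)
    (fun _ => Metric.isOpen_ball) (by
      intro x _
      obtain ⟨y, ⟨k, rfl⟩, hk⟩ := hS.exists_dist_lt x hδ
      exact Set.mem_iUnion.2 ⟨k, hk⟩)
  refine ⟨d * 1 + ∑ k ∈ T, ‖(latticePoint k : E d)‖, by positivity, fun y => ?_⟩
  let k₀ : Fin d → ℤ := fun i => ⌊y i⌋
  set z : E d := y - latticePoint k₀ with hz
  have hzn : ‖z‖ ≤ d * 1 := by
    refine norm_le_mul_of_abs_le zero_le_one fun i => ?_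
    have h1 := Int.floor_le (y i)
    have h2 := Int.lt_floor_add_one (y i)
    have : z i = y i - ⌊y i⌋ := rfl
    rw [this, abs_le]
    constructor <;> linarith
  have hzL : inner ℝ ν z - t ∈ Set.Icc (-L) L := by
    have h1 : |inner ℝ ν z| ≤ ‖ν‖ * (d * 1) :=
      (abs_real_inner_le_norm _ _).trans (by gcongr)
    exact abs_le.1 ((abs_sub _ _).trans (by linarith))
  obtain ⟨k, hkT, hk⟩ := Set.mem_iUnion₂.1 (hT hzL)
  refine ⟨k₀ + k, ?_, ?_⟩
  · rw [latticePoint_add, ← sub_sub]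
    refine (norm_sub_le _ _).trans (add_le_add hzn ?_)
    exact Finset.single_le_sum (f := fun k => ‖(latticePoint k : E d)‖)
      (fun _ _ => norm_nonneg _) hkT
  · rw [Metric.mem_ball, Real.dist_eq] at hk
    rw [latticePoint_add, ← sub_sub, inner_sub_right]
    calc _ = |inner ℝ ν z - t - inner ℝ ν (latticePoint k)| := by congr 1; ring
      _ ≤ δ := hk.le

/-- A spherical cap around `ν` contains at least of order `r^{d-1}` points of mutual distance
greater than `h / r`. -/
theorem exists_separated_cap (hd : 2 ≤ d) {ν : E d} (hν : ‖ν‖ = 1) {θ h : ℝ} (hθ : 0 < θ)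
    (hh : 0 < h) : ∃ κ : ℝ, 0 < κ ∧ ∀ r : ℝ, 0 < r → ∃ P : Finset (E d),
      κ * r ^ (d - 1) ≤ (P.card : ℝ) ∧ (∀ p ∈ P, ‖p‖ = 1 ∧ ‖p - ν‖ ≤ θ) ∧
      ∀ p ∈ P, ∀ q ∈ P, p ≠ q → h < r * ‖p - q‖ := by
  classical
  have hν0 : ν ≠ 0 := by rintro rfl; simp at hν
  let W : Submodule ℝ (E d) := (Submodule.span ℝ {ν})ᗮ
  have hWdim : Module.finrank ℝ W = d - 1 := by
    have : Fact (Module.finrank ℝ (E d) = (d - 1) + 1) :=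
      ⟨by rw [finrank_euclideanSpace_fin]; omega⟩
    exact Submodule.finrank_orthogonal_span_singleton hν0
  let b : OrthonormalBasis (Fin (d - 1)) ℝ W :=
    (stdOrthonormalBasis ℝ W).reindex (finCongr hWdim)
  have hWν : ∀ v : W, inner ℝ ν (v : E d) = 0 := fun v =>
    Submodule.mem_orthogonal_singleton_iff_inner_right.1 v.2
  obtain ⟨ε, hε0, hεθ, hε1⟩ : ∃ ε : ℝ, 0 < ε ∧ 2 * ε ≤ θ ∧ ε ≤ 1 :=
    ⟨min (θ / 2) 1, by positivity, by linarith [min_le_left (θ / 2) 1], min_le_right _ _⟩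
  have hdpos : (0 : ℝ) < d := by exact_mod_cast (by omega : 0 < d)
  refine ⟨(ε / (2 * h * d)) ^ (d - 1), by positivity, fun r hr => ?_⟩
  let L : ℕ := ⌊ε / (2 * h * d) * r⌋₊
  have hL : (L : ℝ) ≤ ε / (2 * h * d) * r := Nat.floor_le (by positivity)
  have hL' : ε / (2 * h * d) * r < L + 1 := Nat.lt_floor_add_one _
  -- A grid of step 2h/r in the tangent hyperplane, kept within norm ε; it has (L + 1)^{d-1} points.
  let v : (Fin (d - 1) → Fin (L + 1)) → W := fun n =>
    b.repr.symm (WithLp.toLp 2 fun i => 2 * h / r * ((n i : ℕ) : ℝ))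
  have hvnorm : ∀ n, ‖v n‖ ≤ ε := by
    intro n
    simp only [v]
    rw [LinearIsometryEquiv.norm_map]
    have h1 : ∀ i, |(WithLp.toLp 2 fun i => 2 * h / r * ((n i : ℕ) : ℝ) : E (d - 1)) i| ≤
        ε / d := by
      intro i
      have h2 : ((n i : ℕ) : ℝ) ≤ L := by exact_mod_cast Nat.lt_succ_iff.1 (n i).2
      change |2 * h / r * ((n i : ℕ) : ℝ)| ≤ ε / d
      rw [abs_of_nonneg (by positivity)]
      calc 2 * h / r * ((n i : ℕ) : ℝ) ≤ 2 * h / r * (ε / (2 * h * d) * r) := by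
            gcongr; exact h2.trans hL
        _ = ε / d := by field_simp
    calc _ ≤ ((d - 1 : ℕ) : ℝ) * (ε / d) := norm_le_mul_of_abs_le (by positivity) h1
      _ ≤ d * (ε / d) := by gcongr; omega
      _ = ε := by field_simp
  have hvsep : ∀ n n', n ≠ n' → 2 * h / r ≤ ‖v n - v n'‖ := by
    intro n n' hne
    simp only [v]
    rw [← map_sub, LinearIsometryEquiv.norm_map]
    obtain ⟨i, hi⟩ := Function.ne_iff.1 hne
    refine le_trans ?_ (abs_apply_le_norm _ i)
    change _ ≤ |2 * h / r * ((n i : ℕ) : ℝ) - 2 * h / r * ((n' i : ℕ) : ℝ)|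
    rw [← mul_sub, abs_mul, abs_of_pos (by positivity : 0 < 2 * h / r)]
    refine le_mul_of_one_le_right (by positivity) ?_
    have : (1 : ℤ) ≤ |((n i : ℕ) : ℤ) - ((n' i : ℕ) : ℤ)| := by
      refine Int.one_le_abs (sub_ne_zero.2 ?_)
      intro h
      exact hi (Fin.ext (by exact_mod_cast h))
    exact_mod_cast this
  -- The grid is lifted to the sphere. Orthogonal projection back to the hyperplane does not
  -- increase distances, so the separation survives.
  let p : (Fin (d - 1) → Fin (L + 1)) → E d := fun n =>
    Real.sqrt (1 - ‖v n‖ ^ 2) • ν + (v n : E d)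
  have hv1 : ∀ n, ‖v n‖ ^ 2 ≤ 1 := fun n => by
    have := hvnorm n
    have h0 := norm_nonneg (v n)
    nlinarith
  have hpsep : ∀ n n', n ≠ n' → h < r * ‖p n - p n'‖ := by
    intro n n' hne
    have h1 : ‖v n - v n'‖ ≤ ‖p n - p n'‖ := by
      rw [← sq_le_sq₀ (norm_nonneg _) (norm_nonneg _)]
      have : p n - p n' = (Real.sqrt (1 - ‖v n‖ ^ 2) - Real.sqrt (1 - ‖v n'‖ ^ 2)) • ν +
          ((v n - v n' : W) : E d) := by
        simp only [p, sub_smul, Submodule.coe_sub]; abel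
      rw [this, norm_add_sq_real, real_inner_smul_left, hWν, Submodule.coe_norm]
      nlinarith [sq_nonneg ‖(Real.sqrt (1 - ‖v n‖ ^ 2) - Real.sqrt (1 - ‖v n'‖ ^ 2)) • ν‖]
    have h2 := (hvsep n n' hne).trans h1
    rw [div_le_iff₀ hr] at h2
    linarith
  have hinj : Function.Injective p := by
    intro n n' hnn
    by_contra hne
    have := hpsep n n' hne
    rw [hnn, sub_self, norm_zero, mul_zero] at this
    linarith
  refine ⟨Finset.univ.image p, ?_, ?_, ?_⟩
  · rw [Finset.card_image_of_injective _ hinj, Finset.card_univ, Fintype.card_pi]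
    simp only [Fintype.card_fin, Finset.prod_const, Finset.card_univ]
    push_cast
    rw [← mul_pow]
    gcongr
  · intro q hq
    obtain ⟨n, -, rfl⟩ := Finset.mem_image.1 hq
    have hs0 : 0 ≤ Real.sqrt (1 - ‖v n‖ ^ 2) := Real.sqrt_nonneg _
    have hs2 : Real.sqrt (1 - ‖v n‖ ^ 2) ^ 2 = 1 - ‖v n‖ ^ 2 :=
      Real.sq_sqrt (by linarith [hv1 n])
    have hcn : ‖(v n : E d)‖ = ‖v n‖ := rfl
    constructor
    · rw [← sq_eq_sq₀ (norm_nonneg _) zero_le_one]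
      simp only [p]
      rw [norm_add_sq_real, real_inner_smul_left, hWν, norm_smul, hν, Real.norm_of_nonneg hs0,
        hcn, mul_one, hs2]
      ring
    · have h0 := norm_nonneg (v n)
      have h1 : 1 - ‖v n‖ ≤ Real.sqrt (1 - ‖v n‖ ^ 2) := by
        apply Real.le_sqrt_of_sq_le
        have := hvnorm n
        nlinarith
      have h2 : Real.sqrt (1 - ‖v n‖ ^ 2) ≤ 1 := Real.sqrt_le_one.2 (by nlinarith)
      have : p n - ν = (Real.sqrt (1 - ‖v n‖ ^ 2) - 1) • ν + (v n : E d) := by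
        simp only [p, sub_smul, one_smul]; abel
      rw [this]
      refine (norm_add_le _ _).trans ?_
      rw [norm_smul, hν, Real.norm_eq_abs, abs_of_nonpos (by linarith), hcn]
      have := hvnorm n
      linarith
  · intro q hq q' hq' hne
    obtain ⟨n, -, rfl⟩ := Finset.mem_image.1 hq
    obtain ⟨n', -, rfl⟩ := Finset.mem_image.1 hq'
    exact hpsep n n' fun h => hne (by rw [h])

/-- Unless `ψ` vanishes, at least of order `r^{d-1}` of the lattice translates of a ball of large
radius `r` have an integral bounded below; the translations can be found near a fixed direction
that is not parallel to a coordinate axis. -/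
theorem exists_many_large_integrals (hd : 2 ≤ d) {ψ : E d → ℂ} (hψ : Integrable ψ)
    (hne : ¬ ψ =ᵐ[volume] 0) : ∃ ν : E d, (∀ i, |ν i| < 1) ∧ ∀ θ : ℝ, 0 < θ →
      ∃ κ : ℝ, 0 < κ ∧ ∃ M r₀ : ℝ, ∀ r : ℝ, r₀ ≤ r → ∀ c : E d, ∃ T : Finset (Fin d → ℤ),
        κ * r ^ (d - 1) ≤ (T.card : ℝ) ∧ ∀ k ∈ T,
          κ ≤ ‖∫ x in Metric.ball (c - latticePoint k) r, ψ x‖ ∧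
          ‖c + r • ν - latticePoint k‖ ≤ M + θ * r := by
  classical
  let i₀ : Fin d := ⟨0, by omega⟩
  let i₁ : Fin d := ⟨1, by omega⟩
  have hi : i₀ ≠ i₁ := by simp [i₀, i₁]
  obtain ⟨ν, hν, hν1, hirr, t, ht⟩ := exists_halfSpace_integral_ne_zero hψ hne hi
  have hν0' : ν i₀ ≠ 0 := by
    intro h0
    rw [h0, zero_div] at hirr
    exact hirr ⟨0, by simp⟩
  refine ⟨ν, fun i => ?_, fun θ hθ => ?_⟩
  · have hsum : ∑ j, |ν j| ^ 2 = 1 := by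
      have := EuclideanSpace.norm_sq_eq ν
      simpa [hν] using this.symm
    -- Two coordinates of the unit vector `ν` are nonzero, so none can have modulus 1.
    obtain ⟨j, hji, hj⟩ : ∃ j, j ≠ i ∧ ν j ≠ 0 := by
      by_cases h : i = i₀
      · exact ⟨i₁, by rw [h]; exact hi.symm, hν1⟩
      · exact ⟨i₀, fun h' => h h'.symm, hν0'⟩
    have h2 : |ν j| ^ 2 + |ν i| ^ 2 ≤ 1 := by
      rw [← hsum, ← Finset.sum_pair (f := fun j => |ν j| ^ 2) hji]
      exact Finset.sum_le_sum_of_subset_of_nonneg (Finset.subset_univ _)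
        fun _ _ _ => by positivity
    have h3 : 0 < |ν j| := abs_pos.2 hj
    nlinarith [abs_nonneg (ν i)]
  · set g := ‖∫ x in {x | inner ℝ ν x ≤ t}, ψ x‖ with hg
    have hg0 : 0 < g := norm_pos_iff.2 ht
    obtain ⟨δ, hδ, hclose⟩ := exists_ball_integral_close hψ hν t (half_pos hg0)
    obtain ⟨M, hM, hlat⟩ := exists_latticePoint_inner_close hirr t hδ
    obtain ⟨θ₁, hθ₁, r₀, hint⟩ := hclose M hM
    -- Each cap point is assigned a lattice point within `M`, so separation beyond 2M + 1 makes the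
    -- assignment injective.
    obtain ⟨κ, hκ, hcap⟩ := exists_separated_cap hd hν (lt_min hθ hθ₁)
      (by positivity : 0 < 2 * M + 1)
    refine ⟨min κ (g / 2), by positivity, M, max r₀ 1, fun r hr c => ?_⟩
    have hr1 : 0 < r := lt_of_lt_of_le one_pos ((le_max_right _ _).trans hr)
    obtain ⟨P, hPc, hP, hPsep⟩ := hcap r hr1
    choose k hk1 hk2 using fun p : E d => hlat (c + r • p)
    have hinj : Set.InjOn k P := by
      intro p hp q hq hpq
      by_contra hne
      have h1 := hPsep p hp q hq hne
      have h2 : r * ‖p - q‖ ≤ M + M := by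
        calc r * ‖p - q‖ = ‖(c + r • p - latticePoint (k p)) - (c + r • q - latticePoint (k q))‖ := by
              rw [hpq, sub_sub_sub_cancel_right, add_sub_add_left_eq_sub, ← smul_sub, norm_smul,
                Real.norm_of_nonneg hr1.le]
          _ ≤ _ := (norm_sub_le _ _).trans (add_le_add (hk1 p) (hk1 q))
      linarith
    refine ⟨P.image k, ?_, ?_⟩
    · rw [Finset.card_image_of_injOn hinj]
      refine le_trans ?_ hPc
      gcongr
      exact min_le_left _ _
    · intro l hl
      obtain ⟨p, hp, rfl⟩ := Finset.mem_image.1 hl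
      obtain ⟨hp1, hp2⟩ := hP p hp
      constructor
      · have := hint r ((le_max_left _ _).trans hr) p hp1 (hp2.trans (min_le_right _ _)) _
          (hk1 p) (hk2 p)
        rw [show c + r • p - latticePoint (k p) - r • p = c - latticePoint (k p) by abel] at this
        have h2 := norm_sub_norm_le (∫ x in {x | inner ℝ ν x ≤ t}, ψ x)
          (∫ x in Metric.ball (c - latticePoint (k p)) r, ψ x)
        rw [norm_sub_rev] at h2
        refine (min_le_right _ _).trans ?_
        linarith
      · calc ‖c + r • ν - latticePoint (k p)‖
            = ‖(c + r • p - latticePoint (k p)) - r • (p - ν)‖ := by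
              congr 1; rw [smul_sub]; abel
          _ ≤ M + θ * r := by
              refine (norm_sub_le _ _).trans (add_le_add (hk1 p) ?_)
              rw [norm_smul, Real.norm_of_nonneg hr1.le, mul_comm]
              gcongr
              exact hp2.trans (min_le_left _ _)

end Geometry

/-! ### Coefficients that follow the integrals of a generator -/

section Tracks

variable {d : ℕ} {ι : Type*}

/-- `k / 2^j` lies in the unit cube, at distance at least `a` from its boundary. -/
def Margin (a : ℝ) (j : ℕ) (k : Fin d → ℤ) : Prop :=
  ∀ i, a * 2 ^ j ≤ (k i : ℝ) ∧ (k i : ℝ) ≤ (1 - a) * 2 ^ j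

/-- Up to normalization and a vanishing error, the integral of `ψ(2^j · - k)` over the ball of
centre `x₀` and radius `ρ` bounds a coefficient of `c` from below, for every `k` with
`k / 2^j` well inside the unit cube, and distinct `(j, k)` have distinct coefficients. -/
def Tracks (x₀ : E d) (ρ : ℝ) (c : ι → ℂ) (ψ : E d → ℂ) : Prop :=
  ∀ a : ℝ, 0 < a → ∃ (j₀ : ℕ) (idx : ℕ × (Fin d → ℤ) → ι),
    Set.InjOn idx {p | j₀ ≤ p.1 ∧ Margin a p.1 p.2} ∧
    ∀ ε : ℝ, 0 < ε → ∀ᶠ j : ℕ in atTop, ∀ k : Fin d → ℤ, Margin a j k →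
      ‖∫ x in Metric.ball ((2 : ℝ) ^ j • x₀ - latticePoint k) (2 ^ j * ρ), ψ x‖ - ε ≤
        Real.sqrt ((2 ^ j) ^ d) * ‖c (idx (j, k))‖

theorem tendsto_two_pow_mul {b : ℝ} (hb : 0 < b) :
    Tendsto (fun j : ℕ => (2 : ℝ) ^ j * b) atTop atTop :=
  (tendsto_pow_atTop_atTop_of_one_lt (by norm_num)).atTop_mul_const hb

/-- The ball may touch the faces of the cube, but only in axis directions. Since |ν i| ≤ 1 - η for
all i, the point x₀ + ρν has distance at least ρη from the faces. -/
theorem exists_margin_large_integrals (hd : 2 ≤ d) {ψ : E d → ℂ} (hψ : Integrable ψ)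
    (hne : ¬ ψ =ᵐ[volume] 0) {x₀ : E d} {ρ : ℝ} (hρ : 0 < ρ)
    (hx₀ : ∀ i, ρ ≤ x₀ i ∧ x₀ i ≤ 1 - ρ) :
    ∃ κ a : ℝ, 0 < κ ∧ 0 < a ∧ ∀ᶠ j : ℕ in atTop, ∃ T : Finset (Fin d → ℤ),
      κ * (2 ^ j) ^ (d - 1) ≤ (T.card : ℝ) ∧ ∀ k ∈ T, Margin a j k ∧
        κ ≤ ‖∫ x in Metric.ball ((2 : ℝ) ^ j • x₀ - latticePoint k) (2 ^ j * ρ), ψ x‖ := by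
  obtain ⟨ν, hν, h⟩ := exists_many_large_integrals hd hψ hne
  obtain ⟨η, hη0, hη⟩ : ∃ η : ℝ, 0 < η ∧ ∀ i, |ν i| ≤ 1 - η := by
    have : Nonempty (Fin d) := ⟨⟨0, by omega⟩⟩
    obtain ⟨i₁, hi₁⟩ := Finite.exists_max fun i => |ν i|
    exact ⟨1 - |ν i₁|, by linarith [hν i₁], fun i => by linarith [hi₁ i]⟩
  obtain ⟨κ, hκ, M, r₀, hT⟩ := h (η / 4) (by positivity)
  -- Of the available margin ρη, one quarter is lost to the width of the cap and one quarter to the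
  -- bounded rounding, once 2^j is large.
  refine ⟨min κ (κ * ρ ^ (d - 1)), ρ * η / 2, by positivity, by positivity, ?_⟩
  filter_upwards [(tendsto_two_pow_mul hρ).eventually_ge_atTop r₀,
    (tendsto_two_pow_mul (by positivity : 0 < ρ * η / 4)).eventually_ge_atTop M] with j hj1 hj2
  obtain ⟨T, hTc, hTk⟩ := hT _ hj1 ((2 : ℝ) ^ j • x₀)
  refine ⟨T, ?_, fun k hk => ⟨fun i => ?_, (min_le_left _ _).trans (hTk k hk).1⟩⟩
  · refine le_trans ?_ hTc
    rw [mul_pow]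
    calc _ ≤ κ * ρ ^ (d - 1) * (2 ^ j) ^ (d - 1) := by gcongr; exact min_le_right _ _
      _ = _ := by ring
  · have h1 := (abs_apply_le_norm _ i).trans (hTk k hk).2
    have h2 : (((2 : ℝ) ^ j • x₀ + (2 ^ j * ρ) • ν - latticePoint k : E d)) i =
        2 ^ j * x₀ i + 2 ^ j * ρ * ν i - k i := by
      simp [latticePoint_apply]
    rw [h2, abs_le] at h1
    have h3 := abs_le.1 (hη i)
    have hp : (0 : ℝ) < 2 ^ j * ρ := by positivity
    have h4 : 2 ^ j * ρ * ν i ≤ 2 ^ j * ρ * (1 - η) := by gcongr; exact h3.2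
    have h5 : 2 ^ j * ρ * (-(1 - η)) ≤ 2 ^ j * ρ * ν i := by gcongr; exact h3.1
    have h6 : (2 : ℝ) ^ j * ρ ≤ 2 ^ j * x₀ i := by gcongr; exact (hx₀ i).1
    have h7 : (2 : ℝ) ^ j * x₀ i ≤ 2 ^ j * (1 - ρ) := by gcongr; exact (hx₀ i).2
    constructor <;> nlinarith

/-- For these translations the rescaled ball contains a ball of radius 2^j ρ/2 about the origin, so
the integral of a generator tends to its mean. -/
theorem exists_margin_center (hd : 2 ≤ d) {x₀ : E d} {ρ : ℝ} (hρ : 0 < ρ)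
    (hx₀ : ∀ i, ρ ≤ x₀ i ∧ x₀ i ≤ 1 - ρ) :
    ∃ κ a : ℝ, 0 < κ ∧ 0 < a ∧ ∀ᶠ j : ℕ in atTop, ∃ T : Finset (Fin d → ℤ),
      κ * (2 ^ j) ^ d ≤ (T.card : ℝ) ∧ ∀ k ∈ T, Margin a j k ∧
        ‖(2 : ℝ) ^ j • x₀ - latticePoint k‖ ≤ 2 ^ j * (ρ / 2) := by
  classical
  have hdpos : (0 : ℝ) < d := by exact_mod_cast (by omega : 0 < d)
  have hd1 : (1 : ℝ) ≤ d := by exact_mod_cast (by omega : 1 ≤ d)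
  have hb : 0 < ρ / (2 * d) := by positivity
  refine ⟨(ρ / (2 * d) / 2) ^ d, ρ / 2, by positivity, by positivity, ?_⟩
  filter_upwards [(tendsto_two_pow_mul hb).eventually_ge_atTop 2] with j hj
  let L : ℕ := ⌊(2 : ℝ) ^ j * (ρ / (2 * d))⌋₊
  have hL : (L : ℝ) ≤ 2 ^ j * (ρ / (2 * d)) := Nat.floor_le (by positivity)
  have hL' : (2 : ℝ) ^ j * (ρ / (2 * d)) < L + 1 := Nat.lt_floor_add_one _
  let e : (Fin d → Fin L) → (Fin d → ℤ) := fun n i => ⌈(2 : ℝ) ^ j * x₀ i⌉ + ((n i : ℕ) : ℤ)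
  have he : Function.Injective e := by
    intro n n' h
    funext i
    have := congrFun h i
    simp only [e] at this
    exact Fin.ext (by omega)
  refine ⟨Finset.univ.image e, ?_, ?_⟩
  · rw [Finset.card_image_of_injective _ he, Finset.card_univ, Fintype.card_pi]
    simp only [Fintype.card_fin, Finset.prod_const, Finset.card_univ]
    push_cast
    rw [← mul_pow]
    gcongr
    linarith
  · intro k hk
    obtain ⟨n, -, rfl⟩ := Finset.mem_image.1 hk
    have h1 : ∀ i, 2 ^ j * x₀ i ≤ (e n i : ℝ) ∧
        (e n i : ℝ) ≤ 2 ^ j * x₀ i + 2 ^ j * (ρ / (2 * d)) := by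
      intro i
      have hn : ((n i : ℕ) : ℝ) + 1 ≤ L := by exact_mod_cast (n i).2
      have h2 := Int.le_ceil ((2 : ℝ) ^ j * x₀ i)
      have h3 := Int.ceil_lt_add_one ((2 : ℝ) ^ j * x₀ i)
      simp only [e]
      push_cast
      constructor
      · have : (0 : ℝ) ≤ ((n i : ℕ) : ℝ) := by positivity
        linarith
      · linarith
    constructor
    · intro i
      have hp : (0 : ℝ) < 2 ^ j := by positivity
      have h6 : (2 : ℝ) ^ j * ρ ≤ 2 ^ j * x₀ i := by gcongr; exact (hx₀ i).1
      have h7 : (2 : ℝ) ^ j * x₀ i ≤ 2 ^ j * (1 - ρ) := by gcongr; exact (hx₀ i).2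
      have h8 : (2 : ℝ) ^ j * (ρ / (2 * d)) ≤ 2 ^ j * (ρ / 2) := by
        gcongr; linarith
      have h9 := h1 i
      constructor <;> nlinarith
    · have h10 : ‖(2 : ℝ) ^ j • x₀ - latticePoint (e n)‖ ≤ d * (2 ^ j * (ρ / (2 * d))) := by
        refine norm_le_mul_of_abs_le (by positivity) fun i => ?_
        have : ((2 : ℝ) ^ j • x₀ - latticePoint (e n)) i = 2 ^ j * x₀ i - e n i := by
          simp [latticePoint_apply]
        rw [this, abs_le]
        have := h1 i
        constructor <;> linarith
      calc _ ≤ _ := h10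
        _ = _ := by field_simp

/-- By the Bessel inequality, a generator tracked by coefficients has mean zero. -/
theorem Tracks.integral_eq_zero (hd : 2 ≤ d) {x₀ : E d} {ρ : ℝ} (hρ : 0 < ρ)
    (hx₀ : ∀ i, ρ ≤ x₀ i ∧ x₀ i ≤ 1 - ρ) {c : ι → ℂ} {ψ : E d → ℂ} (h : Tracks x₀ ρ c ψ)
    (hψ : Integrable ψ) {M : ℝ} (hM : ∀ t : Finset ι, ∑ i ∈ t, ‖c i‖ ^ 2 ≤ M) :
    ∫ x, ψ x = 0 := by
  classical
  by_contra hne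
  set g := ‖∫ x, ψ x‖ with hg
  have hg0 : 0 < g := norm_pos_iff.2 hne
  obtain ⟨κ, a, hκ, ha, hT⟩ := exists_margin_center hd hρ hx₀
  obtain ⟨j₀, idx, hinj, hidx⟩ := h a ha
  obtain ⟨R, hR, hRg⟩ := exists_setIntegral_norm_ge_lt hψ (by positivity : 0 < g / 4)
  have hev := (hidx (g / 4) (by positivity)).and (hT.and ((eventually_ge_atTop j₀).and
    ((tendsto_two_pow_mul (half_pos hρ)).eventually_ge_atTop R)))
  obtain ⟨j₁, hj₁⟩ := eventually_atTop.1 hev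
  -- If the mean is nonzero, one fine scale contributes κ 2^{jd} coefficients of squared size at
  -- least (g/2)² 2^{-jd}: a fixed amount.
  have hsum : ∀ j, ∃ T : Finset (Fin d → ℤ), j₁ ≤ j → (∀ k ∈ T, Margin a j k) ∧
      κ * (g / 2) ^ 2 ≤ ∑ k ∈ T, ‖c (idx (j, k))‖ ^ 2 := by
    intro j
    by_cases hj : j₁ ≤ j
    swap
    · exact ⟨∅, fun h => absurd h hj⟩
    obtain ⟨h1, ⟨T, hTc, hTk⟩, h3, h4⟩ := hj₁ j hj
    refine ⟨T, fun _ => ⟨fun k hk => (hTk k hk).1, ?_⟩⟩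
    have hterm : ∀ k ∈ T, (g / 2) ^ 2 * ((2 ^ j) ^ d)⁻¹ ≤ ‖c (idx (j, k))‖ ^ 2 := by
      intro k hk
      have h5 : ‖(∫ x in Metric.ball ((2 : ℝ) ^ j • x₀ - latticePoint k) (2 ^ j * ρ), ψ x) -
          ∫ x in Set.univ, ψ x‖ ≤ ∫ x in {x | R ≤ ‖x‖}, ‖ψ x‖ := by
        refine norm_setIntegral_sub_le hψ measurableSet_ball MeasurableSet.univ
          (measurableSet_le (by fun_prop) (by fun_prop)) fun x hx => ?_
        simp only [Set.mem_ofPred_eq, not_le] at hx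
        simp only [Set.mem_univ, iff_true, mem_ball_iff_norm']
        have := (hTk k hk).2
        have := norm_sub_le ((2 : ℝ) ^ j • x₀ - latticePoint k) x
        linarith
      rw [Measure.restrict_univ] at h5
      have h6 := norm_sub_norm_le (∫ x, ψ x)
        (∫ x in Metric.ball ((2 : ℝ) ^ j • x₀ - latticePoint k) (2 ^ j * ρ), ψ x)
      rw [norm_sub_rev] at h6
      have h7 : g / 2 ≤ Real.sqrt ((2 ^ j) ^ d) * ‖c (idx (j, k))‖ := by
        have := h1 k (hTk k hk).1
        linarith
      have h8 : (g / 2) ^ 2 ≤ (2 ^ j) ^ d * ‖c (idx (j, k))‖ ^ 2 := by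
        calc (g / 2) ^ 2 ≤ (Real.sqrt ((2 ^ j) ^ d) * ‖c (idx (j, k))‖) ^ 2 := by gcongr
          _ = _ := by rw [mul_pow, Real.sq_sqrt (by positivity)]
      rwa [← div_eq_mul_inv, div_le_iff₀ (by positivity), mul_comm (‖c (idx (j, k))‖ ^ 2)]
    calc κ * (g / 2) ^ 2 = κ * (2 ^ j) ^ d * ((g / 2) ^ 2 * ((2 ^ j) ^ d)⁻¹) := by
          field_simp
      _ ≤ T.card * ((g / 2) ^ 2 * ((2 ^ j) ^ d)⁻¹) := by gcongr
      _ = ∑ _k ∈ T, (g / 2) ^ 2 * ((2 ^ j) ^ d)⁻¹ := by rw [Finset.sum_const, nsmul_eq_mul]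
      _ ≤ _ := Finset.sum_le_sum hterm
  choose T hT using hsum
  -- Injectivity of `idx` keeps different scales apart, so `n` scales contribute `n` times this
  -- amount.
  have hbig : ∀ n : ℕ, n * (κ * (g / 2) ^ 2) ≤ M := by
    intro n
    let P := (Finset.Ico j₁ (j₁ + n)).sigma T
    let e : (Σ _ : ℕ, Fin d → ℤ) → ι := fun p => idx (p.1, p.2)
    have heinj : Set.InjOn e P := by
      rintro ⟨j, k⟩ hp ⟨j', k'⟩ hp' heq
      simp only [P, Finset.coe_sigma, Set.mem_sigma_iff, Finset.mem_coe, Finset.mem_Ico] at hp hp'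
      have h1 := hinj ⟨(hj₁ j hp.1.1).2.2.1, (hT j hp.1.1).1 k hp.2⟩
        ⟨(hj₁ j' hp'.1.1).2.2.1, (hT j' hp'.1.1).1 k' hp'.2⟩ heq
      simp only [Prod.mk.injEq] at h1
      obtain ⟨rfl, rfl⟩ := h1
      rfl
    calc n * (κ * (g / 2) ^ 2) = ∑ j ∈ Finset.Ico j₁ (j₁ + n), κ * (g / 2) ^ 2 := by
          rw [Finset.sum_const, nsmul_eq_mul, Nat.card_Ico, Nat.add_sub_cancel_left]
      _ ≤ ∑ j ∈ Finset.Ico j₁ (j₁ + n), ∑ k ∈ T j, ‖c (idx (j, k))‖ ^ 2 :=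
          Finset.sum_le_sum fun j hj => (hT j (Finset.mem_Ico.1 hj).1).2
      _ = ∑ p ∈ P, ‖c (e p)‖ ^ 2 := by
          simp only [P, Finset.sum_sigma, e]
      _ = ∑ i ∈ P.image e, ‖c i‖ ^ 2 := (Finset.sum_image (f := fun i => ‖c i‖ ^ 2) heinj).symm
      _ ≤ M := hM _
  obtain ⟨n, hn⟩ := exists_nat_gt (M / (κ * (g / 2) ^ 2))
  rw [div_lt_iff₀ (by positivity)] at hn
  exact absurd (hbig n) (not_le.2 hn)

/-- Coefficients that track a nonzero generator are abundant. -/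
theorem Tracks.abundant (hd : 2 ≤ d) {x₀ : E d} {ρ : ℝ} (hρ : 0 < ρ)
    (hx₀ : ∀ i, ρ ≤ x₀ i ∧ x₀ i ≤ 1 - ρ) {c : ι → ℂ} {ψ : E d → ℂ} (h : Tracks x₀ ρ c ψ)
    (hψ : Integrable ψ) (hne : ¬ ψ =ᵐ[volume] 0) : Abundant d c := by
  classical
  obtain ⟨κ, a, hκ, ha, hT⟩ := exists_margin_large_integrals hd hψ hne hρ hx₀
  obtain ⟨j₀, idx, hinj, hidx⟩ := h a ha
  refine ⟨min κ ((κ / 2) ^ 2), by positivity, ?_⟩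
  filter_upwards [hidx (κ / 2) (by positivity), hT, eventually_ge_atTop j₀] with j h1 h2 h3
  obtain ⟨T, hTc, hTk⟩ := h2
  refine ⟨T.image fun k => idx (j, k), ?_, ?_⟩
  · rw [Finset.card_image_of_injOn]
    · refine le_trans ?_ hTc
      gcongr
      exact min_le_left _ _
    · intro k hk k' hk' heq
      have := hinj ⟨h3, (hTk k hk).1⟩ ⟨h3, (hTk k' hk').1⟩ heq
      exact congrArg Prod.snd this
  · intro i hi
    obtain ⟨k, hk, rfl⟩ := Finset.mem_image.1 hi
    have h4 : κ / 2 ≤ Real.sqrt ((2 ^ j) ^ d) * ‖c (idx (j, k))‖ := by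
      have := h1 k (hTk k hk).1
      have := (hTk k hk).2
      linarith
    have h8 : (κ / 2) ^ 2 ≤ (2 ^ j) ^ d * ‖c (idx (j, k))‖ ^ 2 := by
      calc (κ / 2) ^ 2 ≤ (Real.sqrt ((2 ^ j) ^ d) * ‖c (idx (j, k))‖) ^ 2 := by gcongr
        _ = _ := by rw [mul_pow, Real.sq_sqrt (by positivity)]
    rw [← div_eq_mul_inv, div_le_iff₀ (by positivity), mul_comm (‖c (idx (j, k))‖ ^ 2)]
    exact (min_le_right _ _).trans h8

end Tracks

/-! ### Dilated generators and the coefficients of a ball -/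

section Dilation

variable {d : ℕ}

theorem quasiMeasurePreserving_smul_sub {t : ℝ} (ht : t ≠ 0) (v : E d) :
    Measure.QuasiMeasurePreserving (fun x : E d => t • x - v) volume volume := by
  have h1 : Measure.QuasiMeasurePreserving (fun x : E d => t • x) volume volume := by
    refine ⟨by fun_prop, ?_⟩
    rw [Measure.map_addHaar_smul volume ht]
    exact Measure.smul_absolutelyContinuous
  exact (measurePreserving_sub_right volume v).quasiMeasurePreserving.comp h1

/-- A generator can be recovered from any of its dilates, so measurability, known for elements of
L², passes back to it. -/
theorem eq_comp_of_dilTrans (ψ : E d → ℂ) (j : ℤ) (k : Fin d → ℤ) (y : E d) :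
    ψ y = ((2 : ℝ) ^ ((j : ℝ) * (d : ℝ) / 2))⁻¹ •
      dilTrans ψ j k (((2 : ℝ) ^ j)⁻¹ • y - (-(((2 : ℝ) ^ j)⁻¹ • latticePoint k))) := by
  have h : (2 : ℝ) ^ j • (((2 : ℝ) ^ j)⁻¹ • y - (-(((2 : ℝ) ^ j)⁻¹ • latticePoint k))) -
      latticePoint k = y := by
    rw [sub_neg_eq_add, smul_add, smul_inv_smul₀ (by positivity), smul_inv_smul₀ (by positivity)]
    abel
  rw [dilTrans, h, inv_smul_smul₀ (by positivity)]

theorem aestronglyMeasurable_of_dilTrans {ψ : E d → ℂ} {j : ℤ} {k : Fin d → ℤ}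
    (h : AEStronglyMeasurable (dilTrans ψ j k) volume) : AEStronglyMeasurable ψ volume := by
  have h1 := (h.comp_quasiMeasurePreserving (quasiMeasurePreserving_smul_sub
    (t := ((2 : ℝ) ^ j)⁻¹) (by positivity) (-(((2 : ℝ) ^ j)⁻¹ • latticePoint k)))).const_smul
      ((2 : ℝ) ^ ((j : ℝ) * (d : ℝ) / 2))⁻¹
  exact h1.congr (Eventually.of_forall fun y => (eq_comp_of_dilTrans ψ j k y).symm)

theorem integrable_dilTrans_iff {ψ : E d → ℂ} {j : ℤ} {k : Fin d → ℤ} :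
    Integrable (dilTrans ψ j k) ↔ Integrable ψ := by
  have hc : (2 : ℝ) ^ ((j : ℝ) * (d : ℝ) / 2) ≠ 0 := by positivity
  have h1 : Integrable (dilTrans ψ j k) ↔
      Integrable (fun x : E d => ψ ((2 : ℝ) ^ j • x - latticePoint k)) :=
    integrable_fun_smul_iff hc _
  rw [h1, integrable_comp_smul_iff volume (fun x => ψ (x - latticePoint k))
    (by positivity : (2 : ℝ) ^ j ≠ 0)]
  exact ⟨fun h => by simpa using h.comp_add_right (latticePoint k),
    fun h => h.comp_sub_right (latticePoint k)⟩

theorem dilTrans_ae_eq_zero {ψ : E d → ℂ} (h : ψ =ᵐ[volume] 0) (j : ℤ) (k : Fin d → ℤ) :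
    dilTrans ψ j k =ᵐ[volume] 0 := by
  have h1 := (quasiMeasurePreserving_smul_sub (t := (2 : ℝ) ^ j) (by positivity)
    (latticePoint k : E d)).ae_eq_comp h
  filter_upwards [h1] with x hx
  simp only [Function.comp_apply, Pi.zero_apply] at hx
  simp [dilTrans, hx]

theorem two_rpow_mul_inv (j : ℤ) :
    (2 : ℝ) ^ ((j : ℝ) * (d : ℝ) / 2) * ((((2 : ℝ) ^ j) ^ d)⁻¹) = 2 ^ (-(d / 2 * j) : ℝ) := by
  rw [← Real.rpow_intCast, ← Real.rpow_natCast, ← Real.rpow_mul (by norm_num),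
    ← Real.rpow_neg (by norm_num), ← Real.rpow_add (by norm_num)]
  congr 1
  ring

/-- Change of variables: the normalization 2^{jd/2} meets the Jacobian 2^{-jd}. -/
theorem norm_integral_ball_dilTrans (ψ : E d → ℂ) (j : ℤ) (k : Fin d → ℤ) (x₀ : E d) (ρ : ℝ) :
    ‖∫ x in Metric.ball x₀ ρ, dilTrans ψ j k x‖ = 2 ^ (-(d / 2 * j) : ℝ) *
      ‖∫ x in Metric.ball ((2 : ℝ) ^ j • x₀ - latticePoint k) (2 ^ j * ρ), ψ x‖ := by
  have ht : (0 : ℝ) < 2 ^ j := by positivity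
  let G : E d → ℂ := (Metric.ball ((2 : ℝ) ^ j • x₀ - latticePoint k) (2 ^ j * ρ)).indicator ψ
  have h1 : ∀ x, (Metric.ball x₀ ρ).indicator (dilTrans ψ j k) x =
      ((2 : ℝ) ^ ((j : ℝ) * (d : ℝ) / 2)) • G ((2 : ℝ) ^ j • x - latticePoint k) := by
    intro x
    have hiff : x ∈ Metric.ball x₀ ρ ↔ (2 : ℝ) ^ j • x - latticePoint k ∈
        Metric.ball ((2 : ℝ) ^ j • x₀ - latticePoint k) (2 ^ j * ρ) := by
      rw [mem_ball_iff_norm, mem_ball_iff_norm, sub_sub_sub_cancel_right, ← smul_sub, norm_smul,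
        Real.norm_of_nonneg ht.le, mul_lt_mul_iff_right₀ ht]
    by_cases hx : x ∈ Metric.ball x₀ ρ
    · rw [Set.indicator_of_mem hx, dilTrans]
      simp only [G]
      rw [Set.indicator_of_mem (hiff.1 hx)]
    · rw [Set.indicator_of_notMem hx]
      simp only [G]
      rw [Set.indicator_of_notMem (fun h => hx (hiff.2 h)), smul_zero]
  rw [← integral_indicator measurableSet_ball, ← integral_indicator measurableSet_ball]
  simp_rw [h1]
  rw [integral_smul, Measure.integral_comp_smul volume (fun y => G (y - latticePoint k)),
    integral_sub_right_eq_self, finrank_euclideanSpace_fin, smul_smul, norm_smul, norm_mul,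
    Real.norm_of_nonneg (by positivity), Real.norm_of_nonneg (abs_nonneg _),
    abs_of_pos (by positivity), two_rpow_mul_inv]

theorem norm_inner_indicator_eq {μ : Measure (E d)} {u f : Lp ℂ 2 μ} {B : Set (E d)}
    (hB : MeasurableSet B) (hf : f =ᵐ[μ] B.indicator fun _ => (1 : ℂ)) {g : E d → ℂ}
    (hu : u =ᵐ[μ] g) : ‖inner ℂ u f‖ = ‖∫ x in B, g x ∂μ‖ := by
  rw [L2.inner_def]
  have h1 : (fun x => inner ℂ (u x) (f x)) =ᵐ[μ] B.indicator fun x => (starRingEnd ℂ) (g x) := by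
    filter_upwards [hf, hu] with x h1 h2
    rw [h1, h2, RCLike.inner_apply]
    by_cases hx : x ∈ B <;> simp [hx]
  rw [integral_congr_ae h1, integral_indicator hB, integral_conj, RCLike.norm_conj]

theorem indicator_ball_ae_eq {x₀ : E d} {ρ : ℝ} (hρ : 0 < ρ) {B : Set (E d)}
    (hB : B = Metric.ball x₀ ρ ∨ B = Metric.closedBall x₀ ρ) (g : E d → ℂ) :
    B.indicator g =ᵐ[volume] (Metric.ball x₀ ρ).indicator g := by
  rcases hB with rfl | rfl
  · rfl
  · have h := Measure.addHaar_sphere_of_ne_zero (volume : Measure (E d)) x₀ hρ.ne'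
    refine indicator_ae_eq_of_ae_eq_set ?_
    rw [← Metric.ball_union_sphere]
    exact union_ae_eq_left_of_ae_eq_empty (ae_eq_empty.2 h)

theorem center_bounds_of_ball_subset {x₀ : E d} {ρ : ℝ}
    (h : Metric.ball x₀ ρ ⊆ unitCube d) (hρ : 0 < ρ) : ∀ i, ρ ≤ x₀ i ∧ x₀ i ≤ 1 - ρ := by
  intro i
  have key : ∀ s : ℝ, |s| < ρ → 0 ≤ x₀ i + s ∧ x₀ i + s ≤ 1 := by
    intro s hs
    have : x₀ + EuclideanSpace.single i s ∈ Metric.ball x₀ ρ := by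
      rw [mem_ball_iff_norm, add_sub_cancel_left, PiLp.norm_single, Real.norm_eq_abs]
      exact hs
    simpa using h this i
  constructor
  · refine le_of_forall_lt fun s hs => ?_
    by_contra hcon
    have h0 := key 0 (by simpa using hρ)
    have := key (-((s + ρ) / 2)) (by
      rw [abs_neg, abs_lt]
      constructor <;> linarith)
    linarith
  · refine le_of_forall_gt fun s hs => ?_
    by_contra hcon
    have h0 := key 0 (by simpa using hρ)
    have := key ((1 - s + ρ) / 2) (by
      rw [abs_lt]
      constructor <;> linarith)
    linarith

end Dilation

/-! ### Sparsity of the coefficients attached to one generator -/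

section Generator

variable {d : ℕ}

theorem tsum_rpow_le {Z : Type*} (a : Z → ℝ≥0∞) {s : ℝ} (hs : 0 < s) (hs1 : s ≤ 1) :
    (∑' z, a z) ^ s ≤ ∑' z, a z ^ s := by
  classical
  rw [← ENNReal.le_rpow_inv_iff hs, ENNReal.tsum_eq_iSup_sum]
  refine iSup_le fun T => ?_
  rw [ENNReal.le_rpow_inv_iff hs]
  refine le_trans ?_ (ENNReal.sum_le_tsum T)
  induction T using Finset.induction_on with
  | empty => simp [hs]
  | insert z T hz ih =>
    rw [Finset.sum_insert hz, Finset.sum_insert hz]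
    exact (ENNReal.rpow_add_le_add_rpow _ _ hs.le hs1).trans (by gcongr)

theorem enorm_setIntegral_le_lintegral_enorm (ψ : E d → ℂ) (S : Set (E d)) :
    ‖∫ x in S, ψ x‖ₑ ≤ ∫⁻ x, ‖ψ x‖ₑ :=
  (enorm_integral_le_lintegral_enorm _).trans (setLIntegral_le_lintegral _ _)

/-- A coefficient may collect several translates, indexed by `Z`: a single one on ℝ^d and for
interior wavelets, all periodic copies for periodic systems. Injectivity of `g b` says that each
lattice translate is used at most once per level, so t ↦ t^s being subadditive, the level's ℓ^s sum
is at most the full lattice sum. -/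
theorem BallDecay.sparse {β Z : Type*} {K : β → Type*} {lev : β → ℕ}
    (hlev : Function.Injective lev) (hd : 2 ≤ d) {ρ : ℝ} (hρ : 0 < ρ) {ψ : E d → ℂ}
    (h : BallDecay ρ ψ) (x₀ : E d) {c : (Σ b, K b) → ℂ} {g : ∀ b, K b → Z → (Fin d → ℤ)}
    (hg : ∀ b, Function.Injective fun p : K b × Z => g b p.1 p.2) {I : ℝ≥0∞} (hI : I ≠ ∞)
    (hc : ∀ b k, ‖c ⟨b, k⟩‖ₑ ≤ (2 : ℝ≥0∞) ^ (-(d / 2 * lev b) : ℝ) *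
      ∑' z, ‖∫ x in Metric.ball ((2 : ℝ) ^ lev b • x₀ - latticePoint (g b k z))
        (2 ^ lev b * ρ), ψ x‖ₑ)
    (hb : ∀ b k, ∑' z, ‖∫ x in Metric.ball ((2 : ℝ) ^ lev b • x₀ - latticePoint (g b k z))
        (2 ^ lev b * ρ), ψ x‖ₑ ≤ I) : Sparse d c := by
  obtain ⟨s, hs, hs1, C, hC, hsum⟩ := h.tsum_le hd hρ
  refine sparse_of_levels hlev hd hs hs1 (C := C * ENNReal.ofReal (ρ ^ (d - 1)) + I)
    (ENNReal.add_ne_top.2 ⟨ENNReal.mul_ne_top hC ENNReal.ofReal_ne_top, hI⟩) ?_ ?_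
  · intro b
    set n := lev b
    let a : (Fin d → ℤ) → ℝ≥0∞ := fun l =>
      ‖∫ x in Metric.ball ((2 : ℝ) ^ n • x₀ - latticePoint l) (2 ^ n * ρ), ψ x‖ₑ
    have h1 : ∑' l, a l ^ s ≤ C * ENNReal.ofReal ((2 ^ n * ρ) ^ (d - 1)) :=
      hsum ((2 : ℝ) ^ n • x₀) (2 ^ n * ρ) (le_mul_of_one_le_left hρ.le (one_le_pow₀ (by norm_num)))
    calc ∑' k, ‖c ⟨b, k⟩‖ₑ ^ s
        ≤ ∑' k, (2 : ℝ≥0∞) ^ (-(d / 2 * n) * s : ℝ) * ∑' z, a (g b k z) ^ s := by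
          refine ENNReal.tsum_le_tsum fun k => ?_
          calc ‖c ⟨b, k⟩‖ₑ ^ s ≤ ((2 : ℝ≥0∞) ^ (-(d / 2 * n) : ℝ) * ∑' z, a (g b k z)) ^ s := by
                gcongr; exact hc b k
            _ = (2 : ℝ≥0∞) ^ (-(d / 2 * n) * s : ℝ) * (∑' z, a (g b k z)) ^ s := by
                rw [ENNReal.mul_rpow_of_nonneg _ _ hs.le, ← ENNReal.rpow_mul]
            _ ≤ _ := by gcongr; exact tsum_rpow_le _ hs hs1.le
      _ = (2 : ℝ≥0∞) ^ (-(d / 2 * n) * s : ℝ) * ∑' k, ∑' z, a (g b k z) ^ s :=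
          ENNReal.tsum_mul_left
      _ = (2 : ℝ≥0∞) ^ (-(d / 2 * n) * s : ℝ) * ∑' p : K b × Z, a (g b p.1 p.2) ^ s := by
          rw [ENNReal.tsum_prod (f := fun k z => a (g b k z) ^ s)]
      _ ≤ (2 : ℝ≥0∞) ^ (-(d / 2 * n) * s : ℝ) *
            (C * ENNReal.ofReal ((2 ^ n * ρ) ^ (d - 1))) := by
          gcongr
          exact (ENNReal.tsum_comp_le_tsum_of_injective (hg b) fun l => a l ^ s).trans h1
      _ = C * ENNReal.ofReal (ρ ^ (d - 1)) *
            ((2 : ℝ≥0∞) ^ (-(d / 2 * n) * s : ℝ) * (2 : ℝ≥0∞) ^ (((n * (d - 1) : ℕ)) : ℝ)) := by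
          rw [mul_pow, ENNReal.ofReal_mul (by positivity), ← pow_mul,
            ENNReal.ofReal_pow (by norm_num), ENNReal.rpow_natCast]
          simp only [ENNReal.ofReal_ofNat]
          ring
      _ = C * ENNReal.ofReal (ρ ^ (d - 1)) * (2 : ℝ≥0∞) ^ ((d - 1 - d * s / 2) * n : ℝ) := by
          rw [← two_rpow_add]
          congr 2
          push_cast [Nat.cast_sub (by omega : 1 ≤ d)]
          ring
      _ ≤ _ := by gcongr; exact le_self_add
  · intro b k
    calc _ ≤ _ := hc b k
      _ ≤ (2 : ℝ≥0∞) ^ (-(d / 2 * lev b) : ℝ) * I := by gcongr; exact hb b k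
      _ = I * (2 : ℝ≥0∞) ^ (-(d / 2 * lev b) : ℝ) := mul_comm _ _
      _ ≤ _ := by gcongr; exact le_add_self

theorem enorm_eq_of_norm_eq {z : ℂ} {w : ℂ} {x : ℝ} (h : ‖z‖ = 2 ^ x * ‖w‖) :
    ‖z‖ₑ = (2 : ℝ≥0∞) ^ x * ‖w‖ₑ := by
  rw [← ofReal_norm, h, ENNReal.ofReal_mul (by positivity), ofReal_norm,
    ← ENNReal.ofReal_rpow_of_pos (by norm_num)]
  simp

theorem sqrt_two_pow_mul {z : ℂ} {w : ℝ} {j : ℕ} (h : ‖z‖ = 2 ^ (-(d / 2 * (j : ℕ)) : ℝ) * w) :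
    Real.sqrt ((2 ^ j) ^ d) * ‖z‖ = w := by
  rw [h, Real.sqrt_eq_rpow, ← pow_mul, ← Real.rpow_natCast, ← Real.rpow_mul (by norm_num),
    ← mul_assoc, ← Real.rpow_add (by norm_num)]
  have : ((j * d : ℕ) : ℝ) * (1 / 2) + -((d : ℝ) / 2 * (j : ℝ)) = 0 := by push_cast; ring
  rw [this, Real.rpow_zero, one_mul]

end Generator

/-! ### Wavelet bases of `L²(ℝ^d)` -/

section Space

variable {d : ℕ} {ι : Type*}

theorem Sparse.congr_norm {c c' : ι → ℂ} (h : Sparse d c) (hc : ∀ i, ‖c' i‖ = ‖c i‖) :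
    Sparse d c' := by
  obtain ⟨C, hC, h⟩ := h
  refine ⟨C, hC, fun J => ?_⟩
  have : ∀ i, ‖c' i‖ₑ = ‖c i‖ₑ := fun i => by rw [← ofReal_norm, hc i, ofReal_norm]
  simp_rw [this]
  exact h J

/-- The case without error term. Only periodic systems, whose wavelets wrap around, need the `ε` in
`Tracks`. -/
theorem tracks_of_norm_eq {x₀ : E d} {ρ : ℝ} {c : ι → ℂ} {ψ : E d → ℂ}
    (h : ∀ a : ℝ, 0 < a → ∃ (j₀ : ℕ) (idx : ℕ × (Fin d → ℤ) → ι),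
      Set.InjOn idx {p | j₀ ≤ p.1 ∧ Margin a p.1 p.2} ∧
      ∀ j k, j₀ ≤ j → Margin a j k → ‖c (idx (j, k))‖ = 2 ^ (-(d / 2 * (j : ℕ)) : ℝ) *
        ‖∫ x in Metric.ball ((2 : ℝ) ^ j • x₀ - latticePoint k) (2 ^ j * ρ), ψ x‖) :
    Tracks x₀ ρ c ψ := by
  intro a ha
  obtain ⟨j₀, idx, hinj, hc⟩ := h a ha
  refine ⟨j₀, idx, hinj, fun ε hε => ?_⟩
  filter_upwards [eventually_ge_atTop j₀] with j hj k hk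
  rw [sqrt_two_pow_mul (hc j k hj hk)]
  linarith

theorem norm_inner_ball_dilTrans {x₀ : E d} {ρ : ℝ} {u f : L2Space d}
    (hf : f =ᵐ[volume] (Metric.ball x₀ ρ).indicator fun _ => (1 : ℂ)) {ψ : E d → ℂ} {j : ℤ}
    {k : Fin d → ℤ} (hu : u =ᵐ[volume] dilTrans ψ j k) :
    ‖inner ℂ u f‖ = 2 ^ (-(d / 2 * j) : ℝ) *
      ‖∫ x in Metric.ball ((2 : ℝ) ^ j • x₀ - latticePoint k) (2 ^ j * ρ), ψ x‖ := by
  rw [norm_inner_indicator_eq measurableSet_ball hf hu, norm_integral_ball_dilTrans]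

/-- The coefficients of a ball for one scaling function at one scale are sparse. -/
theorem WellLocalized.sparse_scale (hd : 2 ≤ d) {ρ : ℝ} (hρ : 0 < ρ) {η : E d → ℂ}
    (h : WellLocalized η) (x₀ : E d) (j : ℤ) {c : (Fin d → ℤ) → ℂ}
    (hc : ∀ k, ‖c k‖ = 2 ^ (-(d / 2 * j) : ℝ) *
      ‖∫ x in Metric.ball ((2 : ℝ) ^ j • x₀ - latticePoint k) (2 ^ j * ρ), η x‖) :
    Sparse d c := by
  obtain ⟨s, hs, hs1, C, hC, hsum⟩ := h.tsum_ball_ne_top hd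
    (‖(2 : ℝ) ^ j • x₀‖ + 2 ^ j * ρ) (by positivity)
  refine sparse_of_tsum_rpow hd hs.le hs1.le (ne_top_of_le_ne_top ?_ (b :=
    ((2 : ℝ≥0∞) ^ (-(d / 2 * j) : ℝ)) ^ s * (C * ENNReal.ofReal (((2 ^ j * ρ) ^ d) ^ s))) ?_)
  · exact ENNReal.mul_ne_top (ENNReal.rpow_ne_top_of_nonneg hs.le (two_rpow_ne_top _))
      (ENNReal.mul_ne_top hC ENNReal.ofReal_ne_top)
  · simp_rw [fun k => enorm_eq_of_norm_eq (hc k), ENNReal.mul_rpow_of_nonneg _ _ hs.le]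
    rw [ENNReal.tsum_mul_left]
    gcongr
    exact hsum _ _ (by positivity) le_rfl

/-- The coefficients of a ball for all dilates and translates of one generator of mean zero are
sparse. -/
theorem WellLocalized.sparse_hom (hd : 2 ≤ d) {ρ : ℝ} (hρ : 0 < ρ) {ψ : E d → ℂ}
    (h : WellLocalized ψ) (hψ : Integrable ψ) (h0 : ∫ x, ψ x = 0) (x₀ : E d)
    {c : ℤ × (Fin d → ℤ) → ℂ}
    (hc : ∀ j k, ‖c (j, k)‖ = 2 ^ (-(d / 2 * j) : ℝ) *
      ‖∫ x in Metric.ball ((2 : ℝ) ^ j • x₀ - latticePoint k) (2 ^ j * ρ), ψ x‖) :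
    Sparse d c := by
  -- Nonnegative and negative scales are separated.
  let e : Bool → (Σ _ : ℕ, Fin d → ℤ) → ℤ × (Fin d → ℤ) := fun b p =>
    (if b then (p.1 : ℤ) else -((p.1 : ℤ) + 1), p.2)
  refine Sparse.of_cover e (fun i => ?_) fun b => ?_
  · obtain ⟨j, k⟩ := i
    rcases lt_or_ge j 0 with hj | hj
    · refine ⟨false, ⟨(-j - 1).toNat, k⟩, ?_⟩
      simp only [e, Bool.false_eq_true, if_false, Prod.mk.injEq, and_true]
      omega
    · refine ⟨true, ⟨j.toNat, k⟩, ?_⟩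
      simp only [e, if_true, Prod.mk.injEq, and_true]
      omega
  cases b
  -- At scale j < 0 the rescaled ball stays in a bounded region and has volume of order 2^{jd}, so
  -- the coefficients are O(2^{jd/2}) without cancellation, and the ℓ^s sums decay geometrically as
  -- j → -∞.
  · obtain ⟨s, hs, hs1, C, hC, hsum⟩ := h.tsum_ball_ne_top hd (‖x₀‖ + ρ) (by positivity)
    have hterm : ∀ n : ℕ, ∑' k : Fin d → ℤ, ‖c (e false ⟨n, k⟩)‖ₑ ^ s ≤
        C * ENNReal.ofReal ((ρ ^ d) ^ s) * ((2 : ℝ≥0∞) ^ (-(d / 2 * s) : ℝ)) ^ n := by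
      intro n
      set j : ℤ := -((n : ℤ) + 1) with hj
      have hj1 : (2 : ℝ) ^ j ≤ 1 := zpow_le_one_of_nonpos₀ (by norm_num) (by omega)
      have hle := hsum ((2 : ℝ) ^ j • x₀) (2 ^ j * ρ) (by positivity) (by
        rw [norm_smul, Real.norm_of_nonneg (by positivity), ← mul_add]
        exact mul_le_of_le_one_left (by positivity) hj1)
      have he : ∀ k, ‖c (e false ⟨n, k⟩)‖ₑ = (2 : ℝ≥0∞) ^ (-(d / 2 * j) : ℝ) *
          ‖∫ x in Metric.ball ((2 : ℝ) ^ j • x₀ - latticePoint k) (2 ^ j * ρ), ψ x‖ₑ := by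
        intro k
        exact enorm_eq_of_norm_eq (hc j k)
      simp_rw [he, ENNReal.mul_rpow_of_nonneg _ _ hs.le]
      rw [ENNReal.tsum_mul_left, ← ENNReal.rpow_mul]
      calc _ ≤ (2 : ℝ≥0∞) ^ (-(d / 2 * j) * s : ℝ) *
            (C * ENNReal.ofReal (((2 ^ j * ρ) ^ d) ^ s)) := by gcongr
        _ = C * ENNReal.ofReal ((ρ ^ d) ^ s) *
            ((2 : ℝ≥0∞) ^ (-(d / 2 * j) * s : ℝ) * (2 : ℝ≥0∞) ^ (j * d * s : ℝ)) := by
            have : ((2 ^ j * ρ) ^ d) ^ s = (2 : ℝ) ^ (j * d * s : ℝ) * (ρ ^ d) ^ s := by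
              rw [mul_pow, Real.mul_rpow (by positivity) (by positivity), ← Real.rpow_intCast,
                ← Real.rpow_natCast, ← Real.rpow_mul (by positivity), ← Real.rpow_mul (by positivity),
                mul_assoc]
            rw [this, ENNReal.ofReal_mul (by positivity), ← ENNReal.ofReal_rpow_of_pos (by norm_num),
              ENNReal.ofReal_ofNat]
            ring
        _ ≤ _ := by
            rw [← two_rpow_add, ← ENNReal.rpow_natCast, ← ENNReal.rpow_mul]
            gcongr
            · norm_num
            rw [hj]
            push_cast
            have : (0 : ℝ) ≤ d * s := by positivity
            nlinarith
    refine sparse_of_tsum_rpow hd hs.le hs1.le (ne_top_of_le_ne_top ?_ (b :=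
      C * ENNReal.ofReal ((ρ ^ d) ^ s) * (1 - (2 : ℝ≥0∞) ^ (-(d / 2 * s) : ℝ))⁻¹) ?_)
    · refine ENNReal.mul_ne_top (ENNReal.mul_ne_top hC ENNReal.ofReal_ne_top) ?_
      rw [ne_eq, ENNReal.inv_eq_top, tsub_eq_zero_iff_le, not_le]
      refine ENNReal.rpow_lt_one_of_one_lt_of_neg (by norm_num) ?_
      have : (0 : ℝ) < d := by exact_mod_cast (by omega : 0 < d)
      rw [neg_lt_zero]
      positivity
    · rw [ENNReal.tsum_sigma (fun n k => ‖c (e false ⟨n, k⟩)‖ₑ ^ s), ← ENNReal.tsum_geometric,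
        ← ENNReal.tsum_mul_left]
      exact ENNReal.tsum_le_tsum hterm
  · refine BallDecay.sparse (lev := fun n : ℕ => n) (Z := Unit) (g := fun _ k _ => k)
      (I := ∫⁻ x, ‖ψ x‖ₑ) (fun _ _ h => h) hd hρ (h.ballDecay hd hρ hψ h0) x₀ ?_
      (hasFiniteIntegral_iff_enorm.1 hψ.2).ne ?_ ?_
    · rintro n ⟨k, _⟩ ⟨k', _⟩ h
      exact Prod.ext h rfl
    · intro n k
      have := hc n k
      rw [zpow_natCast, Int.cast_natCast] at this
      rw [tsum_fintype, Fintype.sum_unique]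
      exact (enorm_eq_of_norm_eq this).le
    · intro n k
      rw [tsum_fintype, Fintype.sum_unique]
      exact enorm_setIntegral_le_lintegral_enorm _ _

theorem isBiorthogonal_dual_ne_zero {H : Type*} [NormedAddCommGroup H] [InnerProductSpace ℂ H]
    {φ φ' : ι → H} (hb : IsBiorthogonal φ' φ) (i : ι) : φ' i ≠ 0 := by
  intro h
  have := hb.1 i
  rw [h, inner_zero_left] at this
  exact zero_ne_one this

theorem IsRieszBasis.sum_inner_sq_le {H : Type*} [NormedAddCommGroup H] [InnerProductSpace ℂ H]
    {φ φ' : ι → H} (hφ : IsRieszBasis φ) (hb : IsBiorthogonal φ' φ) (f : H) :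
    ∃ M : ℝ, ∀ t : Finset ι, ∑ i ∈ t, ‖inner ℂ (φ' i) f‖ ^ 2 ≤ M := by
  obtain ⟨A, B, hA, -, hl, -⟩ := hφ.exists_coefficient_bounds hb
  refine ⟨‖f‖ ^ 2 / A, fun t => ?_⟩
  rw [le_div_iff₀ hA, mul_comm]
  exact hl t f

theorem bestNTermRate_hom (hd : 2 ≤ d) {x₀ : E d} {ρ : ℝ} (hρ : 0 < ρ)
    (hx₀ : ∀ i, ρ ≤ x₀ i ∧ x₀ i ≤ 1 - ρ) {f : L2Space d}
    (hf : f =ᵐ[volume] (Metric.ball x₀ ρ).indicator fun _ => (1 : ℂ)) {φ φ' : ι → L2Space d}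
    (hφ : IsRieszBasis φ) (hb : IsBiorthogonal φ' φ) {q : ℕ} (hq : 0 < q) (e : HomIndex d q ≃ ι)
    (h : IsHomSystem (φ' ∘ e)) : BestNTermRate φ f (1 / ((d : ℝ) - 1)) := by
  obtain ⟨ψ, hψ, hψe⟩ := h
  have hcoef : ∀ l j k, ‖inner ℂ (φ' (e (l, j, k))) f‖ = 2 ^ (-(d / 2 * j) : ℝ) *
      ‖∫ x in Metric.ball ((2 : ℝ) ^ j • x₀ - latticePoint k) (2 ^ j * ρ), ψ l x‖ :=
    fun l j k => norm_inner_ball_dilTrans hf (hψe l j k)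
  have hint : ∀ l, Integrable (ψ l) := fun l =>
    (hψ l).integrable (aestronglyMeasurable_of_dilTrans
      ((Lp.aestronglyMeasurable _).congr (hψe l 0 0)))
  have htracks : ∀ l, Tracks x₀ ρ (fun i => inner ℂ (φ' i) f) (ψ l) := by
    intro l
    refine tracks_of_norm_eq fun a _ => ⟨0, fun p => e (l, (p.1 : ℤ), p.2), ?_, ?_⟩
    · rintro ⟨j, k⟩ _ ⟨j', k'⟩ _ heq
      have := e.injective heq
      simp only [Prod.mk.injEq, true_and, Nat.cast_inj] at this
      rw [this.1, this.2]
    · intro j k _ _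
      have := hcoef l j k
      rwa [zpow_natCast, Int.cast_natCast] at this
  obtain ⟨M, hM⟩ := hφ.sum_inner_sq_le hb f
  have : Infinite ι := Infinite.of_injective (fun j : ℤ => e (⟨0, hq⟩, j, 0)) fun j j' h => by
    simpa using e.injective h
  refine bestNTermRate_of_sparse_of_abundant hφ hb hd f ?_ ?_
  · refine Sparse.of_cover (L := Fin q) (κ := fun _ => ℤ × (Fin d → ℤ)) (fun l p => e (l, p))
      (fun i => ⟨(e.symm i).1, (e.symm i).2, e.apply_symm_apply i⟩) fun l => ?_
    exact (hψ l).sparse_hom hd hρ (hint l) ((htracks l).integral_eq_zero hd hρ hx₀ (hint l) hM)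
      x₀ fun j k => hcoef l j k
  · refine (htracks ⟨0, hq⟩).abundant hd hρ hx₀ (hint _) fun h0 => ?_
    -- A null generator would give a zero dual element, which biorthogonality excludes.
    refine isBiorthogonal_dual_ne_zero hb (e (⟨0, hq⟩, 0, 0)) ?_
    exact (Lp.eq_zero_iff_ae_eq_zero).2 ((hψe _ _ _).trans (dilTrans_ae_eq_zero h0 _ _))

theorem bestNTermRate_inhom (hd : 2 ≤ d) {x₀ : E d} {ρ : ℝ} (hρ : 0 < ρ)
    (hx₀ : ∀ i, ρ ≤ x₀ i ∧ x₀ i ≤ 1 - ρ) {f : L2Space d}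
    (hf : f =ᵐ[volume] (Metric.ball x₀ ρ).indicator fun _ => (1 : ℂ)) {φ φ' : ι → L2Space d}
    (hφ : IsRieszBasis φ) (hb : IsBiorthogonal φ' φ) {r q : ℕ} {J : ℤ} (hq : 0 < q)
    (e : InhomIndex d r q J ≃ ι) (h : IsInhomSystem (φ' ∘ e)) :
    BestNTermRate φ f (1 / ((d : ℝ) - 1)) := by
  obtain ⟨η, ψ, hη, hψ, hηe, hψe⟩ := h
  have hcoef : ∀ l (j : {j : ℤ // J ≤ j}) k, ‖inner ℂ (φ' (e (Sum.inr (l, j, k)))) f‖ =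
      2 ^ (-(d / 2 * (j : ℤ)) : ℝ) *
      ‖∫ x in Metric.ball ((2 : ℝ) ^ (j : ℤ) • x₀ - latticePoint k) (2 ^ (j : ℤ) * ρ), ψ l x‖ :=
    fun l j k => norm_inner_ball_dilTrans hf (hψe l j k)
  have hint : ∀ l, Integrable (ψ l) := fun l =>
    (hψ l).integrable (aestronglyMeasurable_of_dilTrans
      ((Lp.aestronglyMeasurable _).congr (hψe l ⟨J, le_rfl⟩ 0)))
  have htracks : ∀ l, Tracks x₀ ρ (fun i => inner ℂ (φ' i) f) (ψ l) := by
    intro l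
    -- Taking the maximum with `J` makes the index total; it changes nothing from scale `J.toNat`
    -- on.
    refine tracks_of_norm_eq fun a _ => ⟨J.toNat,
      fun p => e (Sum.inr (l, ⟨max J p.1, le_max_left _ _⟩, p.2)), ?_, ?_⟩
    · rintro ⟨j, k⟩ hj ⟨j', k'⟩ hj' heq
      have h1 := e.injective heq
      simp only [Sum.inr.injEq, Prod.mk.injEq, true_and, Subtype.mk.injEq] at h1
      have hj1 : J.toNat ≤ j := hj.1
      have hj1' : J.toNat ≤ j' := hj'.1
      rw [Prod.mk.injEq]
      exact ⟨by omega, h1.2⟩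
    · intro j k hj _
      have h1 := hcoef l ⟨max J j, le_max_left _ _⟩ k
      have h2 : max J (j : ℤ) = j := max_eq_right (by omega)
      simp only [h2] at h1 ⊢
      rwa [zpow_natCast, Int.cast_natCast] at h1
  obtain ⟨M, hM⟩ := hφ.sum_inner_sq_le hb f
  have : Infinite ι := Infinite.of_injective
    (fun n : ℕ => e (Sum.inr (⟨0, hq⟩, ⟨J + n, by omega⟩, 0))) fun j j' h => by
      simpa using e.injective h
  refine bestNTermRate_of_sparse_of_abundant hφ hb hd f ?_ ?_
  · refine Sparse.of_cover (L := Fin r ⊕ Fin q)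
      (κ := Sum.elim (fun _ => Fin d → ℤ) fun _ => {j : ℤ // J ≤ j} × (Fin d → ℤ))
      (Sum.rec (fun a k => e (Sum.inl (a, k))) fun l p => e (Sum.inr (l, p))) (fun i => ?_) ?_
    · rcases hi : e.symm i with ⟨a, k⟩ | ⟨l, p⟩
      · exact ⟨Sum.inl a, k, by rw [← e.apply_symm_apply i, hi]⟩
      · exact ⟨Sum.inr l, p, by rw [← e.apply_symm_apply i, hi]⟩
    rintro (a | l)
    · exact (hη a).sparse_scale hd hρ x₀ J fun k => norm_inner_ball_dilTrans hf (hηe a k)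
    -- The coefficient formula makes sense at all integer scales, so sparsity is proved there and
    -- restricted to j ≥ J.
    · let c : ℤ × (Fin d → ℤ) → ℂ := fun p => ((2 ^ (-(d / 2 * p.1) : ℝ) *
        ‖∫ x in Metric.ball ((2 : ℝ) ^ p.1 • x₀ - latticePoint p.2) (2 ^ p.1 * ρ), ψ l x‖ : ℝ) : ℂ)
      have hc : Sparse d c := by
        refine (hψ l).sparse_hom hd hρ (hint l)
          ((htracks l).integral_eq_zero hd hρ hx₀ (hint l) hM) x₀ fun j k => ?_
        simp only [c]
        rw [Complex.norm_real, Real.norm_of_nonneg (by positivity)]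
      refine (hc.comp_injective (e := fun p : {j : ℤ // J ≤ j} × (Fin d → ℤ) => ((p.1 : ℤ), p.2))
        ?_).congr_norm ?_
      · rintro ⟨j, k⟩ ⟨j', k'⟩ h
        simp only [Prod.mk.injEq] at h
        exact Prod.ext (Subtype.ext h.1) h.2
      · rintro ⟨j, k⟩
        simp only [c]
        rw [Complex.norm_real, Real.norm_of_nonneg (by positivity)]
        exact hcoef l j k
  · refine (htracks ⟨0, hq⟩).abundant hd hρ hx₀ (hint _) fun h0 => ?_
    refine isBiorthogonal_dual_ne_zero hb (e (Sum.inr (⟨0, hq⟩, ⟨J, le_rfl⟩, 0))) ?_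
    exact (Lp.eq_zero_iff_ae_eq_zero).2 ((hψe _ _ _).trans (dilTrans_ae_eq_zero h0 _ _))

end Space

/-! ### Periodic wavelet bases of `L²([0,1]^d)` -/

section Periodic

variable {d : ℕ} {ι : Type*}

theorem latticePoint_two_pow_smul (j : ℕ) (z : Fin d → ℤ) :
    (latticePoint ((2 : ℤ) ^ j • z) : E d) = (2 : ℝ) ^ j • latticePoint z := by
  ext i
  simp [latticePoint_apply]

theorem dilTrans_add_latticePoint (g : E d → ℂ) (j : ℕ) (k z : Fin d → ℤ) (x : E d) :
    dilTrans g j k (x + latticePoint z) = dilTrans g j (k - (2 : ℤ) ^ j • z) x := by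
  rw [dilTrans, dilTrans, latticePoint_sub, latticePoint_two_pow_smul, zpow_natCast, smul_add]
  congr 2
  abel

theorem isClosed_unitCube : IsClosed (unitCube d) := by
  have : unitCube d = ⋂ i, {x : E d | 0 ≤ x i ∧ x i ≤ 1} := by
    ext x; simp [unitCube]
  rw [this]
  refine isClosed_iInter fun i => ?_
  have hi : Continuous fun x : E d => x i := (EuclideanSpace.proj i).continuous
  exact (isClosed_le continuous_const hi).inter (isClosed_le hi continuous_const)

theorem measurableSet_unitCube : MeasurableSet (unitCube d) :=
  isClosed_unitCube.measurableSet

/-- Balls of radius `r` at lattice spacing t ≥ 2r are disjoint. A ball in the unit cube has ρ ≤ 1/2,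
so its periodic copies see disjoint parts of ψ and their total is at most ∫ |ψ|. -/
theorem tsum_lintegral_ball_le (c : E d) {t r : ℝ} (ht : 2 * r ≤ t) (hr : 0 < r)
    (h : E d → ℝ≥0∞) :
    ∑' z : Fin d → ℤ, ∫⁻ x in Metric.ball (c + t • latticePoint z) r, h x ≤ ∫⁻ x, h x := by
  rw [← lintegral_iUnion (fun _ => measurableSet_ball)]
  · exact setLIntegral_le_lintegral _ _
  · intro z z' hz
    refine Metric.ball_disjoint_ball ?_
    have h1 := one_le_norm_latticePoint_sub hz
    rw [dist_eq_norm, add_sub_add_left_eq_sub, ← smul_sub, norm_smul,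
      Real.norm_of_nonneg (by linarith)]
    nlinarith

theorem tsum_lintegral_translate_le {x₀ : E d} {ρ : ℝ} (hρ : 0 < ρ) (hρ2 : ρ ≤ 1 / 2) (j : ℕ)
    (k : Fin d → ℤ) (h : E d → ℝ≥0∞) :
    ∑' z : Fin d → ℤ, ∫⁻ x in Metric.ball ((2 : ℝ) ^ j • x₀ -
      latticePoint (k - (2 : ℤ) ^ j • z)) (2 ^ j * ρ), h x ≤ ∫⁻ x, h x := by
  have hp : (0 : ℝ) < 2 ^ j := by positivity
  refine le_trans (le_of_eq (tsum_congr fun z => ?_)) (tsum_lintegral_ball_le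
    ((2 : ℝ) ^ j • x₀ - latticePoint k) (t := 2 ^ j) (r := 2 ^ j * ρ) (by nlinarith)
    (by positivity) h)
  rw [latticePoint_sub, latticePoint_two_pow_smul, sub_sub_eq_add_sub, sub_add_eq_add_sub]

theorem tsum_lintegral_dilTrans_ne_top {ψ : E d → ℂ} (hψ : Integrable ψ) {x₀ : E d} {ρ : ℝ}
    (hρ : 0 < ρ) (hρ2 : ρ ≤ 1 / 2) (j : ℕ) (k : Fin d → ℤ) :
    ∑' z : Fin d → ℤ, ∫⁻ x in Metric.ball x₀ ρ, ‖dilTrans ψ j k (x + latticePoint z)‖ₑ ≠ ∞ := by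
  refine ne_top_of_le_ne_top (hasFiniteIntegral_iff_enorm.1
    ((integrable_dilTrans_iff (j := (j : ℤ)) (k := k)).2 hψ).2).ne
    (le_trans (le_of_eq (tsum_congr fun z => ?_))
      (tsum_lintegral_ball_le x₀ (t := 1) (r := ρ) (by linarith) hρ _))
  rw [one_smul, ← lintegral_indicator measurableSet_ball, ← lintegral_indicator measurableSet_ball]
  refine Eq.trans ?_ (lintegral_add_right_eq_self _ (latticePoint z : E d))
  refine lintegral_congr fun x => ?_
  have hiff : x + latticePoint z ∈ Metric.ball (x₀ + latticePoint z) ρ ↔ x ∈ Metric.ball x₀ ρ := by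
    rw [mem_ball_iff_norm, mem_ball_iff_norm, add_sub_add_right_eq_sub]
  by_cases hx : x ∈ Metric.ball x₀ ρ
  · rw [Set.indicator_of_mem hx, Set.indicator_of_mem (hiff.2 hx)]
  · rw [Set.indicator_of_notMem hx, Set.indicator_of_notMem fun h => hx (hiff.1 h)]

/-- Shifting the argument by `z` replaces `k` by k - 2^j z; disjointness of the copies gives the
absolute convergence needed for the interchange. -/
theorem setIntegral_periodizedDilTrans {ψ : E d → ℂ} (hψ : Integrable ψ) {x₀ : E d} {ρ : ℝ}
    (hρ : 0 < ρ) (hρ2 : ρ ≤ 1 / 2) (j : ℕ) (k : Fin d → ℤ) :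
    ∫ x in Metric.ball x₀ ρ, periodizedDilTrans ψ j k x =
        ∑' z : Fin d → ℤ, ∫ x in Metric.ball x₀ ρ, dilTrans ψ j (k - (2 : ℤ) ^ j • z) x := by
  have hdil := (integrable_dilTrans_iff (j := (j : ℤ)) (k := k)).2 hψ
  simp only [periodizedDilTrans]
  rw [integral_tsum]
  · simp_rw [dilTrans_add_latticePoint]
  · intro z
    exact (hdil.comp_add_right (latticePoint z)).aestronglyMeasurable.restrict
  · exact tsum_lintegral_dilTrans_ne_top hψ hρ hρ2 j k

/-- For z ≠ 0 the point (x + k) / 2^j lies in a different unit cube from k / 2^j, which keeps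
distance a from the faces of its own. So wrapped copies only meet the tail of ψ. -/
theorem mem_ball_translate_of_ne {x₀ : E d} {ρ : ℝ} (hsub : Metric.ball x₀ ρ ⊆ unitCube d)
    {a : ℝ} {j : ℕ} {k z : Fin d → ℤ} (hk : Margin a j k) (hz : z ≠ 0) {x : E d}
    (hx : x ∈ Metric.ball ((2 : ℝ) ^ j • x₀ - latticePoint (k - (2 : ℤ) ^ j • z)) (2 ^ j * ρ)) :
    2 ^ j * a ≤ ‖x‖ := by
  have hp : (0 : ℝ) < 2 ^ j := by positivity
  have hy : ((2 : ℝ) ^ j)⁻¹ • (x + latticePoint k) - latticePoint z ∈ unitCube d := by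
    apply hsub
    rw [mem_ball_iff_norm, latticePoint_sub, latticePoint_two_pow_smul] at hx
    rw [mem_ball_iff_norm, ← mul_lt_mul_iff_right₀ hp]
    calc 2 ^ j * ‖((2 : ℝ) ^ j)⁻¹ • (x + latticePoint k) - latticePoint z - x₀‖
        = ‖(2 : ℝ) ^ j • (((2 : ℝ) ^ j)⁻¹ • (x + latticePoint k) - latticePoint z - x₀)‖ := by
          rw [norm_smul, Real.norm_of_nonneg hp.le]
      _ = ‖x - ((2 : ℝ) ^ j • x₀ - (latticePoint k - (2 : ℝ) ^ j • latticePoint z))‖ := by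
          congr 1
          rw [smul_sub, smul_sub, smul_inv_smul₀ hp.ne']
          abel
      _ < _ := hx
  obtain ⟨i, hi⟩ := Function.ne_iff.1 hz
  obtain ⟨h1, h2⟩ := hy i
  have hval : (((2 : ℝ) ^ j)⁻¹ • (x + latticePoint k) - latticePoint z : E d) i =
      ((2 : ℝ) ^ j)⁻¹ * (x i + k i) - z i := by
    simp only [PiLp.sub_apply, PiLp.smul_apply, PiLp.add_apply, latticePoint_apply, smul_eq_mul]
  rw [hval] at h1 h2
  have h3 : 2 ^ j * (z i : ℝ) ≤ x i + k i := by
    have : (z i : ℝ) ≤ (x i + k i) / 2 ^ j := by rw [div_eq_inv_mul]; linarith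
    rw [le_div_iff₀ hp] at this
    linarith
  have h4 : x i + k i ≤ 2 ^ j * (z i + 1 : ℝ) := by
    have : (x i + k i) / 2 ^ j ≤ (z i + 1 : ℝ) := by rw [div_eq_inv_mul]; linarith
    rw [div_le_iff₀ hp] at this
    linarith
  obtain ⟨hk1, hk2⟩ := hk i
  refine le_trans ?_ (abs_apply_le_norm x i)
  rcases lt_or_gt_of_ne hi with hneg | hpos
  · have : (z i : ℝ) + 1 ≤ 0 := by exact_mod_cast hneg
    refine le_trans ?_ (neg_le_abs _)
    nlinarith
  · have : (1 : ℝ) ≤ z i := by exact_mod_cast hpos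
    refine le_trans ?_ (le_abs_self _)
    nlinarith

/-- The generator of a periodic system is measurable, being the limit of its periodizations. -/
theorem WellLocalized.aestronglyMeasurable_of_periodized (hd : 2 ≤ d) {ψ : E d → ℂ}
    (h : WellLocalized ψ) {J : ℕ}
    (hm : ∀ j : ℕ, J ≤ j → 1 ≤ j → AEStronglyMeasurable
      (periodizedDilTrans ψ j (fun _ => (2 : ℤ) ^ (j - 1))) (volume.restrict (unitCube d))) :
    AEStronglyMeasurable ψ volume := by
  obtain ⟨C, m, hmd, hC⟩ := h
  have hm0 : 0 < m := by
    have : (0 : ℝ) ≤ d := by positivity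
    linarith
  have hC0 : 0 ≤ C := by
    have := (norm_nonneg _).trans (hC 0)
    simpa using this
  -- Translation by half a period moves any fixed `y` into the cube after rescaling, once j is
  -- large. Undoing the dilation then shows ψ(y) plus copies receding to infinity.
  let k : ℕ → Fin d → ℤ := fun j _ => (2 : ℤ) ^ (j - 1)
  let G : ℕ → E d → ℂ := fun n y =>
    ((2 : ℝ) ^ (((n + J + 1 : ℕ) : ℤ) * (d : ℝ) / 2 : ℝ))⁻¹ •
      (unitCube d).indicator (periodizedDilTrans ψ ((n + J + 1 : ℕ) : ℤ) (k (n + J + 1)))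
        (((2 : ℝ) ^ ((n + J + 1 : ℕ) : ℤ))⁻¹ • y -
          (-(((2 : ℝ) ^ ((n + J + 1 : ℕ) : ℤ))⁻¹ • latticePoint (k (n + J + 1)))))
  refine aestronglyMeasurable_of_tendsto_ae atTop (f := G) (fun n => ?_) ?_
  · have h1 := (((aestronglyMeasurable_indicator_iff measurableSet_unitCube).2
      (hm (n + J + 1) (by omega) (by omega))).comp_quasiMeasurePreserving
      (quasiMeasurePreserving_smul_sub (t := ((2 : ℝ) ^ ((n + J + 1 : ℕ) : ℤ))⁻¹) (by positivity)
        (-(((2 : ℝ) ^ ((n + J + 1 : ℕ) : ℤ))⁻¹ • latticePoint (k (n + J + 1)))))).const_smul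
      ((2 : ℝ) ^ (((n + J + 1 : ℕ) : ℤ) * (d : ℝ) / 2 : ℝ))⁻¹
    exact h1
  refine Eventually.of_forall fun y => ?_
  have hGy : ∀ᶠ n : ℕ in atTop, G n y =
      ∑' z : Fin d → ℤ, ψ (y + (2 : ℝ) ^ (n + J + 1) • latticePoint z) := by
    filter_upwards [(tendsto_two_pow_mul (one_pos : (0 : ℝ) < 1)).eventually_ge_atTop ‖y‖] with n hn
    simp only [G]
    set j := n + J + 1 with hj
    have hp : (0 : ℝ) < 2 ^ j := by positivity
    have hyj : ‖y‖ ≤ 2 ^ (j - 1) := by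
      refine hn.trans ?_
      rw [mul_one]
      exact pow_le_pow_right₀ (by norm_num) (by omega)
    have hmem : ((2 : ℝ) ^ (j : ℤ))⁻¹ • y - (-(((2 : ℝ) ^ (j : ℤ))⁻¹ • latticePoint (k j))) ∈
        unitCube d := by
      intro i
      have h1 := abs_le.1 ((abs_apply_le_norm y i).trans hyj)
      have h2 : (((2 : ℝ) ^ (j : ℤ))⁻¹ • y - (-(((2 : ℝ) ^ (j : ℤ))⁻¹ • latticePoint (k j))) : E d) i
          = (y i + 2 ^ (j - 1)) / 2 ^ j := by
        simp [latticePoint_apply, k]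
        ring
      have h3 : (2 : ℝ) ^ j = 2 * 2 ^ (j - 1) := by
        rw [← pow_succ']; congr 1
      rw [h2]
      constructor
      · apply div_nonneg _ hp.le
        linarith
      · rw [div_le_one hp, h3]
        linarith
    rw [Set.indicator_of_mem hmem, periodizedDilTrans, ← tsum_const_smul'']
    refine tsum_congr fun z => ?_
    rw [dilTrans_add_latticePoint, dilTrans, inv_smul_smul₀ (by positivity), latticePoint_sub,
      latticePoint_two_pow_smul, sub_neg_eq_add, smul_add, smul_inv_smul₀ (by positivity),
      smul_inv_smul₀ (by positivity)]
    congr 1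
    abel
  refine Tendsto.congr' (EventuallyEq.symm hGy) ?_
  -- The terms with z ≠ 0 vanish in the limit; since m > d, the localization supplies a summable
  -- bound.
  have hlim := tendsto_tsum_of_dominated_convergence (𝓕 := atTop)
    (f := fun (n : ℕ) (z : Fin d → ℤ) => ψ (y + (2 : ℝ) ^ (n + J + 1) • latticePoint z))
    (g := fun z => if z = 0 then ψ y else 0)
    (bound := fun z => C * (1 + ‖y‖) ^ m * (1 + ‖(latticePoint z : E d)‖) ^ (-m)) ?_ ?_ ?_
  · rwa [tsum_ite_eq] at hlim
  · refine Summable.mul_left _ ?_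
    have h1 := ENNReal.summable_toReal
      (tsum_lattice_one_add_norm_rpow_ne_top hd (by linarith : (d : ℝ) < m))
    refine h1.congr fun z => ENNReal.toReal_ofReal (by positivity)
  · intro z
    by_cases hz : z = 0
    · subst hz
      have : (latticePoint 0 : E d) = 0 := by ext i; simp [latticePoint_apply]
      simp [this]
    · simp only [hz, if_false]
      rw [tendsto_zero_iff_norm_tendsto_zero]
      have hz1 : 1 ≤ ‖(latticePoint z : E d)‖ := by
        have := one_le_norm_latticePoint_sub hz
        have h0 : (latticePoint 0 : E d) = 0 := by ext i; simp [latticePoint_apply]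
        rwa [h0, sub_zero] at this
      have hlim : Tendsto (fun n : ℕ => C * ((2 : ℝ) ^ n * 1 - ‖y‖) ^ (-m)) atTop (nhds 0) := by
        have h1 : Tendsto (fun n : ℕ => (2 : ℝ) ^ n * 1 - ‖y‖) atTop atTop :=
          tendsto_atTop_add_const_right _ _ (tendsto_two_pow_mul one_pos)
        simpa using ((tendsto_rpow_neg_atTop hm0).comp h1).const_mul C
      refine squeeze_zero' (Eventually.of_forall fun _ => norm_nonneg _) ?_ hlim
      filter_upwards [(tendsto_two_pow_mul (one_pos : (0 : ℝ) < 1)).eventually_gt_atTop ‖y‖]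
        with n hn
      refine (hC _).trans ?_
      gcongr 1
      refine Real.rpow_le_rpow_of_nonpos (by linarith) ?_ (by linarith)
      have h2 : ‖(2 : ℝ) ^ (n + J + 1) • (latticePoint z : E d)‖ ≤
          ‖y + (2 : ℝ) ^ (n + J + 1) • latticePoint z‖ + ‖y‖ := by
        have := norm_sub_le (y + (2 : ℝ) ^ (n + J + 1) • latticePoint z) y
        rwa [add_sub_cancel_left] at this
      rw [norm_smul, Real.norm_of_nonneg (by positivity)] at h2
      have h3 : (2 : ℝ) ^ n ≤ 2 ^ (n + J + 1) := pow_le_pow_right₀ (by norm_num) (by omega)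
      have h4 : (2 : ℝ) ^ n * 1 ≤ 2 ^ (n + J + 1) * ‖(latticePoint z : E d)‖ := by gcongr
      linarith
  · refine Eventually.of_forall fun n z => (hC _).trans ?_
    rw [mul_assoc]
    gcongr 1
    set w : E d := (2 : ℝ) ^ (n + J + 1) • latticePoint z
    have h1 : ‖(latticePoint z : E d)‖ ≤ ‖w‖ := by
      rw [norm_smul, Real.norm_of_nonneg (by positivity)]
      exact le_mul_of_one_le_left (norm_nonneg _) (one_le_pow₀ (by norm_num))
    have h2 : ‖w‖ ≤ ‖y + w‖ + ‖y‖ := by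
      have := norm_sub_le (y + w) y
      rwa [add_sub_cancel_left] at this
    calc (1 + ‖y + w‖) ^ (-m) = (1 + ‖y‖) ^ m * ((1 + ‖y‖) * (1 + ‖y + w‖)) ^ (-m) := by
          rw [Real.mul_rpow (by positivity) (by positivity), Real.rpow_neg (by positivity),
            Real.rpow_neg (by positivity)]
          field_simp
      _ ≤ _ := by
          gcongr 1
          refine Real.rpow_le_rpow_of_nonpos (by positivity) ?_ (by linarith)
          nlinarith [norm_nonneg y, norm_nonneg (y + w)]

theorem sparse_of_finite [Finite ι] (hd : 2 ≤ d) (c : ι → ℂ) : Sparse d c := by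
  have := Fintype.ofFinite ι
  refine sparse_of_tsum_rpow hd zero_le_one le_rfl ?_
  rw [tsum_fintype]
  simp

theorem norm_inner_cube {x₀ : E d} {ρ : ℝ} (hsub : Metric.ball x₀ ρ ⊆ unitCube d) {u f : L2Cube d}
    (hf : f =ᵐ[volume.restrict (unitCube d)] (Metric.ball x₀ ρ).indicator fun _ => (1 : ℂ))
    {g : E d → ℂ} (hu : u =ᵐ[volume.restrict (unitCube d)] g) :
    ‖inner ℂ u f‖ = ‖∫ x in Metric.ball x₀ ρ, g x‖ := by
  rw [norm_inner_indicator_eq measurableSet_ball hf hu, Measure.restrict_restrict_of_subset hsub]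

theorem periodizedDilTrans_ae_eq_zero {ψ : E d → ℂ} (h : ψ =ᵐ[volume] 0) (j : ℤ)
    (k : Fin d → ℤ) : periodizedDilTrans ψ j k =ᵐ[volume] 0 := by
  have h1 : ∀ z : Fin d → ℤ, ∀ᵐ x : E d, dilTrans ψ j k (x + latticePoint z) = 0 := fun z =>
    (measurePreserving_add_right volume (latticePoint z : E d)).quasiMeasurePreserving.ae
      (dilTrans_ae_eq_zero h j k)
  filter_upwards [ae_all_iff.2 h1] with x hx
  simp [periodizedDilTrans, hx]

theorem bestNTermRate_per (hd : 2 ≤ d) {x₀ : E d} {ρ : ℝ} (hρ : 0 < ρ)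
    (hsub : Metric.ball x₀ ρ ⊆ unitCube d) {f : L2Cube d}
    (hf : f =ᵐ[volume.restrict (unitCube d)] (Metric.ball x₀ ρ).indicator fun _ => (1 : ℂ))
    {φ φ' : ι → L2Cube d} (hφ : IsRieszBasis φ) (hb : IsBiorthogonal φ' φ) {r q J : ℕ}
    (hq : 0 < q) (e : PerIndex d r q J ≃ ι) (h : IsPerSystem (φ' ∘ e)) :
    BestNTermRate φ f (1 / ((d : ℝ) - 1)) := by
  have hx₀ := center_bounds_of_ball_subset hsub hρ
  have hρ2 : ρ ≤ 1 / 2 := by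
    have := hx₀ ⟨0, by omega⟩
    linarith
  obtain ⟨ψ, hψ, hψe⟩ := h
  have hint : ∀ l, Integrable (ψ l) := by
    refine fun l => (hψ l).integrable
      ((hψ l).aestronglyMeasurable_of_periodized hd (J := J) fun j hj hj1 => ?_)
    have hlt : 2 ^ (j - 1) < 2 ^ j := Nat.pow_lt_pow_right (by norm_num) (by omega)
    have h1 := (Lp.aestronglyMeasurable _).congr (hψe ⟨j, hj⟩ l fun _ => ⟨2 ^ (j - 1), hlt⟩)
    simpa using h1
  let a : Fin q → ℕ → (Fin d → ℤ) → (Fin d → ℤ) → ℂ := fun l j k z =>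
    ∫ x in Metric.ball x₀ ρ, dilTrans (ψ l) j (k - (2 : ℤ) ^ j • z) x
  let F : Fin q → ℕ → (Fin d → ℤ) → ℂ := fun l j k =>
    ∫ x in Metric.ball ((2 : ℝ) ^ j • x₀ - latticePoint k) (2 ^ j * ρ), ψ l x
  have haF : ∀ l j k z, ‖a l j k z‖ = 2 ^ (-(d / 2 * (j : ℕ)) : ℝ) *
      ‖F l j (k - (2 : ℤ) ^ j • z)‖ := by
    intro l j k z
    have := norm_integral_ball_dilTrans (ψ l) j (k - (2 : ℤ) ^ j • z) x₀ ρ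
    rwa [zpow_natCast, Int.cast_natCast] at this
  have hFsum : ∀ l j k, ∑' z, ‖F l j (k - (2 : ℤ) ^ j • z)‖ₑ ≤ ∫⁻ x, ‖ψ l x‖ₑ := fun l j k =>
    (ENNReal.tsum_le_tsum fun z => enorm_integral_le_lintegral_enorm _).trans
      (tsum_lintegral_translate_le hρ hρ2 j k _)
  have hasum : ∀ l j k, Summable (a l j k) := by
    intro l j k
    refine Summable.of_norm ?_
    have h1 := ENNReal.summable_toReal (ne_top_of_le_ne_top
      (hasFiniteIntegral_iff_enorm.1 (hint l).2).ne (hFsum l j k))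
    refine (h1.mul_left (2 ^ (-(d / 2 * (j : ℕ)) : ℝ))).congr fun z => ?_
    rw [toReal_enorm, ← haF]
  have hcoef : ∀ (j : {j : ℕ // J ≤ j}) l k, ‖inner ℂ (φ' (e (Sum.inr ⟨j, l, k⟩))) f‖ =
      ‖∑' z, a l j (fun i => ((k i : ℕ) : ℤ)) z‖ := by
    intro j l k
    have h1 := norm_inner_cube hsub hf (hψe j l k)
    rw [setIntegral_periodizedDilTrans (hint l) hρ hρ2] at h1
    exact h1
  have htracks : ∀ l, Tracks x₀ ρ (fun i => inner ℂ (φ' i) f) (ψ l) := by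
    intro l a₀ ha₀
    have hfin : ∀ (j : ℕ) (n : ℕ), min n (2 ^ j - 1) < 2 ^ j := fun j n => by
      have : 0 < 2 ^ j := by positivity
      omega
    -- Truncation to {0, …, 2^j - 1} serves only to define the index everywhere; it is the identity
    -- under the margin condition.
    have hrange : ∀ j (k : Fin d → ℤ), Margin a₀ j k → ∀ i,
        ((min (k i).toNat (2 ^ j - 1) : ℕ) : ℤ) = k i := by
      intro j k hk i
      have hp : (0 : ℝ) < 2 ^ j := by positivity
      have h1 : (0 : ℝ) < k i := lt_of_lt_of_le (by positivity) (hk i).1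
      have h2 : (k i : ℝ) < 2 ^ j := lt_of_le_of_lt (hk i).2 (by nlinarith)
      have h1' : 0 < k i := by exact_mod_cast h1
      have h2' : k i < ((2 ^ j : ℕ) : ℤ) := by
        push_cast; exact_mod_cast h2
      omega
    refine ⟨J, fun p => e (Sum.inr ⟨⟨max J p.1, le_max_left _ _⟩, l,
      fun i => ⟨min (p.2 i).toNat (2 ^ (max J p.1) - 1), hfin _ _⟩⟩), ?_, fun ε hε => ?_⟩
    · rintro ⟨j, k⟩ ⟨hj, hk⟩ ⟨j', k'⟩ ⟨hj', hk'⟩ heq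
      dsimp only at hj hj' hk hk'
      have h1 := Sum.inr.inj (e.injective heq)
      have hjj : j = j' := by
        have := congrArg (fun s => (s.1 : ℕ)) h1
        simp only at this
        omega
      subst hjj
      simp only [Sigma.mk.injEq, heq_eq_eq, Prod.mk.injEq, true_and] at h1
      rw [Prod.mk.injEq]
      refine ⟨rfl, funext fun i => ?_⟩
      have h2 := congrArg (fun n : Fin (2 ^ (max J j)) => ((n : ℕ) : ℤ)) (congrFun h1 i)
      simp only [max_eq_right hj] at h2
      rwa [hrange j k hk i, hrange j k' hk' i] at h2
    · obtain ⟨R, hR, hRε⟩ := exists_setIntegral_norm_ge_lt (hint l) hε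
      filter_upwards [eventually_ge_atTop J, (tendsto_two_pow_mul ha₀).eventually_ge_atTop R]
        with j hj hjR k hk
      have hp : (0 : ℝ) < 2 ^ j := by positivity
      have h1 := hcoef ⟨max J j, le_max_left _ _⟩ l
        (fun i => ⟨min (k i).toNat (2 ^ (max J j) - 1), hfin _ _⟩)
      have h2 : (fun i => ((min (k i).toNat (2 ^ (max J j) - 1) : ℕ) : ℤ)) = k := by
        rw [max_eq_right hj]
        exact funext (hrange j k hk)
      rw [h2] at h1
      have h3 : max J j = j := max_eq_right hj
      have h4 : ‖∑' z, a l (max J j) k z‖ = ‖∑' z, a l j k z‖ := by rw [h3]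
      rw [h1, h4]
      -- The term z = 0 is the tracked integral. The others only see ψ beyond radius `R`, on
      -- disjoint sets, hence at most `ε` in total after normalization.
      have hsplit := (hasum l j k).tsum_eq_add_tsum_ite 0
      have htail : ∑' z : Fin d → ℤ, ‖(if z = 0 then 0 else a l j k z)‖ₑ ≤
          (2 : ℝ≥0∞) ^ (-(d / 2 * (j : ℕ)) : ℝ) * ENNReal.ofReal ε := by
        calc _ ≤ ∑' z : Fin d → ℤ, (2 : ℝ≥0∞) ^ (-(d / 2 * (j : ℕ)) : ℝ) *
              ∫⁻ x in Metric.ball ((2 : ℝ) ^ j • x₀ -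
                latticePoint (k - (2 : ℤ) ^ j • z)) (2 ^ j * ρ),
                  {x | R ≤ ‖x‖}.indicator (fun x => ‖ψ l x‖ₑ) x := by
              refine ENNReal.tsum_le_tsum fun z => ?_
              by_cases hz : z = 0
              · simp [hz]
              · simp only [hz, if_false]
                rw [enorm_eq_of_norm_eq (haF l j k z)]
                gcongr
                refine (enorm_integral_le_lintegral_enorm _).trans (le_of_eq ?_)
                refine setLIntegral_congr_fun measurableSet_ball fun x hx => ?_
                have hxR : x ∈ {x : E d | R ≤ ‖x‖} :=
                  hjR.trans (mem_ball_translate_of_ne hsub hk hz hx)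
                rw [Set.indicator_of_mem hxR]
          _ ≤ (2 : ℝ≥0∞) ^ (-(d / 2 * (j : ℕ)) : ℝ) *
              ∫⁻ x, {x | R ≤ ‖x‖}.indicator (fun x => ‖ψ l x‖ₑ) x := by
              rw [ENNReal.tsum_mul_left]
              gcongr
              exact tsum_lintegral_translate_le hρ hρ2 j k _
          _ ≤ _ := by
              gcongr
              rw [lintegral_indicator (measurableSet_le (by fun_prop) (by fun_prop)),
                ← ofReal_integral_norm_eq_lintegral_enorm (hint l).integrableOn]
              exact ENNReal.ofReal_le_ofReal hRε.le
      have hreal : ‖a l j k 0‖ ≤ ‖∑' z, a l j k z‖ + 2 ^ (-(d / 2 * (j : ℕ)) : ℝ) * ε := by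
        have h5 : ‖∑' z : Fin d → ℤ, (if z = 0 then 0 else a l j k z)‖ ≤
            2 ^ (-(d / 2 * (j : ℕ)) : ℝ) * ε := by
          have h6 := enorm_tsum_le_tsum_enorm.trans htail
          rw [← ofReal_norm, ← ENNReal.ofReal_ofNat 2, ENNReal.ofReal_rpow_of_pos (by norm_num),
            ← ENNReal.ofReal_mul (by positivity),
            ENNReal.ofReal_le_ofReal_iff (by positivity)] at h6
          exact h6
        have h7 : a l j k 0 = (∑' z, a l j k z) -
            ∑' z : Fin d → ℤ, (if z = 0 then 0 else a l j k z) := by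
          rw [hsplit]; ring
        rw [h7]
        exact (norm_sub_le _ _).trans (by gcongr)
      have h0 : Real.sqrt ((2 ^ j) ^ d) * ‖a l j k 0‖ = ‖F l j (k - (2 : ℤ) ^ j • 0)‖ :=
        sqrt_two_pow_mul (haF l j k 0)
      rw [smul_zero, sub_zero] at h0
      have h8 : Real.sqrt ((2 ^ j) ^ d) * (2 : ℝ) ^ (-(d / 2 * (j : ℕ)) : ℝ) = 1 := by
        have := sqrt_two_pow_mul (d := d) (j := j)
          (z := (((2 : ℝ) ^ (-(d / 2 * (j : ℕ)) : ℝ) : ℝ) : ℂ)) (w := 1)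
          (by rw [Complex.norm_real, Real.norm_of_nonneg (by positivity), mul_one])
        rwa [Complex.norm_real, Real.norm_of_nonneg (by positivity)] at this
      have h9 := mul_le_mul_of_nonneg_left hreal (Real.sqrt_nonneg ((2 ^ j) ^ d))
      rw [h0, mul_add, ← mul_assoc, h8, one_mul] at h9
      simp only [F] at h9
      linarith
  obtain ⟨M, hM⟩ := hφ.sum_inner_sq_le hb f
  have : Infinite ι := Infinite.of_injective
    (fun n : ℕ => e (Sum.inr ⟨⟨J + n, by omega⟩, ⟨0, hq⟩, fun _ => ⟨0, by positivity⟩⟩))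
    fun n n' h => by
      have h1 := Sum.inr.inj (e.injective h)
      have := congrArg (fun s => (s.1 : ℕ)) h1
      simp only at this
      omega
  refine bestNTermRate_of_sparse_of_abundant hφ hb hd f ?_ ?_
  · refine Sparse.of_cover (L := Unit ⊕ Fin q)
      (κ := Sum.elim (fun _ => Fin r)
        fun _ => Σ j : {j : ℕ // J ≤ j}, (Fin d → Fin (2 ^ (j : ℕ))))
      (Sum.rec (fun _ a => e (Sum.inl a)) fun l p => e (Sum.inr ⟨p.1, l, p.2⟩)) (fun i => ?_) ?_
    · rcases hi : e.symm i with n | ⟨j, l, k⟩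
      · exact ⟨Sum.inl (), n, by rw [← e.apply_symm_apply i, hi]⟩
      · exact ⟨Sum.inr l, ⟨j, k⟩, by rw [← e.apply_symm_apply i, hi]⟩
    rintro (_ | l)
    · exact sparse_of_finite (ι := Fin r) hd _
    · have hmean := (htracks l).integral_eq_zero hd hρ hx₀ (hint l) hM
      refine BallDecay.sparse (β := {j : ℕ // J ≤ j}) (lev := fun j => (j : ℕ)) (Z := Fin d → ℤ)
        (K := fun j => Fin d → Fin (2 ^ (j : ℕ)))
        (g := fun j k z => (fun i => ((k i : ℕ) : ℤ)) - (2 : ℤ) ^ (j : ℕ) • z)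
        (I := ∫⁻ x, ‖ψ l x‖ₑ) Subtype.val_injective hd hρ ((hψ l).ballDecay hd hρ (hint l) hmean)
        x₀ ?_ (hasFiniteIntegral_iff_enorm.1 (hint l).2).ne ?_ ?_
      · rintro j ⟨k, z⟩ ⟨k', z'⟩ h
        have h1 : ∀ i, ((k i : ℕ) : ℤ) - 2 ^ (j : ℕ) * z i =
            ((k' i : ℕ) : ℤ) - 2 ^ (j : ℕ) * z' i := fun i => by
          simpa using congrFun h i
        -- In k - 2^j z the entries of `k` are the residues modulo 2^j, so they and `z` are
        -- determined.
        have h2 : ∀ i, k i = k' i ∧ z i = z' i := by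
          intro i
          have hk := (k i).2
          have hk' := (k' i).2
          have hmod : ((k i : ℕ) : ℤ) = ((k' i : ℕ) : ℤ) := by
            have e1 : ((k i : ℕ) : ℤ) % (2 ^ (j : ℕ) : ℤ) = ((k' i : ℕ) : ℤ) % (2 ^ (j : ℕ) : ℤ) := by
              have : ((k i : ℕ) : ℤ) = ((k' i : ℕ) : ℤ) + 2 ^ (j : ℕ) * (z i - z' i) := by
                linarith [h1 i]
              rw [this, Int.add_mul_emod_self_left]
            rwa [Int.emod_eq_of_lt (by positivity) (by exact_mod_cast hk),
              Int.emod_eq_of_lt (by positivity) (by exact_mod_cast hk')] at e1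
          refine ⟨Fin.ext (by exact_mod_cast hmod), ?_⟩
          have e2 := h1 i
          rw [hmod] at e2
          have : (2 ^ (j : ℕ) : ℤ) * z i = 2 ^ (j : ℕ) * z' i := by linarith
          exact mul_left_cancel₀ (by positivity) this
        exact Prod.ext (funext fun i => (h2 i).1) (funext fun i => (h2 i).2)
      · intro j k
        have h1 := hcoef j l k
        have h2 : ‖inner ℂ (φ' (e (Sum.inr ⟨j, l, k⟩))) f‖ₑ =
            ‖∑' z, a l j (fun i => ((k i : ℕ) : ℤ)) z‖ₑ := by
          rw [← ofReal_norm, h1, ofReal_norm]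
        refine (le_of_eq h2).trans (enorm_tsum_le_tsum_enorm.trans ?_)
        rw [← ENNReal.tsum_mul_left]
        exact ENNReal.tsum_le_tsum fun z => (enorm_eq_of_norm_eq (haF l j _ z)).le
      · intro j k
        exact hFsum l j _
  · refine (htracks ⟨0, hq⟩).abundant hd hρ hx₀ (hint _) fun h0 => ?_
    refine isBiorthogonal_dual_ne_zero hb
      (e (Sum.inr ⟨⟨J, le_rfl⟩, ⟨0, hq⟩, fun _ => ⟨0, by positivity⟩⟩)) ?_
    exact (Lp.eq_zero_iff_ae_eq_zero).2 ((hψe _ _ _).trans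
      (ae_restrict_of_ae (periodizedDilTrans_ae_eq_zero h0 _ _)))

end Periodic

/-! ### Boundary adapted wavelet bases of `L²([0,1]^d)` -/

section Boundary

variable {d : ℕ} {ι : Type*}

theorem norm_le_of_mem_unitCube {x : E d} (hx : x ∈ unitCube d) : ‖x‖ ≤ d * 1 :=
  norm_le_mul_of_abs_le zero_le_one fun i => abs_le.2 ⟨by linarith [(hx i).1], (hx i).2⟩

theorem volume_unitCube_lt_top : volume (unitCube d) < ∞ :=
  ((Metric.isBounded_closedBall (x := (0 : E d)) (r := d * 1)).subset fun _ hx =>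
    mem_closedBall_zero_iff.2 (norm_le_of_mem_unitCube hx)).measure_lt_top

theorem dilTrans_eq_zero_of_notMem_unitCube {ψ : E d → ℂ} {R j : ℕ}
    (hψ : ∀ x, ψ x ≠ 0 → ∀ i, |x i| ≤ R) (k : InteriorIndex d R j) {x : E d}
    (hx : x ∉ unitCube d) : dilTrans ψ (j : ℤ) k x = 0 := by
  by_contra hne
  refine hx fun i => ?_
  have hp : (0 : ℝ) < 2 ^ j := by positivity
  have h0 : ψ ((2 : ℝ) ^ (j : ℤ) • x - latticePoint k) ≠ 0 :=
    fun h => hne (by rw [dilTrans, h, smul_zero])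
  have h1 := abs_le.1 (hψ _ h0 i)
  rw [PiLp.sub_apply, PiLp.smul_apply, latticePoint_apply, smul_eq_mul, zpow_natCast] at h1
  have h2 : (R : ℝ) ≤ ((k : Fin d → ℤ) i : ℝ) := by exact_mod_cast (k.2 i).1
  have h3 : ((k : Fin d → ℤ) i : ℝ) ≤ 2 ^ j - R := by exact_mod_cast (k.2 i).2
  constructor
  · by_contra! h
    nlinarith
  · by_contra! h
    nlinarith

/-- One interior wavelet suffices: it is in L², hence in L¹, of the cube, and its dilated generator
vanishes outside the cube. -/
theorem integrable_of_interior {ψ : E d → ℂ} {R j : ℕ} (hψ : ∀ x, ψ x ≠ 0 → ∀ i, |x i| ≤ R)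
    (k : InteriorIndex d R j) {u : L2Cube d}
    (hu : u =ᵐ[volume.restrict (unitCube d)] dilTrans ψ (j : ℤ) k) : Integrable ψ := by
  have : IsFiniteMeasure ((volume : Measure (E d)).restrict (unitCube d)) :=
    ⟨by rw [Measure.restrict_apply_univ]; exact volume_unitCube_lt_top⟩
  have h1 : IntegrableOn (dilTrans ψ (j : ℤ) k) (unitCube d) :=
    ((Lp.memLp u).integrable (by norm_num)).congr hu
  rw [← integrable_dilTrans_iff (j := (j : ℤ)) (k := k)]
  refine (integrable_indicator_iff measurableSet_unitCube |>.2 h1).congr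
    (Eventually.of_forall fun x => ?_)
  by_cases hx : x ∈ unitCube d
  · rw [Set.indicator_of_mem hx]
  · rw [Set.indicator_of_notMem hx, dilTrans_eq_zero_of_notMem_unitCube hψ k hx]

/-- The coefficient of a ball for a function supported in `S`. -/
theorem enorm_inner_le_of_support {x₀ : E d} {ρ : ℝ} {u f : L2Cube d}
    (hf : f =ᵐ[volume.restrict (unitCube d)] (Metric.ball x₀ ρ).indicator fun _ => (1 : ℂ))
    {S : Set (E d)} (hS : MeasurableSet S)
    (hu : ∀ᵐ x ∂(volume.restrict (unitCube d)), u x ≠ 0 → x ∈ S) :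
    ‖inner ℂ u f‖ₑ ≤ ‖u‖ₑ * volume S ^ (1 / 2 : ℝ) := by
  set μ := (volume : Measure (E d)).restrict (unitCube d) with hμ
  have h1 := norm_inner_indicator_eq measurableSet_ball hf (ae_eq_refl (u : E d → ℂ))
  rw [← ofReal_norm, h1, ofReal_norm]
  calc ‖∫ x in Metric.ball x₀ ρ, u x ∂μ‖ₑ ≤ ∫⁻ x in Metric.ball x₀ ρ, ‖u x‖ₑ ∂μ :=
        enorm_integral_le_lintegral_enorm _
    _ ≤ ∫⁻ x, ‖u x‖ₑ ∂μ := setLIntegral_le_lintegral _ _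
    _ = ∫⁻ x in S, ‖u x‖ₑ ∂μ := by
        rw [← lintegral_indicator hS]
        refine lintegral_congr_ae ?_
        filter_upwards [hu] with x hx
        by_cases hxS : x ∈ S
        · rw [Set.indicator_of_mem hxS]
        · rw [Set.indicator_of_notMem hxS, enorm_eq_zero]
          by_contra h
          exact hxS (hx h)
    _ = eLpNorm u 1 (μ.restrict S) := by rw [eLpNorm_one_eq_lintegral_enorm]
    _ ≤ eLpNorm u 2 (μ.restrict S) * (μ.restrict S) Set.univ ^
          (1 / (1 : ℝ≥0∞).toReal - 1 / (2 : ℝ≥0∞).toReal) :=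
        eLpNorm_le_eLpNorm_mul_rpow_measure_univ (by norm_num)
          (Lp.aestronglyMeasurable u).restrict
    _ ≤ _ := by
        have h2 : 1 / (1 : ℝ≥0∞).toReal - 1 / (2 : ℝ≥0∞).toReal = (1 / 2 : ℝ) := by norm_num
        rw [h2, Lp.enorm_def, Measure.restrict_apply_univ]
        exact mul_le_mul' (eLpNorm_mono_measure _ Measure.restrict_le_self)
          (ENNReal.rpow_le_rpow (Measure.restrict_apply_le _ _) (by norm_num))

/-- The part of the unit cube within distance `ρ 2^{-j}` of `y + ℤ^d` has measure
`O(2^{-jd})`. -/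
theorem exists_cover_lattice_neighbourhood (ρ : ℝ) :
    ∃ C : ℝ≥0∞, C ≠ ∞ ∧ ∀ (j : ℕ) (y : E d), y ∈ unitCube d → ∃ S : Set (E d), MeasurableSet S ∧
      volume S ≤ C * (2 : ℝ≥0∞) ^ (-(d * j) : ℝ) ∧ ∀ x ∈ unitCube d,
        (∃ z : Fin d → ℤ, ‖x - (y + latticePoint z)‖ ≤ ρ * ((2 : ℝ) ^ j)⁻¹) → x ∈ S := by
  -- As `x` and `y` both lie in the cube, only lattice shifts with |z i| ≤ 1 + |ρ| occur, and their
  -- number does not depend on `j`.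
  set n : ℤ := ⌈1 + |ρ|⌉
  set T : Finset (Fin d → ℤ) := Fintype.piFinset fun _ => Finset.Icc (-n) n
  refine ⟨T.card * (ENNReal.ofReal (|ρ| ^ d) * volume (Metric.ball (0 : E d) 1)),
    ENNReal.mul_ne_top (ENNReal.natCast_ne_top _)
      (ENNReal.mul_ne_top ENNReal.ofReal_ne_top measure_ball_lt_top.ne), fun j y hy =>
    ⟨⋃ z ∈ T, Metric.closedBall (y + latticePoint z) (|ρ| * ((2 : ℝ) ^ j)⁻¹),
      T.measurableSet_biUnion fun _ _ => measurableSet_closedBall, ?_, ?_⟩⟩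
  · refine (measure_biUnion_finset_le _ _).trans ?_
    have hball : ∀ z : Fin d → ℤ,
        volume (Metric.closedBall (y + latticePoint z) (|ρ| * ((2 : ℝ) ^ j)⁻¹)) =
          ENNReal.ofReal (|ρ| ^ d) * volume (Metric.ball (0 : E d) 1) *
            (2 : ℝ≥0∞) ^ (-(d * j) : ℝ) := by
      intro z
      have h1 : (((2 : ℝ) ^ j)⁻¹) ^ d = (2 : ℝ) ^ (-(d * j) : ℝ) := by
        rw [Real.rpow_neg (by norm_num), inv_pow, ← pow_mul, ← Real.rpow_natCast, Nat.cast_mul,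
          mul_comm]
      rw [Measure.addHaar_closedBall _ _ (by positivity), finrank_euclideanSpace_fin, mul_pow, h1,
        ENNReal.ofReal_mul (by positivity), ← ENNReal.ofReal_rpow_of_pos (by norm_num),
        ENNReal.ofReal_ofNat]
      ring
    simp_rw [hball]
    rw [Finset.sum_const, nsmul_eq_mul]
    exact le_of_eq (by ring)
  · rintro x hx ⟨z, hz⟩
    have hr : ρ * ((2 : ℝ) ^ j)⁻¹ ≤ |ρ| * ((2 : ℝ) ^ j)⁻¹ := by
      gcongr
      exact le_abs_self ρ
    have hr1 : |ρ| * ((2 : ℝ) ^ j)⁻¹ ≤ |ρ| :=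
      mul_le_of_le_one_right (abs_nonneg ρ)
        (inv_le_one_of_one_le₀ (one_le_pow₀ (by norm_num)))
    refine Set.mem_biUnion (x := z) ?_ (mem_closedBall_iff_norm.2 (hz.trans hr))
    rw [Finset.mem_coe, Fintype.mem_piFinset]
    intro i
    have h1 := abs_le.1 ((abs_apply_le_norm _ i).trans (hz.trans (hr.trans hr1)))
    rw [PiLp.sub_apply, PiLp.add_apply, latticePoint_apply] at h1
    have hn : 1 + |ρ| ≤ (n : ℝ) := Int.le_ceil _
    have hxi := hx i
    have hyi := hy i
    rw [Finset.mem_Icc]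
    constructor
    · have : (-n : ℝ) ≤ z i := by linarith
      exact_mod_cast this
    · have : (z i : ℝ) ≤ n := by linarith
      exact_mod_cast this

/-- Number and support suffice: there are O(2^{j(d-1)}) boundary wavelets per scale, and
Cauchy–Schwarz on a support of measure O(2^{-jd}) bounds each coefficient by O(2^{-jd/2}). Any s in
(0, 1) would do; 1/2 is chosen. -/
theorem sparse_boundary (hd : 2 ≤ d) {x₀ : E d} {ρ : ℝ} {f : L2Cube d}
    (hf : f =ᵐ[volume.restrict (unitCube d)] (Metric.ball x₀ ρ).indicator fun _ => (1 : ℂ))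
    {J : ℕ} {b : ℕ → ℕ} {C : ℕ} (hC : ∀ j, b j ≤ C * 2 ^ (j * (d - 1)))
    {u : (Σ j : {j : ℕ // J ≤ j}, Fin (b j)) → L2Cube d} {M : ℝ} (hM : ∀ p, ‖u p‖ ≤ M) {ρ' : ℝ}
    (hu : ∀ (j : {j : ℕ // J ≤ j}) (β : Fin (b j)), ∃ y ∈ frontier (unitCube d),
      ∀ᵐ x ∂(volume.restrict (unitCube d)), u ⟨j, β⟩ x ≠ 0 →
        ∃ z : Fin d → ℤ, ‖x - (y + latticePoint z)‖ ≤ ρ' * ((2 : ℝ) ^ (j : ℕ))⁻¹) :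
    Sparse d fun p => inner ℂ (u p) f := by
  obtain ⟨D, hD, hcover⟩ := exists_cover_lattice_neighbourhood (d := d) ρ'
  set A : ℝ≥0∞ := ENNReal.ofReal M * D ^ (1 / 2 : ℝ) with hA
  have hAtop : A ≠ ∞ :=
    ENNReal.mul_ne_top ENNReal.ofReal_ne_top (ENNReal.rpow_ne_top_of_nonneg (by norm_num) hD)
  have hcoef : ∀ (j : {j : ℕ // J ≤ j}) (β : Fin (b j)),
      ‖inner ℂ (u ⟨j, β⟩) f‖ₑ ≤ A * (2 : ℝ≥0∞) ^ (-(d / 2 * (j : ℕ)) : ℝ) := by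
    intro j β
    obtain ⟨y, hy, hyu⟩ := hu j β
    obtain ⟨S, hS, hvol, hmem⟩ := hcover j y (isClosed_unitCube.frontier_subset hy)
    have h1 : ∀ᵐ x ∂(volume.restrict (unitCube d)), u ⟨j, β⟩ x ≠ 0 → x ∈ S := by
      filter_upwards [hyu, ae_restrict_mem measurableSet_unitCube] with x hx hxc hne
      exact hmem x hxc (hx hne)
    refine (enorm_inner_le_of_support hf hS h1).trans ?_
    calc _ ≤ ENNReal.ofReal M * (D * (2 : ℝ≥0∞) ^ (-(d * (j : ℕ)) : ℝ)) ^ (1 / 2 : ℝ) := by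
          gcongr
          rw [← ofReal_norm]
          exact ENNReal.ofReal_le_ofReal (hM _)
      _ = _ := by
          rw [ENNReal.mul_rpow_of_nonneg _ _ (by norm_num), ← ENNReal.rpow_mul, ← mul_assoc, ← hA]
          congr 2
          ring
  refine sparse_of_levels (β := {j : ℕ // J ≤ j}) (lev := fun j => (j : ℕ)) (s := 1 / 2)
    (C := C * A ^ (1 / 2 : ℝ) + A) Subtype.val_injective hd (by norm_num) (by norm_num)
    (ENNReal.add_ne_top.2 ⟨ENNReal.mul_ne_top (ENNReal.natCast_ne_top _)
      (ENNReal.rpow_ne_top_of_nonneg (by norm_num) hAtop), hAtop⟩) (fun j => ?_) fun j β => ?_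
  · have hb : (b j : ℝ≥0∞) ≤ C * (2 : ℝ≥0∞) ^ ((d - 1) * (j : ℕ) : ℝ) := by
      have h1 : (2 : ℝ≥0∞) ^ ((d - 1) * (j : ℕ) : ℝ) = 2 ^ ((j : ℕ) * (d - 1)) := by
        rw [← ENNReal.rpow_natCast, Nat.cast_mul, Nat.cast_sub (by omega), Nat.cast_one, mul_comm]
      rw [h1]
      exact_mod_cast hC j
    calc _ ≤ ∑' _ : Fin (b j), (A * (2 : ℝ≥0∞) ^ (-(d / 2 * (j : ℕ)) : ℝ)) ^ (1 / 2 : ℝ) := by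
          refine ENNReal.tsum_le_tsum fun β => ?_
          gcongr
          exact hcoef j β
      _ = b j * (A ^ (1 / 2 : ℝ) * (2 : ℝ≥0∞) ^ (-(d / 2 * (j : ℕ)) * (1 / 2) : ℝ)) := by
          rw [tsum_fintype, Finset.sum_const, Finset.card_univ, Fintype.card_fin, nsmul_eq_mul,
            ENNReal.mul_rpow_of_nonneg _ _ (by norm_num), ← ENNReal.rpow_mul]
      _ ≤ C * (2 : ℝ≥0∞) ^ ((d - 1) * (j : ℕ) : ℝ) *
            (A ^ (1 / 2 : ℝ) * (2 : ℝ≥0∞) ^ (-(d / 2 * (j : ℕ)) * (1 / 2) : ℝ)) := by gcongr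
      _ = C * A ^ (1 / 2 : ℝ) * ((2 : ℝ≥0∞) ^ ((d - 1) * (j : ℕ) : ℝ) *
            (2 : ℝ≥0∞) ^ (-(d / 2 * (j : ℕ)) * (1 / 2) : ℝ)) := by ring
      _ = C * A ^ (1 / 2 : ℝ) * (2 : ℝ≥0∞) ^ ((d - 1 - d * (1 / 2) / 2) * (j : ℕ) : ℝ) := by
          rw [← two_rpow_add]
          congr 2
          ring
      _ ≤ _ := by
          gcongr
          exact le_self_add
  · refine (hcoef j β).trans ?_
    gcongr
    exact le_add_self

theorem bestNTermRate_bdry (hd : 2 ≤ d) {x₀ : E d} {ρ : ℝ} (hρ : 0 < ρ)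
    (hsub : Metric.ball x₀ ρ ⊆ unitCube d) {f : L2Cube d}
    (hf : f =ᵐ[volume.restrict (unitCube d)] (Metric.ball x₀ ρ).indicator fun _ => (1 : ℂ))
    {φ φ' : ι → L2Cube d} (hφ : IsRieszBasis φ) (hb : IsBiorthogonal φ' φ) {r q J R : ℕ}
    {b : ℕ → ℕ} (hq : 0 < q) (hbC : ∃ C : ℕ, ∀ j, b j ≤ C * 2 ^ (j * (d - 1)))
    (e : BdryIndex d r q J R b ≃ ι) (h : IsBdrySystem (φ' ∘ e)) :
    BestNTermRate φ f (1 / ((d : ℝ) - 1)) := by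
  classical
  have hx₀ := center_bounds_of_ball_subset hsub hρ
  obtain ⟨⟨ψ, hψ, hψe⟩, ρ', hρ'⟩ := h
  obtain ⟨C, hC⟩ := hbC
  -- Coarse scales may have no interior translations. From scale J + 2R on, (R, …, R) is one; it
  -- yields integrability of ψ, infinitely many indices and a nonzero generator.
  have hlarge : ∀ n : ℕ, (R : ℤ) ≤ 2 ^ (J + 2 * R + n) - R := by
    intro n
    have h1 : J + 2 * R + n < 2 ^ (J + 2 * R + n) := Nat.lt_two_pow_self
    have h2 : ((J + 2 * R + n : ℕ) : ℤ) < 2 ^ (J + 2 * R + n) := by exact_mod_cast h1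
    push_cast at h2
    omega
  let corner : ∀ n : ℕ, InteriorIndex d R (J + 2 * R + n) := fun n =>
    ⟨fun _ => R, fun _ => ⟨le_rfl, hlarge n⟩⟩
  let i₀ : Fin q → ℕ → ι := fun l n =>
    e (Sum.inr ⟨⟨J + 2 * R + n, by omega⟩, Sum.inl (l, corner n)⟩)
  have hint : ∀ l, Integrable (ψ l) := fun l =>
    integrable_of_interior (hψ l) (corner 0) (hψe ⟨J + 2 * R + 0, by omega⟩ l (corner 0))
  have hcoef : ∀ (j : {j : ℕ // J ≤ j}) l (k : InteriorIndex d R j),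
      ‖inner ℂ (φ' (e (Sum.inr ⟨j, Sum.inl (l, k)⟩))) f‖ = 2 ^ (-(d / 2 * (j : ℕ)) : ℝ) *
        ‖∫ x in Metric.ball ((2 : ℝ) ^ (j : ℕ) • x₀ - latticePoint k) (2 ^ (j : ℕ) * ρ), ψ l x‖ := by
    intro j l k
    have h1 := norm_inner_cube hsub hf (hψe j l k)
    rw [norm_integral_ball_dilTrans, zpow_natCast, Int.cast_natCast] at h1
    exact h1
  have htracks : ∀ l, Tracks x₀ ρ (fun i => inner ℂ (φ' i) f) (ψ l) := by
    intro l
    refine tracks_of_norm_eq fun a ha => ?_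
    obtain ⟨j₁, hj₁⟩ := eventually_atTop.1
      ((tendsto_two_pow_mul ha).eventually_ge_atTop (R : ℝ))
    have hint' : ∀ j (k : Fin d → ℤ), max J j₁ ≤ j → Margin a j k →
        J ≤ j ∧ ∀ i, (R : ℤ) ≤ k i ∧ k i ≤ 2 ^ j - (R : ℤ) := by
      intro j k hj hk
      refine ⟨(le_max_left _ _).trans hj, fun i => ?_⟩
      have h1 := hj₁ j ((le_max_right _ _).trans hj)
      obtain ⟨h2, h3⟩ := hk i
      have h4 : (R : ℝ) ≤ k i := by linarith
      have h5 : (k i : ℝ) ≤ 2 ^ j - R := by linarith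
      exact ⟨by exact_mod_cast h4, by exact_mod_cast h5⟩
    -- From scale `j₁` on the margin exceeds `R`, so the translations in question are interior;
    -- elsewhere `i₀ l 0` is a dummy value.
    refine ⟨max J j₁, fun p => if hp : J ≤ p.1 ∧ ∀ i, (R : ℤ) ≤ p.2 i ∧ p.2 i ≤ 2 ^ p.1 - (R : ℤ)
      then e (Sum.inr ⟨⟨p.1, hp.1⟩, Sum.inl (l, ⟨p.2, hp.2⟩)⟩) else i₀ l 0, ?_, ?_⟩
    · rintro ⟨j, k⟩ ⟨hj, hk⟩ ⟨j', k'⟩ ⟨hj', hk'⟩ heq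
      simp only [dif_pos (hint' j k hj hk), dif_pos (hint' j' k' hj' hk')] at heq
      have h1 := Sum.inr.inj (e.injective heq)
      have hjj : j = j' := congrArg (fun s => (s.1 : ℕ)) h1
      subst hjj
      simpa using h1
    · intro j k hj hk
      simp only [dif_pos (hint' j k hj hk)]
      exact hcoef ⟨j, (hint' j k hj hk).1⟩ l ⟨k, (hint' j k hj hk).2⟩
  obtain ⟨M, hM⟩ := hφ.sum_inner_sq_le hb f
  obtain ⟨M', -, hM'⟩ := hφ.exists_norm_dual_le hb
  have : Infinite ι := Infinite.of_injective (i₀ ⟨0, hq⟩) fun n n' h => by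
    have h1 := Sum.inr.inj (e.injective h)
    have h2 : J + 2 * R + n = J + 2 * R + n' := congrArg (fun s => (s.1 : ℕ)) h1
    omega
  refine bestNTermRate_of_sparse_of_abundant hφ hb hd f ?_ ?_
  · refine Sparse.of_cover (L := Unit ⊕ Fin q ⊕ Unit)
      (κ := Sum.elim (fun _ => Fin r) (Sum.elim
        (fun _ => Σ j : {j : ℕ // J ≤ j}, InteriorIndex d R j)
        fun _ => Σ j : {j : ℕ // J ≤ j}, Fin (b j)))
      (Sum.rec (fun _ a => e (Sum.inl a)) (Sum.rec
        (fun l p => e (Sum.inr ⟨p.1, Sum.inl (l, p.2)⟩))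
        fun _ p => e (Sum.inr ⟨p.1, Sum.inr p.2⟩))) (fun i => ?_) ?_
    · rcases hi : e.symm i with n | ⟨j, ⟨l, k⟩ | β⟩
      · exact ⟨Sum.inl (), n, by rw [← e.apply_symm_apply i, hi]⟩
      · exact ⟨Sum.inr (Sum.inl l), ⟨j, k⟩, by rw [← e.apply_symm_apply i, hi]⟩
      · exact ⟨Sum.inr (Sum.inr ()), ⟨j, β⟩, by rw [← e.apply_symm_apply i, hi]⟩
    rintro (_ | l | _)
    · exact sparse_of_finite (ι := Fin r) hd _
    · have hmean := (htracks l).integral_eq_zero hd hρ hx₀ (hint l) hM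
      refine BallDecay.sparse (β := {j : ℕ // J ≤ j}) (lev := fun j => (j : ℕ)) (Z := Unit)
        (K := fun j => InteriorIndex d R j) (g := fun _ k _ => k) (I := ∫⁻ x, ‖ψ l x‖ₑ)
        Subtype.val_injective hd hρ (ballDecay_of_support hρ (hint l) hmean
          (R := d * R) (by positivity)
          fun x hx => norm_le_mul_of_abs_le (by positivity) (hψ l x hx)) x₀ ?_
        (hasFiniteIntegral_iff_enorm.1 (hint l).2).ne ?_ ?_
      · rintro j ⟨k, _⟩ ⟨k', _⟩ h
        exact Prod.ext (Subtype.ext h) rfl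
      · intro j k
        rw [tsum_fintype, Fintype.sum_unique]
        exact (enorm_eq_of_norm_eq (hcoef j l k)).le
      · intro j k
        rw [tsum_fintype, Fintype.sum_unique]
        exact enorm_setIntegral_le_lintegral_enorm _ _
    · exact sparse_boundary (u := fun p => φ' (e (Sum.inr ⟨p.1, Sum.inr p.2⟩))) hd hf hC
        (fun _ => hM' _) hρ'
  · refine (htracks ⟨0, hq⟩).abundant hd hρ hx₀ (hint _) fun h0 => ?_
    refine isBiorthogonal_dual_ne_zero hb (i₀ ⟨0, hq⟩ 0) ?_
    exact (Lp.eq_zero_iff_ae_eq_zero).2 ((hψe _ _ _).trans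
      (ae_restrict_of_ae (dilTrans_ae_eq_zero h0 _ _)))

end Boundary

end WaveletApprox

theorem mainTheorem8 (d : ℕ) (hd : d = 2 ∨ d = 3)
    (x₀ : WaveletApprox.E d) (ρ : ℝ) (hρ : 0 < ρ) (B : Set (WaveletApprox.E d))
    (hB : B = Metric.ball x₀ ρ ∨ B = Metric.closedBall x₀ ρ)
    (hBcube : B ⊆ WaveletApprox.unitCube d) :
    (∀ {ι : Type*} (φ : ι → WaveletApprox.L2Space d), WaveletApprox.IsWaveletBasisSpace φ →
      ∀ f : WaveletApprox.L2Space d, f =ᵐ[volume] B.indicator (fun _ => (1 : ℂ)) →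
        WaveletApprox.BestNTermRate φ f (1 / ((d : ℝ) - 1))) ∧
    (∀ {ι : Type*} (φ : ι → WaveletApprox.L2Cube d), WaveletApprox.IsWaveletBasisCube φ →
      ∀ f : WaveletApprox.L2Cube d,
        f =ᵐ[volume.restrict (WaveletApprox.unitCube d)] B.indicator (fun _ => (1 : ℂ)) →
        WaveletApprox.BestNTermRate φ f (1 / ((d : ℝ) - 1))) := by
  have hd2 : 2 ≤ d := by omega
  have hball : B.indicator (fun _ => (1 : ℂ)) =ᵐ[volume]
      (Metric.ball x₀ ρ).indicator fun _ => (1 : ℂ) :=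
    WaveletApprox.indicator_ball_ae_eq hρ hB _
  have hsub : Metric.ball x₀ ρ ⊆ WaveletApprox.unitCube d := by
    refine Set.Subset.trans ?_ hBcube
    rcases hB with rfl | rfl
    · exact subset_rfl
    · exact Metric.ball_subset_closedBall
  have hx₀ := WaveletApprox.center_bounds_of_ball_subset hsub hρ
  refine ⟨fun φ hφ f hf => ?_, fun φ hφ f hf => ?_⟩
  · have hf' := hf.trans hball
    obtain ⟨hφ, φ', hb, ⟨q, hq, e, -, h⟩ | ⟨r, q, J, hq, e, -, h⟩⟩ := hφ
    · exact WaveletApprox.bestNTermRate_hom hd2 hρ hx₀ hf' hφ hb hq e h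
    · exact WaveletApprox.bestNTermRate_inhom hd2 hρ hx₀ hf' hφ hb hq e h
  · have hf' := hf.trans (ae_restrict_of_ae hball)
    obtain ⟨hφ, φ', hb, ⟨r, q, J, hq, e, -, h⟩ | ⟨r, q, J, R, b, hq, hbC, e, -, h⟩⟩ := hφ
    · exact WaveletApprox.bestNTermRate_per hd2 hρ hsub hf' hφ hb hq e h
    · exact WaveletApprox.bestNTermRate_bdry hd2 hρ hsub hf' hφ hb hq hbC e h
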